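/- Let $H\in(1/4,1)$, $d\ge 0$, and $\theta_i>0$, $\sigma_i>0$, $\mu_i\in\mathbb R$ for $1\le i\le d$. Let $X=(X^1,\dots,X^d)$, indexed by $[0,\infty)$, be the stationary fractional Ornstein--Uhlenbeck process with independent coordinates: $X$ is a continuous, strictly stationary process whose coordinates are independent and satisfy $$dX^i_t=-\theta_i(X^i_t-\mu_i)\,dt+\sigma_i\,dB^{H,i}_t,$$ where $B^{H,1},\dots,B^{H,d}$ are independent fractional Brownian motions with Hurst parameter $H$. Let $\tilde X_t=X_t-X_0$ be the centered increment process, let $R^i(\tau)=\operatorname{Cov}(X^i_0,X^i_\tau)$, and let $\Delta>0$. The level-2 signature $S^{(2)}=(S^{(2)}_{ij})_{i,j\le d}$ of $\tilde X$ over $[0,\Delta]$ is the $L^2$-limit of the iterated integrals $\int_{0<u_1<u_2<\Delta}d\tilde X^{i,D}_{u_1}\,d\tilde X^{j,D}_{u_2}$ of the piecewise-linear interpolations $\tilde X^D$ of $\tilde X$, along every sequence of dissections $D$ of $[0,\Delta]$ with mesh tending to zero. For $p>\max(2,1/H)$, a canonical geometric $p$-rough path lift of $\tilde X$ over $[0,\Delta]$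 is a limit in probability, in rough path $p$-variation (levels $1,\dots,\lfloor p\rfloor$), of the lifts of the $\tilde X^D$ along every such sequence. Put $$f_i(\lambda)=\frac{\lambda^{1-2H}}{\theta_i^2+\lambda^2}\quad(\lambda>0),\qquad \zeta_i=\frac{\sigma_i^2\,\Gamma(2H+1)}{2\theta_i^{2H}\cdot 2\int_0^\infty f_i(\lambda)\,d\lambda}.$$ Then: 1. The level-2 signature $S^{(2)}$ exists and is unique up to null sets; its entries are integrable, and $$\mathbb E\bigl[S^{(2)}_{ij}\bigr]=\begin{cases}v_i:=R^i(0)-R^i(\Delta)&\text{if } i=j,\\ 0&\text{if } i\ne j.\end{cases}$$ 2. For every $p>\max(2,1/H)$, the level-2 component over $[0,\Delta]$ of every canonical geometric $p$-rough path lift of $\tilde X$ over $[0,\Delta]$ is this $S^{(2)}$; in particular it is integrable with the same expectation. 3. All $X^i_t$ are square integrable, $f_i$ and $\lambda\mapsto(1-\cos(\lambda\Delta))f_i(\lambda)$ are integrable on $(0,\infty)$, and $$v_i=R^i(0)-R^i(\Delta)=2\zeta_i\int_0^\infty(1-\cos(\lambda\Delta))\,f_i(\lambda)\,d\lambda .$$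 -/

import Mathlib

open MeasureTheory ProbabilityTheory Filter Topology
open scoped NNReal ENNReal

noncomputable section

/-! ### Fractional Brownian motion and the stationary fractional Ornstein-Uhlenbeck process -/

/-- A real fractional Brownian motion with Hurst index `H`, indexed by `[0, ∞)`: a centered Gaussian
process with covariance `(s^{2H} + t^{2H} - |s - t|^{2H}) / 2` and almost surely continuous paths. -/
structure IsFBM {Ω : Type*} [MeasurableSpace Ω] (P : Measure Ω) (H : ℝ)
    (B : ℝ≥0 → Ω → ℝ) : Prop where
  measurable : ∀ t, Measurable (B t)
  gaussian : IsGaussianProcess B P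
  mean_zero : ∀ t, ∫ ω, B t ω ∂P = 0
  covariance : ∀ s t, cov[B s, B t; P] =
    ((s : ℝ) ^ (2 * H) + (t : ℝ) ^ (2 * H) - |(s : ℝ) - (t : ℝ)| ^ (2 * H)) / 2
  continuous : ∀ᵐ ω ∂P, Continuous fun t => B t ω

/-- Strict stationarity of an `ℝ^d`-valued process `X = (X^1, …, X^d)` indexed by `[0, ∞)`:
the joint law of any finite family of time marginals is invariant under time shifts. -/
def IsStrictlyStationary {Ω : Type*} [MeasurableSpace Ω] (P : Measure Ω) {d : ℕ}
    (X : Fin d → ℝ≥0 → Ω → ℝ) : Prop :=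
  ∀ (τ : ℝ≥0) (n : ℕ) (t : Fin n → ℝ≥0),
    IdentDistrib (fun ω (k : Fin n) (i : Fin d) => X i (τ + t k) ω)
      (fun ω (k : Fin n) (i : Fin d) => X i (t k) ω) P P

/-- `X` is the stationary `d`-dimensional fractional Ornstein-Uhlenbeck process with independent
coordinates, driven by the independent fractional Brownian motions `B^1, …, B^d`: a continuous,
strictly stationary solution of `dX^i = -θ_i (X^i - μ_i) dt + σ_i dB^i`. -/
structure IsStationaryFOU {Ω : Type*} [MeasurableSpace Ω] (P : Measure Ω) (H : ℝ) {d : ℕ}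
    (θ μ σ : Fin d → ℝ) (B X : Fin d → ℝ≥0 → Ω → ℝ) : Prop where
  fbm : ∀ i, IsFBM P H (B i)
  indep_noise : iIndepFun (fun i ω (t : ℝ≥0) => B i t ω) P
  measurable : ∀ i t, Measurable (X i t)
  continuous : ∀ i, ∀ᵐ ω ∂P, Continuous fun t => X i t ω
  equation : ∀ i, ∀ᵐ ω ∂P, ∀ t : ℝ≥0,
    X i t ω = X i 0 ω - θ i * (∫ s in (0 : ℝ)..t, (X i s.toNNReal ω - μ i)) + σ i * B i t ω
  stationary : IsStrictlyStationary P X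
  indep_coord : iIndepFun (fun i ω (t : ℝ≥0) => X i t ω) P

/-- The autocovariance `R^i(τ) = Cov(X^i_0, X^i_τ)` of a coordinate of a stationary process. -/
def autocov {Ω : Type*} [MeasurableSpace Ω] (P : Measure Ω) {d : ℕ}
    (X : Fin d → ℝ≥0 → Ω → ℝ) (i : Fin d) (τ : ℝ≥0) : ℝ :=
  cov[X i 0, X i τ; P]

/-- The sample path of the centered increment process `X̃_t = X_t - X_0`. -/
def incrPath {Ω : Type*} {d : ℕ} (X : Fin d → ℝ≥0 → Ω → ℝ) (ω : Ω) : Fin d → ℝ → ℝ :=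
  fun i u => X i u.toNNReal ω - X i 0 ω

/-- The unnormalized spectral density `f(l) = l^{1-2H} / (θ² + l²)`, `l > 0`. -/
def fouSpectral (H θ l : ℝ) : ℝ := l ^ (1 - 2 * H) / (θ ^ 2 + l ^ 2)

/-- The normalization `ζ = σ² Γ(2H+1) / (2 θ^{2H} · 2 ∫_0^∞ f(l) dl)`. -/
def fouZeta (H θ σ : ℝ) : ℝ :=
  σ ^ 2 * Real.Gamma (2 * H + 1) /
    (2 * θ ^ (2 * H) * (2 * ∫ l in Set.Ioi (0 : ℝ), fouSpectral H θ l))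

/-! ### Iterated integrals of piecewise-linear interpolations -/

/-- A dissection `0 = t_0 < t_1 < ⋯ < t_n = T` of `[0, T]`. -/
structure Dissection (T : ℝ) where
  /-- number of cells -/
  n : ℕ
  /-- the nodes -/
  pt : Fin (n + 1) → ℝ
  strictMono : StrictMono pt
  first : pt 0 = 0
  last : pt (Fin.last n) = T

/-- The mesh `max_k (t_{k+1} - t_k)` of a dissection. -/
def Dissection.mesh {T : ℝ} (D : Dissection T) : ℝ :=
  ⨆ k : Fin D.n, (D.pt k.succ - D.pt k.castSucc)

/-- The piecewise-linear interpolation of a real path at the nodes of `D`: on `[t_k, t_{k+1}]` it is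
`x(t_k) + (x(t_{k+1}) - x(t_k)) (u - t_k) / (t_{k+1} - t_k)`. -/
def plInterp {T : ℝ} (D : Dissection T) (x : ℝ → ℝ) (u : ℝ) : ℝ :=
  x 0 + ∑ k : Fin D.n, (x (D.pt k.succ) - x (D.pt k.castSucc)) *
    max 0 (min 1 ((u - D.pt k.castSucc) / (D.pt k.succ - D.pt k.castSucc)))

/-- The signature coordinate `∫_{s < u_1 < ⋯ < u_m < t} dx^{i_1}_{u_1} ⋯ dx^{i_m}_{u_m}` of a
piecewise-linear (or piecewise smooth) path `x`, for the word `i_1 … i_m`: integrate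
`dx^{i_1}_{u_1}` over `[s, t]` against the coordinate of `i_2 … i_m` over `[u_1, t]`. -/
def iterInt {d : ℕ} (x : Fin d → ℝ → ℝ) : List (Fin d) → ℝ → ℝ → ℝ
  | [], _, _ => 1
  | i :: w, s, t => ∫ u in s..t, deriv (x i) u * iterInt x w u t

/-- The signature coordinate, over `[s, t]` and along the word `w`, of the piecewise-linear
interpolation at the nodes of `D` of the path `x`. -/
def plSig {d : ℕ} {T : ℝ} (D : Dissection T) (x : Fin d → ℝ → ℝ) (s t : ℝ) (w : List (Fin d)) : ℝ :=
  iterInt (fun i => plInterp D (x i)) w s t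

/-! ### The level-2 signature and the canonical rough path lift -/

/-- `S` is the level-2 signature over `[0, T]` of the increments of `X`: the `L²` limit of the
level-2 iterated integrals of the piecewise-linear interpolations, along every sequence of
dissections of `[0, T]` whose mesh tends to zero. -/
def IsLevelTwoSignature {Ω : Type*} [MeasurableSpace Ω] (P : Measure Ω) {d : ℕ}
    (X : Fin d → ℝ≥0 → Ω → ℝ) (T : ℝ) (S : Fin d → Fin d → Ω → ℝ) : Prop :=
  ∀ i j, MemLp (S i j) 2 P ∧
    ∀ D : ℕ → Dissection T, Tendsto (fun n => (D n).mesh) atTop (𝓝 0) →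
      Tendsto (fun n => eLpNorm (fun ω => plSig (D n) (incrPath X ω) 0 T [i, j] - S i j ω) 2 P)
        atTop (𝓝 0)

/-- The (inhomogeneous) rough path `p`-variation distance on `[0, T]` of two two-parameter
functionals with values in the truncated tensor algebra of degree `⌊p⌋`, given by their
coordinates along words: level `k` is measured in `p/k`-variation. -/
def pVarDist {d : ℕ} (p T : ℝ) (A B : ℝ → ℝ → List (Fin d) → ℝ) : ℝ≥0∞ :=
  ⨆ (w : List (Fin d)) (_ : 1 ≤ w.length ∧ w.length ≤ ⌊p⌋₊) (D : Dissection T),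
    (∑ k : Fin D.n, ENNReal.ofReal
      |A (D.pt k.castSucc) (D.pt k.succ) w - B (D.pt k.castSucc) (D.pt k.succ) w|
        ^ (p / w.length)) ^ ((w.length : ℝ) / p)

/-- `L` is the canonical geometric `p`-rough path lift over `[0, T]` of the increments of the
Gaussian process `X`: the limit in probability, in rough path `p`-variation, of the canonical lifts
of the piecewise-linear interpolations, along every sequence of dissections with mesh tending to
zero. (Being such a limit, `L` is almost surely a geometric `p`-rough path above the increments of
`X`.) -/
def IsCanonicalLift {Ω : Type*} [MeasurableSpace Ω] (P : Measure Ω) {d : ℕ}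
    (X : Fin d → ℝ≥0 → Ω → ℝ) (p T : ℝ) (L : Ω → ℝ → ℝ → List (Fin d) → ℝ) : Prop :=
  (∀ s t w, Measurable fun ω => L ω s t w) ∧
  ∀ D : ℕ → Dissection T, Tendsto (fun n => (D n).mesh) atTop (𝓝 0) →
    ∀ ε : ℝ≥0∞, 0 < ε → Tendsto
      (fun n => P {ω | ε ≤ pVarDist p T (plSig (D n) (incrPath X ω)) (L ω)}) atTop (𝓝 0)

end

/-! Let `v t = R 0 - R t` be half the variance function of a coordinate. Integrating the equation
and taking variances turns stationarity into the integral equation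
`v t + θ ^ 2 ∫₀ᵗ ∫₀ˢ R = σ ^ 2 t ^ (2 H) / 2` for the autocovariance `R`. It has at most one bounded
solution, since a bounded `D` with `D t = D 0 + θ ^ 2 ∫₀ᵗ ∫₀ˢ D` is a multiple of `cosh (θ t)`, and
the spectral integral solves it. The equation also shows that the covariances of increments are
dominated by the rectangular increments of `t ^ α`, `α = min (2 H) (3 / 4)`.

Off the diagonal, the iterated integral of the interpolation along a dissection is a trapezoidal
sum. Refining a cell changes it by a Lévy area, whose second moment is a double sum of products of
covariances because the coordinates are independent; it contributes a multiple of the cell length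
to the power `2 α`. As `2 α > 1`, which is the condition `H > 1 / 4`, the sums are Cauchy in `L²`.
On the diagonal the sum is `(X_Δ - X_0) ^ 2 / 2` for every dissection. Expectations pass to the
limit, and the rough path distance dominates the level-2 coordinate over `[0, Δ]` through the
one-cell dissection. -/

section RectangularIncrements

/-- The increment of the kernel `(u, v) ↦ φ (v - u)` over the rectangle `[a, b] × [c, d]`. If `φ` is
half the variance function of a process with stationary increments, this is minus the covariance of
the increments of the process over `[a, b]` and `[c, d]`. -/
def rectIncr (φ : ℝ → ℝ) (a b c d : ℝ) : ℝ := φ (c - a) + φ (d - b) - φ (c - b) - φ (d - a)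

lemma sum_Ico_rectIncr_right (φ : ℝ → ℝ) (s : ℕ → ℝ) (a b : ℝ) {l m : ℕ} (h : l ≤ m) :
    ∑ q ∈ Finset.Ico l m, rectIncr φ a b (s q) (s (q + 1)) = rectIncr φ a b (s l) (s m) := by
  have telescope := Finset.sum_Ico_sub (fun q => φ (s q - b) - φ (s q - a)) h
  simp only [rectIncr]
  rw [Finset.sum_congr rfl fun q _ => show _ =
    φ (s (q + 1) - b) - φ (s (q + 1) - a) - (φ (s q - b) - φ (s q - a)) by ring, telescope]
  ring

lemma sum_Ico_rectIncr_left (φ : ℝ → ℝ) (s : ℕ → ℝ) (c d : ℝ) {l m : ℕ} (h : l ≤ m) :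
    ∑ q ∈ Finset.Ico l m, rectIncr φ (s q) (s (q + 1)) c d = rectIncr φ (s l) (s m) c d := by
  have telescope := Finset.sum_Ico_sub (fun q => φ (d - s q) - φ (c - s q)) h
  simp only [rectIncr]
  rw [Finset.sum_congr rfl fun q _ => show _ =
    φ (d - s (q + 1)) - φ (c - s (q + 1)) - (φ (d - s q) - φ (c - s q)) by ring, telescope]
  ring

lemma concaveOn_add_le_add {f : ℝ → ℝ} {S : Set ℝ} (hf : ConcaveOn ℝ S f) {x a b : ℝ}
    (ha : 0 ≤ a) (hb : 0 ≤ b) (hx : x ∈ S) (hy : x + a + b ∈ S) :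
    f x + f (x + a + b) ≤ f (x + a) + f (x + b) := by
  rcases (add_nonneg ha hb).eq_or_lt with h | h
  · obtain rfl : a = 0 := by linarith
    obtain rfl : b = 0 := by linarith
    simp
  have hw : b / (a + b) + a / (a + b) = 1 := by field_simp; ring
  have hxa := hf.2 hx hy (div_nonneg hb h.le) (div_nonneg ha h.le) hw
  have hxb := hf.2 hx hy (div_nonneg ha h.le) (div_nonneg hb h.le) ((add_comm _ _).trans hw)
  simp only [smul_eq_mul] at hxa hxb
  rw [show b / (a + b) * x + a / (a + b) * (x + a + b) = x + a by field_simp; ring] at hxa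
  rw [show a / (a + b) * x + b / (a + b) * (x + a + b) = x + b by field_simp; ring] at hxb
  rw [eq_sub_of_add_eq hw] at hxa hxb
  linarith

lemma rectIncr_nonneg {φ : ℝ → ℝ} (hφ : ConcaveOn ℝ (Set.Ici 0) φ) {a b c d : ℝ} (hab : a ≤ b)
    (hbc : b ≤ c) (hcd : c ≤ d) : 0 ≤ rectIncr φ a b c d := by
  have := concaveOn_add_le_add hφ (x := c - b) (a := b - a) (b := d - c) (sub_nonneg.2 hab)
    (sub_nonneg.2 hcd) (sub_nonneg.2 hbc) (by rw [Set.mem_Ici]; linarith)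
  rw [show c - b + (b - a) + (d - c) = d - a by ring, show c - b + (b - a) = c - a by ring,
    show c - b + (d - c) = d - b by ring] at this
  unfold rectIncr
  linarith

lemma rectIncr_le_rectIncr {φ : ℝ → ℝ} (hφ : ConcaveOn ℝ (Set.Ici 0) φ) {a a' b' b c c' d' d : ℝ}
    (haa' : a ≤ a') (hab' : a' ≤ b') (hbb' : b' ≤ b) (hbc : b ≤ c) (hcc' : c ≤ c') (hcd' : c' ≤ d')
    (hdd' : d' ≤ d) : rectIncr φ a' b' c' d' ≤ rectIncr φ a b c d := by
  have hcd : c ≤ d := hcc'.trans (hcd'.trans hdd')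
  have hbc' : b' ≤ c := hbb'.trans hbc
  have left := rectIncr_nonneg hφ haa' (hab'.trans hbc') hcd
  have right := rectIncr_nonneg hφ hbb' hbc hcd
  have below := rectIncr_nonneg hφ hab' hbc' hcc'
  have above := rectIncr_nonneg hφ hab' (hbc'.trans (hcc'.trans hcd')) hdd'
  unfold rectIncr at *
  linarith

/-- The properties of `φ t = t ^ α`, `1 / 2 < α < 1`, on which the area estimate for processes with
variance function of order `φ` rests. -/
structure IsRoughModulus (φ : ℝ → ℝ) (K : ℝ) : Prop where
  map_zero : φ 0 = 0
  monotoneOn : MonotoneOn φ (Set.Ici 0)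
  concaveOn : ConcaveOn ℝ (Set.Ici 0) φ
  sq_add_sq_le : ∀ ⦃u v : ℝ⦄, 0 ≤ u → 0 ≤ v → φ u ^ 2 + φ v ^ 2 ≤ φ (u + v) ^ 2
  const_nonneg : 0 ≤ K
  gap_mul_rectIncr_le : ∀ ⦃a b c d : ℝ⦄, a ≤ b → b ≤ c → c ≤ d →
    φ (c - b) * rectIncr φ a b c d ≤ K * -rectIncr (φ ^ 2) a b c d

namespace IsRoughModulus
variable {φ : ℝ → ℝ} {K : ℝ}

lemma nonneg (hφ : IsRoughModulus φ K) {t : ℝ} (ht : 0 ≤ t) : 0 ≤ φ t :=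
  hφ.map_zero ▸ hφ.monotoneOn Set.self_mem_Ici ht ht

lemma le_of_le (hφ : IsRoughModulus φ K) {t u : ℝ} (ht : 0 ≤ t) (htu : t ≤ u) : φ t ≤ φ u :=
  hφ.monotoneOn ht (ht.trans htu) htu

lemma add_le (hφ : IsRoughModulus φ K) {t u : ℝ} (ht : 0 ≤ t) (hu : 0 ≤ u) :
    φ (t + u) ≤ φ t + φ u := by
  have := concaveOn_add_le_add hφ.concaveOn (x := 0) ht hu Set.self_mem_Ici
    (by rw [zero_add]; exact add_nonneg ht hu)
  simpa only [zero_add, hφ.map_zero] using this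

lemma rectIncr_le_left (hφ : IsRoughModulus φ K) {a b c d : ℝ} (hab : a ≤ b) (hbc : b ≤ c)
    (hcd : c ≤ d) : rectIncr φ a b c d ≤ φ (b - a) := by
  have adjacent := rectIncr_le_rectIncr hφ.concaveOn le_rfl hab le_rfl le_rfl hbc hcd le_rfl
  have mono := hφ.le_of_le (sub_nonneg.2 (hbc.trans hcd)) (sub_le_sub_left hab d)
  refine adjacent.trans ?_
  simp only [rectIncr, sub_self, hφ.map_zero]
  linarith

lemma rectIncr_le_right (hφ : IsRoughModulus φ K) {a b c d : ℝ} (hab : a ≤ b) (hbc : b ≤ c)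
    (hcd : c ≤ d) : rectIncr φ a b c d ≤ φ (d - c) := by
  have adjacent := rectIncr_le_rectIncr hφ.concaveOn le_rfl hab hbc le_rfl le_rfl hcd le_rfl
  have mono := hφ.le_of_le (sub_nonneg.2 (hab.trans hbc)) (sub_le_sub_right hcd a)
  refine adjacent.trans ?_
  simp only [rectIncr, sub_self, hφ.map_zero]
  linarith

section Grid
variable {s : ℕ → ℝ} {l m : ℕ}

lemma sum_sq_le (hφ : IsRoughModulus φ K) (hs : Monotone s) (h : l ≤ m) :
    ∑ p ∈ Finset.Ico l m, φ (s (p + 1) - s p) ^ 2 ≤ φ (s m - s l) ^ 2 := by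
  induction m, h using Nat.le_induction with
  | base => simp [hφ.map_zero]
  | succ n hn ih =>
    rw [Finset.sum_Ico_succ_top hn]
    refine (add_le_add_left ih _).trans ((hφ.sq_add_sq_le (sub_nonneg.2 (hs hn))
      (sub_nonneg.2 (hs n.le_succ))).trans_eq ?_)
    rw [sub_add_sub_cancel']

lemma sum_sum_neg_rectIncr_sq_le (hφ : IsRoughModulus φ K) (h : l ≤ m) :
    ∑ p ∈ Finset.Ico l m, ∑ q ∈ Finset.Ico (p + 1) m,
      -rectIncr (φ ^ 2) (s p) (s (p + 1)) (s q) (s (q + 1)) ≤ φ (s m - s l) ^ 2 := by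
  have row : ∀ p ∈ Finset.Ico l m, ∑ q ∈ Finset.Ico (p + 1) m,
      -rectIncr (φ ^ 2) (s p) (s (p + 1)) (s q) (s (q + 1)) ≤
        -φ (s m - s (p + 1)) ^ 2 - -φ (s m - s p) ^ 2 := by
    intro p hp
    rw [Finset.sum_neg_distrib, sum_Ico_rectIncr_right _ s _ _ (Finset.mem_Ico.1 hp).2]
    simp only [rectIncr, sub_self, Pi.pow_apply, hφ.map_zero]
    linarith [sq_nonneg (φ (s (p + 1) - s p))]
  refine (Finset.sum_le_sum row).trans_eq ?_
  rw [Finset.sum_Ico_sub (fun p => -φ (s m - s p) ^ 2) h, sub_self, hφ.map_zero]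
  ring

lemma sum_sum_rectIncr_mul_left_le (hφ : IsRoughModulus φ K) (hs : Monotone s) (h : l ≤ m) :
    ∑ p ∈ Finset.Ico l m, ∑ q ∈ Finset.Ico (p + 1) m,
      rectIncr φ (s p) (s (p + 1)) (s q) (s (q + 1)) * φ (s (p + 1) - s p) ≤
        φ (s m - s l) ^ 2 := by
  refine (Finset.sum_le_sum fun p hp => ?_).trans (hφ.sum_sq_le hs h)
  have hpm : p + 1 ≤ m := (Finset.mem_Ico.1 hp).2
  rw [← Finset.sum_mul, sum_Ico_rectIncr_right _ s _ _ hpm, sq]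
  exact mul_le_mul_of_nonneg_right (hφ.rectIncr_le_left (hs p.le_succ) le_rfl (hs hpm))
    (hφ.nonneg (sub_nonneg.2 (hs p.le_succ)))

lemma sum_sum_rectIncr_mul_right_le (hφ : IsRoughModulus φ K) (hs : Monotone s) (h : l ≤ m) :
    ∑ p ∈ Finset.Ico l m, ∑ q ∈ Finset.Ico (p + 1) m,
      rectIncr φ (s p) (s (p + 1)) (s q) (s (q + 1)) * φ (s (q + 1) - s q) ≤
        φ (s m - s l) ^ 2 := by
  rw [Finset.sum_comm' (t' := Finset.Ico l m) (s' := fun q => Finset.Ico l q)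
    (by intro p q; simp only [Finset.mem_Ico]; omega)]
  refine (Finset.sum_le_sum fun q hq => ?_).trans (hφ.sum_sq_le hs h)
  have hlq : l ≤ q := (Finset.mem_Ico.1 hq).1
  rw [← Finset.sum_mul, sum_Ico_rectIncr_left _ s _ _ hlq, sq]
  exact mul_le_mul_of_nonneg_right (hφ.rectIncr_le_right (hs hlq) le_rfl (hs q.le_succ))
    (hφ.nonneg (sub_nonneg.2 (hs q.le_succ)))

end Grid

end IsRoughModulus

end RectangularIncrements

section PowerModulus
variable {α : ℝ}

lemma rpow_sq {t : ℝ} (ht : 0 ≤ t) : (t ^ α) ^ 2 = t ^ (2 * α) := by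
  rw [mul_comm, Real.rpow_mul ht, Real.rpow_two]

lemma rpow_mul_sub_rpow_le (h0 : 1 / 2 < α) (h1 : α ≤ 1) {y z : ℝ} (hy : 0 < y) (hz : 0 < z) :
    y ^ α * (y ^ (α - 1) - z ^ (α - 1)) ≤
      (1 - α) / (2 * α - 1) * (z ^ (2 * α - 1) - y ^ (2 * α - 1)) := by
  have hd : 0 < 2 * α - 1 := by linarith
  obtain ⟨u, hu, rfl⟩ : ∃ u, 0 < u ∧ z = u * y :=
    ⟨z / y, div_pos hz hy, (div_mul_cancel₀ z hy.ne').symm⟩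
  have low : (α - 1) * Real.log u ≤ u ^ (α - 1) - 1 := by
    rw [← Real.log_rpow hu]; exact Real.log_le_sub_one_of_pos (Real.rpow_pos_of_pos hu _)
  have high : (2 * α - 1) * Real.log u ≤ u ^ (2 * α - 1) - 1 := by
    rw [← Real.log_rpow hu]; exact Real.log_le_sub_one_of_pos (Real.rpow_pos_of_pos hu _)
  have normalized : 1 - u ^ (α - 1) ≤ (1 - α) / (2 * α - 1) * (u ^ (2 * α - 1) - 1) :=
    calc 1 - u ^ (α - 1) ≤ (1 - α) * Real.log u := by linarith
      _ = (1 - α) / (2 * α - 1) * ((2 * α - 1) * Real.log u) := by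
        rw [← mul_assoc, div_mul_cancel₀ _ hd.ne']
      _ ≤ _ := mul_le_mul_of_nonneg_left high (div_nonneg (sub_nonneg.2 h1) hd.le)
  have hy2 : y ^ (2 * α - 1) = y ^ α * y ^ (α - 1) := by
    rw [← Real.rpow_add hy]; congr 1; ring
  have scaled := mul_le_mul_of_nonneg_left normalized (Real.rpow_nonneg hy.le (2 * α - 1))
  rw [Real.mul_rpow hu.le hy.le, Real.mul_rpow hu.le hy.le]
  rw [hy2] at scaled ⊢
  linarith

lemma monotoneOn_rpow_increment_comparison (h0 : 1 / 2 < α) (h1 : α ≤ 1) {x b : ℝ} (hx : 0 ≤ x)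
    (hb : 0 ≤ b) :
    MonotoneOn (fun y => (1 - α) / (2 * (2 * α - 1)) * ((y + b) ^ (2 * α) - y ^ (2 * α)) +
      x ^ α * ((y + b) ^ α - y ^ α)) (Set.Ici x) := by
  have hasDeriv : ∀ y ∈ interior (Set.Ici x), HasDerivAt
      (fun y => (1 - α) / (2 * (2 * α - 1)) * ((y + b) ^ (2 * α) - y ^ (2 * α)) +
        x ^ α * ((y + b) ^ α - y ^ α))
      (α * ((1 - α) / (2 * α - 1) * ((y + b) ^ (2 * α - 1) - y ^ (2 * α - 1)) -
        x ^ α * (y ^ (α - 1) - (y + b) ^ (α - 1)))) y := by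
    intro y hy
    have hy0 : 0 < y := hx.trans_lt (interior_Ici.subset hy)
    have drpow (r : ℝ) := ((hasDerivAt_id' y).add_const b).rpow_const (p := r)
      (.inl (add_pos_of_pos_of_nonneg hy0 hb).ne') |>.sub
        ((hasDerivAt_id' y).rpow_const (p := r) (.inl hy0.ne'))
    refine (((drpow (2 * α)).const_mul _).add ((drpow α).const_mul _)).congr_deriv ?_
    have : 2 * α - 1 ≠ 0 := by linarith
    field_simp
    ring
  refine monotoneOn_of_deriv_nonneg (convex_Ici x) ?_
    (fun y hy => (hasDeriv y hy).differentiableAt.differentiableWithinAt) fun y hy => ?_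
  · have crpow {r : ℝ} (hr : 0 ≤ r) : Continuous fun y : ℝ => (y + b) ^ r - y ^ r :=
      ((continuous_add_const b).rpow_const fun _ => .inr hr).sub (Real.continuous_rpow_const hr)
    exact ((continuous_const.mul (crpow (by linarith))).add
      (continuous_const.mul (crpow (by linarith)))).continuousOn
  · rw [(hasDeriv y hy).deriv]
    have hxy : x < y := interior_Ici.subset hy
    have hy0 : 0 < y := hx.trans_lt hxy
    have weight : x ^ α ≤ y ^ α := Real.rpow_le_rpow hx hxy.le (by linarith)
    have decreasing : (y + b) ^ (α - 1) ≤ y ^ (α - 1) :=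
      Real.rpow_le_rpow_of_nonpos hy0 (le_add_of_nonneg_right hb) (by linarith)
    exact mul_nonneg (by linarith) (sub_nonneg.2 ((mul_le_mul_of_nonneg_right weight
      (sub_nonneg.2 decreasing)).trans
        (rpow_mul_sub_rpow_le h0 h1 hy0 (add_pos_of_pos_of_nonneg hy0 hb))))

lemma isRoughModulus_rpow (h0 : 1 / 2 < α) (h1 : α ≤ 1) :
    IsRoughModulus (· ^ α) ((1 - α) / (2 * (2 * α - 1))) where
  map_zero := Real.zero_rpow (by linarith)
  monotoneOn := Real.monotoneOn_rpow_Ici_of_exponent_nonneg (by linarith)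
  concaveOn := Real.concaveOn_rpow (by linarith) h1
  sq_add_sq_le u v hu hv := by
    rw [rpow_sq hu, rpow_sq hv, rpow_sq (add_nonneg hu hv)]
    exact Real.add_rpow_le_rpow_add hu hv (by linarith)
  const_nonneg := div_nonneg (by linarith) (by linarith)
  gap_mul_rectIncr_le a b c d hab hbc hcd := by
    have mono := monotoneOn_rpow_increment_comparison h0 h1 (x := c - b) (b := d - c)
      (sub_nonneg.2 hbc) (sub_nonneg.2 hcd) Set.self_mem_Ici
      (show c - b ≤ c - a by linarith) (by linarith)
    simp only [show c - b + (d - c) = d - b by ring,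
      show c - a + (d - c) = d - a by ring] at mono
    simp only [rectIncr, Pi.pow_apply]
    iterate 4 rw [rpow_sq (by linarith)]
    linarith

end PowerModulus

section AreaOnGrid
variable {E F : Type*} [NormedAddCommGroup E] [InnerProductSpace ℝ E]
  [NormedAddCommGroup F] [InnerProductSpace ℝ F]

/-- The values `x` at the grid points `s` of a Hilbert-space valued path whose increments behave
like those of a process with variance function `φ`: the covariance of increments over
non-overlapping intervals `[s p, s q]`, `[s p', s q']` is controlled by the rectangular increments
of `φ`, and the covariance of the increments over `[s p, s q] ⊆ [s l, s m]` by the increments of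
`φ` from both endpoints. -/
structure RoughGrid (x : ℕ → E) (s : ℕ → ℝ) (φ : ℝ → ℝ) (C : ℝ) : Prop where
  abs_inner_le : ∀ ⦃p q p' q' : ℕ⦄, p ≤ q → q ≤ p' → p' ≤ q' →
    |inner ℝ (x q - x p) (x q' - x p')| ≤ C * rectIncr φ (s p) (s q) (s p') (s q')
  abs_inner_total_le : ∀ ⦃l p q m : ℕ⦄, l ≤ p → p ≤ q → q ≤ m →
    |inner ℝ (x q - x p) (x m - x l)| ≤
      C * (φ (s q - s l) - φ (s p - s l) + (φ (s m - s p) - φ (s m - s q)))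

/-- The increment of `y` over `[p + 1, m]` minus the one over `[l, p]`. Paired with the increments
of `x` over the cells `[p, p + 1]` of `[l, m]`, it produces the Lévy area of `(x, y)` over
`[l, m]`. -/
def skewIncr (y : ℕ → F) (l m p : ℕ) : F := (y m - y (p + 1)) - (y p - y l)

/-- The inner product, in the Hilbert tensor product, of the areas of `(x, y)` over the cells
`[l, m]` and `[l', m']`. -/
def areaInner (x : ℕ → E) (y : ℕ → F) (l m l' m' : ℕ) : ℝ :=
  ∑ p ∈ Finset.Ico l m, ∑ q ∈ Finset.Ico l' m', inner ℝ (x (p + 1) - x p) (x (q + 1) - x q) *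
    inner ℝ (skewIncr y l m p) (skewIncr y l' m' q)

lemma areaInner_comm (x : ℕ → E) (y : ℕ → F) (l m l' m' : ℕ) :
    areaInner x y l m l' m' = areaInner x y l' m' l m := by
  unfold areaInner
  rw [Finset.sum_comm]
  refine Finset.sum_congr rfl fun p _ => Finset.sum_congr rfl fun q _ => ?_
  rw [real_inner_comm, real_inner_comm (skewIncr y l' m' p)]

lemma sum_sum_Ico_eq_of_symm {R : Type*} [CommSemiring R] (g : ℕ → ℕ → R)
    (hg : ∀ p q, g p q = g q p) {l m : ℕ} (h : l ≤ m) :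
    ∑ p ∈ Finset.Ico l m, ∑ q ∈ Finset.Ico l m, g p q =
      ∑ p ∈ Finset.Ico l m, g p p +
        2 * ∑ p ∈ Finset.Ico l m, ∑ q ∈ Finset.Ico (p + 1) m, g p q := by
  induction m, h using Nat.le_induction with
  | base => simp
  | succ n hn ih =>
    have extend : ∀ p ∈ Finset.Ico l n, ∑ q ∈ Finset.Ico (p + 1) (n + 1), g p q =
        ∑ q ∈ Finset.Ico (p + 1) n, g p q + g p n := fun p hp =>
      Finset.sum_Ico_succ_top (Finset.mem_Ico.1 hp).2 _
    simp only [Finset.sum_Ico_succ_top hn, Finset.sum_add_distrib]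
    rw [ih, Finset.sum_congr rfl extend, Finset.sum_add_distrib,
      Finset.sum_congr rfl fun p _ => hg n p, Finset.Ico_self, Finset.sum_empty]
    ring

lemma norm_sub_sq_le {G : Type*} [SeminormedAddCommGroup G] (a b : G) :
    ‖a - b‖ ^ 2 ≤ 2 * (‖a‖ ^ 2 + ‖b‖ ^ 2) :=
  (pow_le_pow_left₀ (norm_nonneg _) (norm_sub_le a b) 2).trans add_sq_le

lemma sum_sum_mul_inner_eq_of_symm {ι : Type*} (I : Finset ι) (r : ι → ι → ℝ)
    (hr : ∀ p q, r p q = r q p) (z : ι → F) :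
    ∑ p ∈ I, ∑ q ∈ I, r p q * inner ℝ (z p) (z q) =
      ∑ p ∈ I, (∑ q ∈ I, r p q) * ‖z p‖ ^ 2 - 2⁻¹ * ∑ p ∈ I, ∑ q ∈ I, r p q * ‖z p - z q‖ ^ 2 := by
  have swapped : ∑ p ∈ I, ∑ q ∈ I, r p q * ‖z q‖ ^ 2 = ∑ p ∈ I, ∑ q ∈ I, r p q * ‖z p‖ ^ 2 := by
    rw [Finset.sum_comm]
    simp only [hr]
  have polarized : ∀ p q, r p q * inner ℝ (z p) (z q) = 2⁻¹ * (r p q * ‖z p‖ ^ 2) +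
      2⁻¹ * (r p q * ‖z q‖ ^ 2) - 2⁻¹ * (r p q * ‖z p - z q‖ ^ 2) := fun p q => by
    rw [norm_sub_sq_real]; ring
  simp only [polarized, Finset.sum_sub_distrib, Finset.sum_add_distrib, ← Finset.mul_sum, swapped,
    Finset.sum_mul]
  ring

namespace RoughGrid
variable {x : ℕ → E} {y : ℕ → F} {s : ℕ → ℝ} {φ : ℝ → ℝ} {K C : ℝ} {l m p q : ℕ}

lemma norm_sub_sq_le (hx : RoughGrid x s φ C) (hφ : φ 0 = 0) (h : p ≤ q) :
    ‖x q - x p‖ ^ 2 ≤ 2 * C * φ (s q - s p) := by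
  have total := hx.abs_inner_total_le le_rfl h le_rfl
  rw [real_inner_self_eq_norm_sq, sub_self, sub_self, hφ] at total
  linarith [le_abs_self (‖x q - x p‖ ^ 2)]

lemma norm_skewIncr_sq_le (hy : RoughGrid y s φ C) (hC : 0 ≤ C) (hφ : IsRoughModulus φ K)
    (hs : Monotone s) (hlp : l ≤ p) (hpm : p < m) :
    ‖skewIncr y l m p‖ ^ 2 ≤ 8 * C * φ (s m - s l) := by
  have after := hy.norm_sub_sq_le hφ.map_zero (p := p + 1) (q := m) hpm
  have before := hy.norm_sub_sq_le hφ.map_zero hlp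
  have φ_after : φ (s m - s (p + 1)) ≤ φ (s m - s l) :=
    hφ.le_of_le (sub_nonneg.2 (hs hpm)) (sub_le_sub_left (hs (hlp.trans p.le_succ)) _)
  have φ_before : φ (s p - s l) ≤ φ (s m - s l) :=
    hφ.le_of_le (sub_nonneg.2 (hs hlp)) (sub_le_sub_right (hs hpm.le) _)
  have split := _root_.norm_sub_sq_le (y m - y (p + 1)) (y p - y l)
  rw [skewIncr]
  nlinarith

lemma norm_skewIncr_sub_sq_le (hy : RoughGrid y s φ C) (hC : 0 ≤ C) (hφ : IsRoughModulus φ K)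
    (hs : Monotone s) (hpq : p < q) :
    ‖skewIncr y l m p - skewIncr y l m q‖ ^ 2 ≤
      4 * C * (2 * φ (s q - s (p + 1)) + φ (s (p + 1) - s p) + φ (s (q + 1) - s q)) := by
  have eq : skewIncr y l m p - skewIncr y l m q = (y q - y p) - -(y (q + 1) - y (p + 1)) := by
    unfold skewIncr; abel
  have left := hy.norm_sub_sq_le hφ.map_zero hpq.le
  have right := hy.norm_sub_sq_le hφ.map_zero (Nat.succ_le_succ hpq.le)
  have gap := sub_nonneg.2 (hs hpq)
  have φ_left := hφ.add_le gap (sub_nonneg.2 (hs p.le_succ))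
  have φ_right := hφ.add_le (sub_nonneg.2 (hs q.le_succ)) gap
  rw [Nat.succ_eq_add_one, sub_add_sub_cancel] at φ_left φ_right
  have split := _root_.norm_sub_sq_le (y q - y p) (-(y (q + 1) - y (p + 1)))
  rw [norm_neg, ← eq] at split
  nlinarith

lemma abs_sum_row_mul_norm_sq_le (hx : RoughGrid x s φ C) (hy : RoughGrid y s φ C) (hC : 0 ≤ C)
    (hφ : IsRoughModulus φ K) (hs : Monotone s) (h : l ≤ m) :
    |∑ p ∈ Finset.Ico l m, (∑ q ∈ Finset.Ico l m, inner ℝ (x (p + 1) - x p) (x (q + 1) - x q)) *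
      ‖skewIncr y l m p‖ ^ 2| ≤ 16 * C ^ 2 * φ (s m - s l) ^ 2 := by
  have row : ∀ p ∈ Finset.Ico l m,
      |(∑ q ∈ Finset.Ico l m, inner ℝ (x (p + 1) - x p) (x (q + 1) - x q)) *
        ‖skewIncr y l m p‖ ^ 2| ≤
      C * ((φ (s (p + 1) - s l) - φ (s m - s (p + 1))) - (φ (s p - s l) - φ (s m - s p))) *
        (8 * C * φ (s m - s l)) := by
    intro p hp
    obtain ⟨hlp, hpm⟩ := Finset.mem_Ico.1 hp
    have total := hx.abs_inner_total_le hlp p.le_succ hpm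
    rw [← inner_sum, Finset.sum_Ico_sub x h, abs_mul, abs_of_nonneg (sq_nonneg ‖_‖)]
    refine (mul_le_mul total (hy.norm_skewIncr_sq_le hC hφ hs hlp hpm) (sq_nonneg _)
      ((abs_nonneg _).trans total)).trans_eq ?_
    rw [Nat.succ_eq_add_one]
    ring
  refine (Finset.abs_sum_le_sum_abs _ _).trans ((Finset.sum_le_sum row).trans_eq ?_)
  rw [← Finset.sum_mul, ← Finset.mul_sum,
    Finset.sum_Ico_sub (fun p => φ (s p - s l) - φ (s m - s p)) h, sub_self, sub_self,
    hφ.map_zero]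
  ring

lemma abs_inner_mul_norm_sub_sq_le (hx : RoughGrid x s φ C) (hy : RoughGrid y s φ C) (hC : 0 ≤ C)
    (hφ : IsRoughModulus φ K) (hs : Monotone s) (hpq : p < q) :
    |inner ℝ (x (p + 1) - x p) (x (q + 1) - x q) *
        ‖skewIncr y l m p - skewIncr y l m q‖ ^ 2| ≤
      4 * C ^ 2 * (2 * K * -rectIncr (φ ^ 2) (s p) (s (p + 1)) (s q) (s (q + 1)) +
        rectIncr φ (s p) (s (p + 1)) (s q) (s (q + 1)) * φ (s (p + 1) - s p) +
        rectIncr φ (s p) (s (p + 1)) (s q) (s (q + 1)) * φ (s (q + 1) - s q)) := by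
  have cov := hx.abs_inner_le p.le_succ hpq q.le_succ
  have norm := hy.norm_skewIncr_sub_sq_le (l := l) (m := m) hC hφ hs hpq
  have weighted := mul_le_mul_of_nonneg_left
    (hφ.gap_mul_rectIncr_le (hs p.le_succ) (hs hpq) (hs q.le_succ))
    (show 0 ≤ 8 * C ^ 2 by positivity)
  rw [abs_mul, abs_of_nonneg (sq_nonneg ‖_‖)]
  refine (mul_le_mul cov norm (sq_nonneg _) ((abs_nonneg _).trans cov)).trans ?_
  simp only [Nat.succ_eq_add_one] at weighted ⊢
  linarith

lemma abs_sum_inner_mul_norm_sub_sq_le (hx : RoughGrid x s φ C) (hy : RoughGrid y s φ C)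
    (hC : 0 ≤ C) (hφ : IsRoughModulus φ K) (hs : Monotone s) (h : l ≤ m) :
    |∑ p ∈ Finset.Ico l m, ∑ q ∈ Finset.Ico l m, inner ℝ (x (p + 1) - x p) (x (q + 1) - x q) *
      ‖skewIncr y l m p - skewIncr y l m q‖ ^ 2| ≤
      16 * (K + 1) * C ^ 2 * φ (s m - s l) ^ 2 := by
  rw [sum_sum_Ico_eq_of_symm _ (fun p q => by rw [norm_sub_rev, real_inner_comm]) h]
  simp only [sub_self, norm_zero, ne_eq, OfNat.ofNat_ne_zero, not_false_eq_true, zero_pow,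
    mul_zero, Finset.sum_const_zero, zero_add]
  rw [abs_mul, abs_two]
  have upper : |∑ p ∈ Finset.Ico l m, ∑ q ∈ Finset.Ico (p + 1) m,
        inner ℝ (x (p + 1) - x p) (x (q + 1) - x q) *
          ‖skewIncr y l m p - skewIncr y l m q‖ ^ 2| ≤
      4 * C ^ 2 * (2 * K * φ (s m - s l) ^ 2 + φ (s m - s l) ^ 2 + φ (s m - s l) ^ 2) := by
    refine (Finset.abs_sum_le_sum_abs _ _).trans ((Finset.sum_le_sum fun p _ =>
      (Finset.abs_sum_le_sum_abs _ _).trans (Finset.sum_le_sum fun q hq =>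
        hx.abs_inner_mul_norm_sub_sq_le hy hC hφ hs (Finset.mem_Ico.1 hq).1)).trans ?_)
    simp only [← Finset.mul_sum, Finset.sum_add_distrib]
    exact mul_le_mul_of_nonneg_left (add_le_add_three
      (mul_le_mul_of_nonneg_left (hφ.sum_sum_neg_rectIncr_sq_le h)
        (mul_nonneg zero_le_two hφ.const_nonneg))
      (hφ.sum_sum_rectIncr_mul_left_le hs h) (hφ.sum_sum_rectIncr_mul_right_le hs h))
      (by positivity)
  linarith

lemma areaInner_self_le (hx : RoughGrid x s φ C) (hy : RoughGrid y s φ C) (hC : 0 ≤ C)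
    (hφ : IsRoughModulus φ K) (hs : Monotone s) (h : l ≤ m) :
    areaInner x y l m l m ≤ (24 + 8 * K) * C ^ 2 * φ (s m - s l) ^ 2 := by
  have rows := le_of_abs_le (hx.abs_sum_row_mul_norm_sq_le hy hC hφ hs h)
  have distances := neg_le_of_abs_le (hx.abs_sum_inner_mul_norm_sub_sq_le hy hC hφ hs h)
  rw [areaInner, sum_sum_mul_inner_eq_of_symm _ _ fun p q => real_inner_comm _ _]
  linarith

lemma abs_inner_skewIncr_le (hy : RoughGrid y s φ C) (hC : 0 ≤ C)
    (hφ : ConcaveOn ℝ (Set.Ici 0) φ) (hs : Monotone s) {l' m' : ℕ} (hlp : l ≤ p) (hpm : p < m)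
    (hm : m ≤ l') (hlq : l' ≤ q) (hqm : q < m') :
    |inner ℝ (skewIncr y l m p) (skewIncr y l' m' q)| ≤
      4 * C * rectIncr φ (s l) (s m) (s l') (s m') := by
  have cov : ∀ {a b c d : ℕ}, l ≤ a → a ≤ b → b ≤ m → l' ≤ c → c ≤ d → d ≤ m' →
      |inner ℝ (y b - y a) (y d - y c)| ≤ C * rectIncr φ (s l) (s m) (s l') (s m') :=
    fun hla hab hbm hlc hcd hdm =>
      (hy.abs_inner_le hab (hbm.trans (hm.trans hlc)) hcd).trans (mul_le_mul_of_nonneg_left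
        (rectIncr_le_rectIncr hφ (hs hla) (hs hab) (hs hbm) (hs hm) (hs hlc) (hs hcd) (hs hdm)) hC)
  have hlp' := hlp.trans p.le_succ
  have hlq' := hlq.trans q.le_succ
  have after_after := abs_le.1 (cov hlp' hpm le_rfl hlq' hqm le_rfl)
  have after_before := abs_le.1 (cov hlp' hpm le_rfl le_rfl hlq hqm.le)
  have before_after := abs_le.1 (cov le_rfl hlp hpm.le hlq' hqm le_rfl)
  have before_before := abs_le.1 (cov le_rfl hlp hpm.le le_rfl hlq hqm.le)
  rw [skewIncr, skewIncr, inner_sub_left, inner_sub_right (y m - y (p + 1)),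
    inner_sub_right (y p - y l)]
  simp only [Nat.succ_eq_add_one] at *
  rw [abs_le]
  constructor <;> linarith

lemma areaInner_le (hx : RoughGrid x s φ C) (hy : RoughGrid y s φ C) (hC : 0 ≤ C)
    (hφ : ConcaveOn ℝ (Set.Ici 0) φ) (hs : Monotone s) {l' m' : ℕ} (h : l ≤ m) (hm : m ≤ l')
    (h' : l' ≤ m') :
    areaInner x y l m l' m' ≤ 4 * C ^ 2 * rectIncr φ (s l) (s m) (s l') (s m') ^ 2 := by
  have term : ∀ p ∈ Finset.Ico l m, ∀ q ∈ Finset.Ico l' m',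
      inner ℝ (x (p + 1) - x p) (x (q + 1) - x q) *
        inner ℝ (skewIncr y l m p) (skewIncr y l' m' q) ≤
      C * rectIncr φ (s p) (s (p + 1)) (s q) (s (q + 1)) *
        (4 * C * rectIncr φ (s l) (s m) (s l') (s m')) := by
    intro p hp q hq
    obtain ⟨hlp, hpm⟩ := Finset.mem_Ico.1 hp
    obtain ⟨hlq, hqm⟩ := Finset.mem_Ico.1 hq
    have cov := hx.abs_inner_le p.le_succ (hpm.trans_le (hm.trans hlq)) q.le_succ
    refine (le_abs_self _).trans ((abs_mul _ _).trans_le ?_)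
    exact mul_le_mul cov (hy.abs_inner_skewIncr_le hC hφ hs hlp hpm hm hlq hqm) (abs_nonneg _)
      ((abs_nonneg _).trans cov)
  refine (Finset.sum_le_sum fun p hp => Finset.sum_le_sum (term p hp)).trans_eq ?_
  simp only [← Finset.sum_mul, ← Finset.mul_sum, sum_Ico_rectIncr_right _ s _ _ h',
    sum_Ico_rectIncr_left _ s _ _ h]
  ring

lemma sum_areaInner_le (hx : RoughGrid x s φ C) (hy : RoughGrid y s φ C) (hC : 0 ≤ C)
    (hφ : IsRoughModulus φ K) (hs : Monotone s) {κ : ℕ → ℕ} (hκ : Monotone κ) (n : ℕ) :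
    ∑ k ∈ Finset.range n, ∑ j ∈ Finset.range n,
      areaInner x y (κ k) (κ (k + 1)) (κ j) (κ (j + 1)) ≤
      (32 + 8 * K) * C ^ 2 * ∑ k ∈ Finset.range n, φ (s (κ (k + 1)) - s (κ k)) ^ 2 := by
  set t : ℕ → ℝ := fun k => s (κ k)
  have ht : Monotone t := hs.comp hκ
  have above_diagonal : ∀ k ∈ Finset.Ico 0 n,
      ∑ j ∈ Finset.Ico (k + 1) n, areaInner x y (κ k) (κ (k + 1)) (κ j) (κ (j + 1)) ≤
        4 * C ^ 2 * φ (t (k + 1) - t k) ^ 2 := by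
    intro k hk
    have hk : k + 1 ≤ n := (Finset.mem_Ico.1 hk).2
    have hk' := ht k.le_succ
    have hΦ : 0 ≤ φ (t (k + 1) - t k) := hφ.nonneg (sub_nonneg.2 hk')
    have term : ∀ j ∈ Finset.Ico (k + 1) n,
        areaInner x y (κ k) (κ (k + 1)) (κ j) (κ (j + 1)) ≤ 4 * C ^ 2 * (φ (t (k + 1) - t k) *
          rectIncr φ (t k) (t (k + 1)) (t j) (t (j + 1))) := by
      intro j hj
      have hkj : k + 1 ≤ j := (Finset.mem_Ico.1 hj).1
      refine (hx.areaInner_le hy hC hφ.concaveOn hs (hκ k.le_succ) (hκ hkj)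
        (hκ j.le_succ)).trans (mul_le_mul_of_nonneg_left ?_ (by positivity))
      rw [sq]
      exact mul_le_mul_of_nonneg_right (hφ.rectIncr_le_left hk' (ht hkj) (ht j.le_succ))
        (rectIncr_nonneg hφ.concaveOn hk' (ht hkj) (ht j.le_succ))
    refine (Finset.sum_le_sum term).trans ?_
    rw [← Finset.mul_sum, ← Finset.mul_sum, sum_Ico_rectIncr_right _ t _ _ hk, sq (φ _)]
    exact mul_le_mul_of_nonneg_left (mul_le_mul_of_nonneg_left
      (hφ.rectIncr_le_left hk' le_rfl (ht hk)) hΦ) (by positivity)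
  rw [Finset.range_eq_Ico, sum_sum_Ico_eq_of_symm _ (fun _ _ => areaInner_comm ..) n.zero_le]
  have diagonal := Finset.sum_le_sum fun k (_ : k ∈ Finset.Ico 0 n) =>
    hx.areaInner_self_le hy hC hφ hs (hκ k.le_succ)
  have off_diagonal := Finset.sum_le_sum above_diagonal
  rw [← Finset.mul_sum] at diagonal off_diagonal
  simp only [Nat.succ_eq_add_one, t] at diagonal off_diagonal ⊢
  linarith

end RoughGrid

end AreaOnGrid

lemma trapezoid_sub_eq {R : Type*} [Field R] [CharZero R] (a b : ℕ → R) (c : R) {κ : ℕ → ℕ}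
    (hκ : Monotone κ) (n : ℕ) :
    ∑ p ∈ Finset.Ico (κ 0) (κ n), (a (p + 1) - a p) * (c - (b p + b (p + 1)) / 2) -
      ∑ k ∈ Finset.range n, (a (κ (k + 1)) - a (κ k)) * (c - (b (κ k) + b (κ (k + 1))) / 2) =
    2⁻¹ * ∑ k ∈ Finset.range n, ∑ p ∈ Finset.Ico (κ k) (κ (k + 1)),
      (a (p + 1) - a p) * ((b (κ (k + 1)) - b (p + 1)) - (b p - b (κ k))) := by
  induction n with
  | zero => simp
  | succ n ih =>
    have cell : ∑ p ∈ Finset.Ico (κ n) (κ (n + 1)),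
        (a (p + 1) - a p) * (c - (b p + b (p + 1)) / 2) -
        (a (κ (n + 1)) - a (κ n)) * (c - (b (κ n) + b (κ (n + 1))) / 2) =
      2⁻¹ * ∑ p ∈ Finset.Ico (κ n) (κ (n + 1)),
        (a (p + 1) - a p) * ((b (κ (n + 1)) - b (p + 1)) - (b p - b (κ n))) := by
      rw [← Finset.sum_Ico_sub a (hκ n.le_succ), Finset.sum_mul, Finset.mul_sum,
        ← Finset.sum_sub_distrib]
      exact Finset.sum_congr rfl fun p _ => by ring
    rw [Finset.sum_range_succ, Finset.sum_range_succ, mul_add, ← ih, ← cell,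
      ← Finset.sum_Ico_consecutive _ (hκ n.zero_le) (hκ n.le_succ)]
    ring

lemma exists_monotone_enumeration {ι : Type*} [LinearOrder ι] (F : Finset ι) (hF : F.Nonempty) :
    ∃ (s : ℕ → ι) (rank : F → ℕ), Monotone s ∧ (∀ n, s n ∈ F) ∧ Monotone rank ∧
      ∀ u, s (rank u) = u := by
  have card_pos := hF.card_pos
  let e := F.orderIsoOfFin rfl
  refine ⟨fun n => e ⟨min n (F.card - 1), by lia⟩, fun u => e.symm u,
    fun a b h => e.monotone (Fin.mk_le_mk.2 (min_le_min_right _ h)), fun n => (e _).2,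
    fun u v h => e.symm.monotone h, fun u => ?_⟩
  have index : (⟨min (e.symm u : ℕ) (F.card - 1), by lia⟩ : Fin F.card) = e.symm u :=
    Fin.ext (min_eq_left (by lia))
  simp only [index, OrderIso.apply_symm_apply]

lemma integral_mul_sub_mul_sub_left (a b α β γ : ℝ) :
    ∫ u in a..b, α * (β - γ * (u - a)) = α * (β * (b - a) - γ * ((b - a) ^ 2 / 2)) := by
  have linear : ∫ u in a..b, (u - a) = (b - a) ^ 2 / 2 := by
    rw [intervalIntegral.integral_comp_sub_right (fun u => u), integral_id]; ring
  rw [intervalIntegral.integral_const_mul, intervalIntegral.integral_sub (by simp)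
    (Continuous.intervalIntegrable (by fun_prop) _ _), intervalIntegral.integral_const_mul, linear,
    intervalIntegral.integral_const, smul_eq_mul, mul_comm β]

namespace Dissection
variable {T : ℝ} (D : Dissection T)

/-- The nodes of a dissection, continued by the last node to a sequence indexed by `ℕ`. -/
def node (k : ℕ) : ℝ := D.pt ⟨min k D.n, by lia⟩

lemma node_mono : Monotone D.node := fun _ _ h =>
  D.strictMono.monotone (Fin.mk_le_mk.2 (min_le_min_right _ h))

lemma node_min (k : ℕ) : D.node (min k D.n) = D.node k := by
  simp only [node, min_assoc, min_self]

lemma node_lt {k : ℕ} (hk : k < D.n) : D.node k < D.node (k + 1) :=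
  D.strictMono (Fin.mk_lt_mk.2 (by lia))

@[simp] lemma node_zero : D.node 0 = 0 := by
  rw [node, ← D.first]
  congr 1

@[simp] lemma node_n : D.node D.n = T := by
  conv_rhs => rw [← D.last]
  rw [node]
  congr 1
  exact Fin.ext (min_self _)

lemma pt_castSucc (k : Fin D.n) : D.pt k.castSucc = D.node k := by
  rw [node]
  congr 1
  exact Fin.ext (min_eq_left k.2.le).symm

lemma pt_succ (k : Fin D.n) : D.pt k.succ = D.node (k + 1) := by
  rw [node]
  congr 1
  exact Fin.ext (min_eq_left k.2).symm

lemma node_mem_Icc (k : ℕ) : D.node k ∈ Set.Icc 0 T := by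
  constructor
  · simpa using D.node_mono k.zero_le
  · simpa [node_min] using D.node_mono (min_le_right k D.n)

lemma node_sub_le_mesh {k : ℕ} (hk : k < D.n) : D.node (k + 1) - D.node k ≤ D.mesh := by
  have := le_ciSup (f := fun k : Fin D.n => D.pt k.succ - D.pt k.castSucc)
    (Set.finite_range _).bddAbove ⟨k, hk⟩
  rwa [pt_succ, pt_castSucc] at this

lemma mesh_nonneg : 0 ≤ D.mesh := Real.iSup_nonneg fun k => by
  rw [pt_succ, pt_castSucc]; exact sub_nonneg.2 (D.node_mono (Nat.le_succ _))

lemma exists_cell {u : ℝ} (h0 : 0 ≤ u) (hu : u < T) :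
    ∃ k < D.n, D.node k ≤ u ∧ u < D.node (k + 1) := by
  have below : ∀ m, u < D.node m → ∃ k < m, D.node k ≤ u ∧ u < D.node (k + 1) := by
    intro m hm
    induction m with
    | zero => exact absurd (D.node_zero ▸ hm) h0.not_gt
    | succ m ih =>
      rcases lt_or_ge u (D.node m) with h | h
      · obtain ⟨k, hk, hk'⟩ := ih h
        exact ⟨k, hk.trans m.lt_succ_self, hk'⟩
      · exact ⟨m, m.lt_succ_self, h, hm⟩
  exact below D.n (by rwa [node_n])

lemma exists_refinement (D D' : Dissection T) : ∃ (s : ℕ → ℝ) (κ κ' : ℕ → ℕ), Monotone s ∧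
    (∀ n, s n ∈ Set.Icc 0 T) ∧ Monotone κ ∧ Monotone κ' ∧ κ 0 = κ' 0 ∧ κ D.n = κ' D'.n ∧
    (∀ k, s (κ k) = D.node k) ∧ ∀ k, s (κ' k) = D'.node k := by
  classical
  let nodes (D : Dissection T) : Finset ℝ := (Finset.range (D.n + 1)).image D.node
  have node_mem : ∀ (D : Dissection T) (k : ℕ), D.node k ∈ nodes D := fun D k =>
    Finset.mem_image.2 ⟨min k D.n, Finset.mem_range.2 (by lia), D.node_min k⟩
  have nodes_subset : ∀ (D : Dissection T), ∀ u ∈ nodes D, u ∈ Set.Icc 0 T := by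
    intro D u hu
    obtain ⟨k, -, rfl⟩ := Finset.mem_image.1 hu
    exact D.node_mem_Icc k
  have left k := Finset.mem_union_left (nodes D') (node_mem D k)
  have right k := Finset.mem_union_right (nodes D) (node_mem D' k)
  obtain ⟨s, rank, hs, hsF, hrank, hsr⟩ := exists_monotone_enumeration _ ⟨_, left 0⟩
  exact ⟨s, fun k => rank ⟨_, left k⟩, fun k => rank ⟨_, right k⟩, hs,
    fun n => (Finset.mem_union.1 (hsF n)).elim (nodes_subset D _) (nodes_subset D' _),
    fun _ _ h => hrank (D.node_mono h), fun _ _ h => hrank (D'.node_mono h),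
    congrArg rank (Subtype.ext (by simp only [node_zero])),
    congrArg rank (Subtype.ext (by simp only [node_n])), fun _ => hsr _, fun _ => hsr _⟩

/-- The slope of the piecewise-linear interpolation of `x` on the `k`-th cell. -/
noncomputable def slope (x : ℝ → ℝ) (k : ℕ) : ℝ :=
  (x (D.node (k + 1)) - x (D.node k)) / (D.node (k + 1) - D.node k)

lemma continuous_plInterp (x : ℝ → ℝ) : Continuous (plInterp D x) := by
  unfold plInterp; fun_prop

lemma plInterp_eq (x : ℝ → ℝ) {k : ℕ} (hk : k < D.n) {u : ℝ}
    (hu : u ∈ Set.Icc (D.node k) (D.node (k + 1))) :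
    plInterp D x u = x (D.node k) + D.slope x k * (u - D.node k) := by
  set ramp : ℕ → ℝ := fun j => max 0 (min 1 ((u - D.node j) / (D.node (j + 1) - D.node j)))
  have gap_pos : ∀ {j}, j < D.n → 0 < D.node (j + 1) - D.node j := fun h => sub_pos.2 (D.node_lt h)
  have ramp_before : ∀ j < k, ramp j = 1 := fun j hj => by
    have : 1 ≤ (u - D.node j) / (D.node (j + 1) - D.node j) := by
      rw [one_le_div (gap_pos (hj.trans hk))]
      exact sub_le_sub_right ((D.node_mono hj).trans hu.1) _
    simp only [ramp, min_eq_left this, zero_le_one, sup_of_le_right]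
  have ramp_here : ramp k = (u - D.node k) / (D.node (k + 1) - D.node k) := by
    simp only [ramp]
    rw [min_eq_right ((div_le_one (gap_pos hk)).2 (sub_le_sub_right hu.2 _)),
      max_eq_right (div_nonneg (sub_nonneg.2 hu.1) (gap_pos hk).le)]
  have ramp_after : ∀ j ∈ Finset.Ico (k + 1) D.n, ramp j = 0 := fun j hj => by
    obtain ⟨hkj, hj⟩ := Finset.mem_Ico.1 hj
    exact max_eq_left (min_le_of_right_le (div_nonpos_of_nonpos_of_nonneg
      (sub_nonpos.2 (hu.2.trans (D.node_mono hkj))) (gap_pos hj).le))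
  have sum_eq : plInterp D x u =
      x 0 + ∑ j ∈ Finset.range D.n, (x (D.node (j + 1)) - x (D.node j)) * ramp j := by
    simp only [plInterp, pt_succ, pt_castSucc, Finset.sum_range, ramp]
  rw [sum_eq, ← Finset.sum_range_add_sum_Ico _ hk.le, Finset.sum_eq_sum_Ico_succ_bot hk,
    Finset.sum_congr rfl fun j hj => by rw [ramp_before j (Finset.mem_range.1 hj), mul_one],
    Finset.sum_congr (s₁ := Finset.Ico (k + 1) D.n) rfl fun j hj => by
      rw [ramp_after j hj, mul_zero],
    Finset.sum_const_zero, Finset.sum_range_sub fun j => x (D.node j), node_zero, ramp_here, slope]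
  ring

lemma plInterp_node (x : ℝ → ℝ) {k : ℕ} (hk : k < D.n) :
    plInterp D x (D.node (k + 1)) = x (D.node (k + 1)) := by
  rw [D.plInterp_eq x hk ⟨D.node_mono k.le_succ, le_rfl⟩, slope,
    div_mul_cancel₀ _ (sub_pos.2 (D.node_lt hk)).ne', add_sub_cancel]

lemma plInterp_last (x : ℝ → ℝ) (hT : 0 < T) : plInterp D x T = x T := by
  obtain ⟨m, hm⟩ : ∃ m, D.n = m + 1 := Nat.exists_eq_succ_of_ne_zero fun h =>
    hT.ne' (by rw [← D.node_n, h, D.node_zero])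
  simpa [← hm] using D.plInterp_node x (k := m) (by lia)

lemma hasDerivAt_plInterp (x : ℝ → ℝ) {k : ℕ} (hk : k < D.n) {u : ℝ}
    (hu : u ∈ Set.Ioo (D.node k) (D.node (k + 1))) :
    HasDerivAt (plInterp D x) (D.slope x k) u := by
  have affine : HasDerivAt (fun u => x (D.node k) + D.slope x k * (u - D.node k))
      (D.slope x k) u := by
    simpa using (((hasDerivAt_id u).sub_const (D.node k)).const_mul (D.slope x k)).const_add
      (x (D.node k))
  refine affine.congr_of_eventuallyEq ?_
  filter_upwards [Ioo_mem_nhds hu.1 hu.2] with w hw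
  exact D.plInterp_eq x hk ⟨hw.1.le, hw.2.le⟩

lemma intervalIntegrable_deriv_plInterp (x : ℝ → ℝ) :
    IntervalIntegrable (deriv (plInterp D x)) volume 0 T := by
  have cell : ∀ k < D.n,
      IntervalIntegrable (deriv (plInterp D x)) volume (D.node k) (D.node (k + 1)) := by
    intro k hk
    refine (intervalIntegrable_const (c := D.slope x k)).congr_uIoo fun u hu => ?_
    rw [Set.uIoo_of_le (D.node_mono k.le_succ)] at hu
    exact (D.hasDerivAt_plInterp x hk hu).deriv.symm
  simpa using IntervalIntegrable.trans_iterate cell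

lemma integral_deriv_plInterp (x : ℝ → ℝ) {u : ℝ} (h0 : 0 ≤ u) (hu : u ≤ T) :
    ∫ v in u..T, deriv (plInterp D x) v = plInterp D x T - plInterp D x u := by
  refine integral_eq_of_hasDerivAt_off_countable _ _
    (s := Set.range D.node) (Set.countable_range _) (D.continuous_plInterp x).continuousOn ?_ ?_
  · rintro v ⟨hv, hvn⟩
    rw [min_eq_left hu, max_eq_right hu] at hv
    obtain ⟨k, hk, hkv, hvk⟩ := D.exists_cell (h0.trans hv.1.le) hv.2
    exact (D.hasDerivAt_plInterp x hk
      ⟨lt_of_le_of_ne hkv fun h => hvn ⟨k, h⟩, hvk⟩).differentiableAt.hasDerivAt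
  · refine (D.intervalIntegrable_deriv_plInterp x).mono_set ?_
    rw [Set.uIcc_of_le hu, Set.uIcc_of_le (h0.trans hu)]
    exact Set.Icc_subset_Icc_left h0

/-- The trapezoidal approximation of `∫ (y T - y) dx` over the cells of `D`. -/
noncomputable def trapezoid (x y : ℝ → ℝ) : ℝ :=
  ∑ k ∈ Finset.range D.n, (x (D.node (k + 1)) - x (D.node k)) *
    (y T - (y (D.node k) + y (D.node (k + 1))) / 2)

end Dissection

lemma plSig_two {d : ℕ} {T : ℝ} (hT : 0 < T) (D : Dissection T) (x : Fin d → ℝ → ℝ) (i j : Fin d) :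
    plSig D x 0 T [i, j] = D.trapezoid (x i) (x j) := by
  set integrand : ℝ → ℝ := fun u => deriv (plInterp D (x i)) u * (x j T - plInterp D (x j) u)
  have inner_integral : plSig D x 0 T [i, j] = ∫ u in (0 : ℝ)..T, integrand u := by
    simp only [plSig, iterInt, mul_one]
    refine intervalIntegral.integral_congr fun u hu => ?_
    rw [Set.uIcc_of_le hT.le] at hu
    simp only [D.integral_deriv_plInterp _ hu.1 hu.2, D.plInterp_last _ hT, integrand]
  have cell : ∀ k < D.n, Set.EqOn (fun u => D.slope (x i) k *
        (x j T - x j (D.node k) - D.slope (x j) k * (u - D.node k))) integrand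
      (Set.uIoo (D.node k) (D.node (k + 1))) := by
    intro k hk u hu
    rw [Set.uIoo_of_le (D.node_mono k.le_succ)] at hu
    simp only [integrand]
    rw [(D.hasDerivAt_plInterp (x i) hk hu).deriv, D.plInterp_eq (x j) hk ⟨hu.1.le, hu.2.le⟩]
    ring
  have cells := intervalIntegral.sum_integral_adjacent_intervals fun k hk =>
    (Continuous.intervalIntegrable (μ := volume) (by fun_prop) _ _).congr_uIoo (cell k hk)
  rw [D.node_zero, D.node_n] at cells
  rw [inner_integral, ← cells, Dissection.trapezoid]
  refine Finset.sum_congr rfl fun k hk => ?_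
  have hk := Finset.mem_range.1 hk
  have gap_ne : D.node (k + 1) - D.node k ≠ 0 := (sub_pos.2 (D.node_lt hk)).ne'
  rw [← intervalIntegral.integral_congr_uIoo (cell k hk), integral_mul_sub_mul_sub_left,
    Dissection.slope, Dissection.slope]
  field_simp
  ring

section RoughVariance

/-- The function `v` on `[0, T]` has increments and rectangular increments dominated by those of
the modulus `φ`. It is meant for `v t = E[(X (s + t) - X s) ^ 2] / 2`, where `X` has stationary
increments. -/
structure IsRoughVariance (v φ : ℝ → ℝ) (T C : ℝ) : Prop where
  abs_sub_le : ∀ ⦃a b : ℝ⦄, 0 ≤ a → a ≤ b → b ≤ T → |v b - v a| ≤ C * (φ b - φ a)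
  abs_rectIncr_le : ∀ ⦃a b c d : ℝ⦄, a ≤ b → b ≤ c → c ≤ d → d - a ≤ T →
    |rectIncr v a b c d| ≤ C * rectIncr φ a b c d

variable {v φ : ℝ → ℝ} {K T C C' : ℝ}

lemma IsRoughVariance.mono (hv : IsRoughVariance v φ T C) (hφ : IsRoughModulus φ K)
    (hC : C ≤ C') : IsRoughVariance v φ T C' where
  abs_sub_le _ _ ha hab hb := (hv.abs_sub_le ha hab hb).trans <|
    mul_le_mul_of_nonneg_right hC (sub_nonneg.2 (hφ.monotoneOn ha (ha.trans hab) hab))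
  abs_rectIncr_le _ _ _ _ hab hbc hcd hT := (hv.abs_rectIncr_le hab hbc hcd hT).trans <|
    mul_le_mul_of_nonneg_right hC (rectIncr_nonneg hφ.concaveOn hab hbc hcd)

lemma inner_sub_sub_eq {E : Type*} [NormedAddCommGroup E] [InnerProductSpace ℝ E] (a b c d : E) :
    inner ℝ (b - a) (d - c) =
      (‖c - b‖ ^ 2 + ‖d - a‖ ^ 2 - ‖d - b‖ ^ 2 - ‖c - a‖ ^ 2) / 2 := by
  simp only [norm_sub_sq_real, inner_sub_left, inner_sub_right, real_inner_comm b c,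
    real_inner_comm d a, real_inner_comm d b, real_inner_comm c a]
  ring

lemma IsRoughVariance.roughGrid {E : Type*} [NormedAddCommGroup E] [InnerProductSpace ℝ E]
    (hv : IsRoughVariance v φ T C) {s : ℕ → ℝ} (hs : Monotone s) (hsT : ∀ n, s n ∈ Set.Icc 0 T)
    {x : ℕ → E} (hx : ∀ p q, p ≤ q → ‖x q - x p‖ ^ 2 = 2 * v (s q - s p)) :
    RoughGrid x s φ C where
  abs_inner_le p q p' q' h1 h2 h3 := by
    have polarized : inner ℝ (x q - x p) (x q' - x p') =
        -rectIncr v (s p) (s q) (s p') (s q') := by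
      rw [inner_sub_sub_eq, hx _ _ h2, hx _ _ (h1.trans (h2.trans h3)), hx _ _ (h2.trans h3),
        hx _ _ (h1.trans h2), rectIncr]
      ring
    rw [polarized, abs_neg]
    exact hv.abs_rectIncr_le (hs h1) (hs h2) (hs h3) (by linarith [(hsT q').2, (hsT p).1])
  abs_inner_total_le l p q m h1 h2 h3 := by
    have polarized : inner ℝ (x q - x p) (x m - x l) =
        v (s q - s l) - v (s p - s l) + (v (s m - s p) - v (s m - s q)) := by
      rw [inner_sub_sub_eq, norm_sub_rev (x l) (x q), norm_sub_rev (x l) (x p),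
        hx _ _ (h1.trans h2), hx _ _ (h2.trans h3), hx _ _ h3, hx _ _ h1]
      ring
    have from_left := hv.abs_sub_le (sub_nonneg.2 (hs h1)) (sub_le_sub_right (hs h2) (s l))
      (by linarith [(hsT q).2, (hsT l).1])
    have from_right := hv.abs_sub_le (sub_nonneg.2 (hs h3)) (sub_le_sub_left (hs h2) (s m))
      (by linarith [(hsT m).2, (hsT p).1])
    rw [polarized, mul_add]
    exact (abs_add_le _ _).trans (add_le_add from_left from_right)

end RoughVariance

section IndependentProcesses
variable {Ω : Type*} [MeasurableSpace Ω] {P : Measure Ω}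

lemma inner_toLp_toLp {f g : Ω → ℝ} (hf : MemLp f 2 P) (hg : MemLp g 2 P) :
    inner ℝ hf.toLp hg.toLp = ∫ ω, f ω * g ω ∂P := by
  rw [L2.inner_def]
  refine integral_congr_ae ?_
  filter_upwards [hf.coeFn_toLp, hg.coeFn_toLp] with ω hfω hgω
  rw [hfω, hgω, RCLike.inner_apply', conj_trivial]

lemma norm_toLp_sq {f : Ω → ℝ} (hf : MemLp f 2 P) : ‖hf.toLp‖ ^ 2 = ∫ ω, f ω ^ 2 ∂P := by
  rw [← real_inner_self_eq_norm_sq, inner_toLp_toLp]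
  simp only [sq]

lemma eLpNorm_two_le_of_integral_sq_le {f : Ω → ℝ} (hf : MemLp f 2 P) {c : ℝ}
    (h : ∫ ω, f ω ^ 2 ∂P ≤ c) : eLpNorm f 2 P ≤ ENNReal.ofReal (Real.sqrt c) := by
  rw [hf.eLpNorm_eq_integral_rpow_norm two_ne_zero ENNReal.ofNat_ne_top, Real.sqrt_eq_rpow]
  simp only [ENNReal.toReal_ofNat, Real.rpow_ofNat, Real.norm_eq_abs, sq_abs, one_div]
  exact ENNReal.ofReal_le_ofReal
    (Real.rpow_le_rpow (integral_nonneg fun ω => sq_nonneg _) h (by norm_num))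

lemma memLp_two_mul_of_indep {f g : Ω → ℝ} (hf : MemLp f 2 P) (hg : MemLp g 2 P)
    (h : IndepFun (fun ω => f ω * f ω) (fun ω => g ω * g ω) P) :
    MemLp (fun ω => f ω * g ω) 2 P := by
  refine (memLp_two_iff_integrable_sq
    (hf.aestronglyMeasurable.mul hg.aestronglyMeasurable)).2 ((h.integrable_mul
      (hf.integrable_mul hf) (hg.integrable_mul hg)).congr
    (Eventually.of_forall fun ω => ?_))
  simp only [Pi.mul_apply]
  ring

lemma integral_sq_sum_mul_of_indep {ι : Type*} (S : Finset ι) {a w : ι → Ω → ℝ}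
    (ha : ∀ i, MemLp (a i) 2 P) (hw : ∀ i, MemLp (w i) 2 P)
    (hind : ∀ i j, IndepFun (fun ω => a i ω * a j ω) (fun ω => w i ω * w j ω) P) :
    ∫ ω, (∑ i ∈ S, a i ω * w i ω) ^ 2 ∂P =
      ∑ i ∈ S, ∑ j ∈ S, (∫ ω, a i ω * a j ω ∂P) * ∫ ω, w i ω * w j ω ∂P := by
  have integrable i j : Integrable (fun ω => (a i ω * a j ω) * (w i ω * w j ω)) P :=
    (hind i j).integrable_mul ((ha i).integrable_mul (ha j)) ((hw i).integrable_mul (hw j))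
  have expand ω : (∑ i ∈ S, a i ω * w i ω) ^ 2 =
      ∑ i ∈ S, ∑ j ∈ S, (a i ω * a j ω) * (w i ω * w j ω) := by
    rw [sq, Finset.sum_mul_sum]
    exact Finset.sum_congr rfl fun i _ => Finset.sum_congr rfl fun j _ => by ring
  simp only [expand]
  rw [integral_finsetSum _ fun i _ => integrable_finsetSum _ fun j _ => integrable i j]
  refine Finset.sum_congr rfl fun i _ => ?_
  rw [integral_finsetSum _ fun j _ => integrable i j]
  exact Finset.sum_congr rfl fun j _ => (hind i j).integral_fun_mul_eq_mul_integral
    ((ha i).integrable_mul (ha j)).aestronglyMeasurable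
    ((hw i).integrable_mul (hw j)).aestronglyMeasurable

section Sequences
variable {X Y : ℕ → Ω → ℝ}

lemma memLp_skewIncr (hY : ∀ n, MemLp (Y n) 2 P) (l m p : ℕ) :
    MemLp (fun ω => skewIncr (Y · ω) l m p) 2 P :=
  ((hY _).sub (hY _)).sub ((hY _).sub (hY _))

lemma indepFun_increment_mul_skewIncr_mul
    (hind : IndepFun (fun ω n => X n ω) (fun ω n => Y n ω) P) {l m p l' m' q : ℕ} :
    IndepFun (fun ω => (X (p + 1) ω - X p ω) * (X (q + 1) ω - X q ω))
      (fun ω => skewIncr (Y · ω) l m p * skewIncr (Y · ω) l' m' q) P :=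
  hind.comp (φ := fun x : ℕ → ℝ => (x (p + 1) - x p) * (x (q + 1) - x q))
    (ψ := fun y : ℕ → ℝ => skewIncr y l m p * skewIncr y l' m' q) (by fun_prop)
    (by unfold skewIncr; fun_prop)

lemma memLp_sum_increment_mul_skewIncr (hX : ∀ n, MemLp (X n) 2 P) (hY : ∀ n, MemLp (Y n) 2 P)
    (hind : IndepFun (fun ω n => X n ω) (fun ω n => Y n ω) P) (κ : ℕ → ℕ) (n : ℕ) :
    MemLp (fun ω => ∑ k ∈ Finset.range n, ∑ p ∈ Finset.Ico (κ k) (κ (k + 1)),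
      (X (p + 1) ω - X p ω) * skewIncr (Y · ω) (κ k) (κ (k + 1)) p) 2 P :=
  memLp_finsetSum _ fun _ _ => memLp_finsetSum _ fun _ _ =>
    memLp_two_mul_of_indep ((hX _).sub (hX _)) (memLp_skewIncr hY _ _ _)
      (indepFun_increment_mul_skewIncr_mul hind)

lemma integral_sq_sum_increment_mul_skewIncr (hX : ∀ n, MemLp (X n) 2 P)
    (hY : ∀ n, MemLp (Y n) 2 P) (hind : IndepFun (fun ω n => X n ω) (fun ω n => Y n ω) P)
    (κ : ℕ → ℕ) (n : ℕ) :
    ∫ ω, (∑ k ∈ Finset.range n, ∑ p ∈ Finset.Ico (κ k) (κ (k + 1)),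
      (X (p + 1) ω - X p ω) * skewIncr (Y · ω) (κ k) (κ (k + 1)) p) ^ 2 ∂P =
    ∑ k ∈ Finset.range n, ∑ j ∈ Finset.range n, areaInner (fun m => (hX m).toLp)
      (fun m => (hY m).toLp) (κ k) (κ (k + 1)) (κ j) (κ (j + 1)) := by
  let cells := (Finset.range n).sigma fun k => Finset.Ico (κ k) (κ (k + 1))
  have second_moment := integral_sq_sum_mul_of_indep cells
    (a := fun i ω => X (i.2 + 1) ω - X i.2 ω)
    (w := fun i ω => skewIncr (Y · ω) (κ i.1) (κ (i.1 + 1)) i.2)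
    (fun _ => (hX _).sub (hX _)) (fun _ => memLp_skewIncr hY _ _ _)
    fun _ _ => indepFun_increment_mul_skewIncr_mul hind
  simp only [cells, Finset.sum_sigma] at second_moment
  rw [second_moment]
  refine Finset.sum_congr rfl fun k _ => ?_
  rw [Finset.sum_comm]
  refine Finset.sum_congr rfl fun j _ => Finset.sum_congr rfl fun p _ =>
    Finset.sum_congr rfl fun q _ => ?_
  simp only [skewIncr, ← MemLp.toLp_sub, inner_toLp_toLp, Pi.sub_apply]

end Sequences

/-- A square integrable process `X` whose increments over `[0, T]` are stationary in mean square,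
with a variance controlled by the modulus `φ`. -/
structure HasRoughIncrements (P : Measure Ω) (X : ℝ → Ω → ℝ) (φ : ℝ → ℝ) (T C : ℝ) : Prop where
  memLp : ∀ t, MemLp (X t) 2 P
  exists_variance : ∃ v, IsRoughVariance v φ T C ∧ ∀ s t, 0 ≤ s → s ≤ t → t ≤ T →
    ∫ ω, (X t ω - X s ω) ^ 2 ∂P = 2 * v (t - s)

/-- The sum of `φ ^ 2` over the lengths of the cells of `D`. -/
noncomputable def Dissection.gapSqSum {T : ℝ} (φ : ℝ → ℝ) (D : Dissection T) : ℝ :=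
  ∑ k ∈ Finset.range D.n, φ (D.node (k + 1) - D.node k) ^ 2

lemma Dissection.gapSqSum_rpow_le {T α : ℝ} (hα : 1 / 2 ≤ α) (D : Dissection T) :
    D.gapSqSum (· ^ α) ≤ D.mesh ^ (2 * α - 1) * T := by
  have length : ∑ k ∈ Finset.range D.n, (D.node (k + 1) - D.node k) = T := by
    rw [Finset.sum_range_sub, D.node_n, D.node_zero, sub_zero]
  refine le_of_le_of_eq ?_ (congrArg (D.mesh ^ (2 * α - 1) * ·) length)
  rw [gapSqSum, Finset.mul_sum]
  refine Finset.sum_le_sum fun k hk => ?_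
  have gap_pos := sub_pos.2 (D.node_lt (Finset.mem_range.1 hk))
  have split := Real.rpow_add_one gap_pos.ne' (2 * α - 1)
  rw [sub_add_cancel] at split
  rw [rpow_sq gap_pos.le, split]
  exact mul_le_mul_of_nonneg_right (Real.rpow_le_rpow gap_pos.le
    (D.node_sub_le_mesh (Finset.mem_range.1 hk)) (by linarith)) gap_pos.le

namespace HasRoughIncrements
variable {X Y : ℝ → Ω → ℝ} {φ : ℝ → ℝ} {K T C C' : ℝ}

lemma mono (hX : HasRoughIncrements P X φ T C) (hφ : IsRoughModulus φ K) (hC : C ≤ C') :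
    HasRoughIncrements P X φ T C' :=
  ⟨hX.memLp, let ⟨v, hv, hXv⟩ := hX.exists_variance; ⟨v, hv.mono hφ hC, hXv⟩⟩

lemma congr (hX : HasRoughIncrements P X φ T C) (h : ∀ t, X t =ᵐ[P] Y t) :
    HasRoughIncrements P Y φ T C := by
  obtain ⟨v, hv, hXv⟩ := hX.exists_variance
  refine ⟨fun t => (hX.memLp t).ae_eq (h t), v, hv, fun s t hs hst ht => ?_⟩
  rw [← hXv s t hs hst ht]
  refine integral_congr_ae ?_
  filter_upwards [h s, h t] with ω hs_eq ht_eq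
  rw [hs_eq, ht_eq]

lemma roughGrid (hX : HasRoughIncrements P X φ T C) {s : ℕ → ℝ} (hs : Monotone s)
    (hsT : ∀ n, s n ∈ Set.Icc 0 T) : RoughGrid (fun n => (hX.memLp (s n)).toLp) s φ C := by
  obtain ⟨v, hv, hXv⟩ := hX.exists_variance
  refine hv.roughGrid hs hsT fun p q hpq => ?_
  rw [← MemLp.toLp_sub, norm_toLp_sq]
  exact hXv _ _ (hsT p).1 (hs hpq) (hsT q).2

lemma aestronglyMeasurable_sum_trapezoid (hX : HasRoughIncrements P X φ T C)
    (hY : HasRoughIncrements P Y φ T C) (I : Finset ℕ) (s : ℕ → ℝ) :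
    AEStronglyMeasurable (fun ω => ∑ p ∈ I, (X (s (p + 1)) ω - X (s p) ω) *
      (Y T ω - (Y (s p) ω + Y (s (p + 1)) ω) / 2)) P := by
  have mX t := (hX.memLp t).aestronglyMeasurable
  have mY t := (hY.memLp t).aestronglyMeasurable
  refine Finset.aestronglyMeasurable_fun_sum _ fun p _ => ((mX _).sub (mX _)).mul ((mY _).sub ?_)
  simpa only [div_eq_mul_inv, Pi.add_apply] using ((mY _).add (mY _)).mul_const _

lemma eLpNorm_trapezoid_sub_grid_le (hX : HasRoughIncrements P X φ T C)
    (hY : HasRoughIncrements P Y φ T C) (hC : 0 ≤ C) (hφ : IsRoughModulus φ K)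
    (hind : IndepFun (fun ω t => X t ω) (fun ω t => Y t ω) P) {s : ℕ → ℝ} (hs : Monotone s)
    (hsT : ∀ n, s n ∈ Set.Icc 0 T) (D : Dissection T) {κ : ℕ → ℕ} (hκ : Monotone κ)
    (hsκ : ∀ k, s (κ k) = D.node k) :
    eLpNorm (fun ω => ∑ p ∈ Finset.Ico (κ 0) (κ D.n), (X (s (p + 1)) ω - X (s p) ω) *
      (Y T ω - (Y (s p) ω + Y (s (p + 1)) ω) / 2) - D.trapezoid (X · ω) (Y · ω)) 2 P ≤
      ENNReal.ofReal (Real.sqrt ((32 + 8 * K) * C ^ 2 * D.gapSqSum φ)) := by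
  have hind_grid : IndepFun (fun ω n => X (s n) ω) (fun ω n => Y (s n) ω) P :=
    hind.comp (φ := fun (x : ℝ → ℝ) n => x (s n)) (ψ := fun (y : ℝ → ℝ) n => y (s n))
      (by fun_prop) (by fun_prop)
  have error_eq ω : ∑ p ∈ Finset.Ico (κ 0) (κ D.n), (X (s (p + 1)) ω - X (s p) ω) *
      (Y T ω - (Y (s p) ω + Y (s (p + 1)) ω) / 2) - D.trapezoid (X · ω) (Y · ω) =
      2⁻¹ * ∑ k ∈ Finset.range D.n, ∑ p ∈ Finset.Ico (κ k) (κ (k + 1)),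
        (X (s (p + 1)) ω - X (s p) ω) * skewIncr (fun n => Y (s n) ω) (κ k) (κ (k + 1)) p := by
    have := trapezoid_sub_eq (fun n => X (s n) ω) (fun n => Y (s n) ω) (Y T ω) hκ D.n
    simpa only [Dissection.trapezoid, skewIncr, hsκ] using this
  simp only [error_eq]
  refine eLpNorm_two_le_of_integral_sq_le ((memLp_sum_increment_mul_skewIncr
    (fun n => hX.memLp (s n)) (fun n => hY.memLp (s n)) hind_grid κ D.n).const_mul _) ?_
  have area_le := (hX.roughGrid hs hsT).sum_areaInner_le (hY.roughGrid hs hsT) hC hφ hs hκ D.n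
  simp only [hsκ] at area_le
  change _ ≤ (32 + 8 * K) * C ^ 2 * D.gapSqSum φ at area_le
  rw [← integral_sq_sum_increment_mul_skewIncr _ _ hind_grid] at area_le
  simp only [mul_pow]
  rw [integral_const_mul]
  exact (mul_le_of_le_one_left (integral_nonneg fun _ => sq_nonneg _) (by norm_num)).trans area_le

lemma eLpNorm_trapezoid_sub_le (hX : HasRoughIncrements P X φ T C)
    (hY : HasRoughIncrements P Y φ T C) (hC : 0 ≤ C) (hφ : IsRoughModulus φ K)
    (hind : IndepFun (fun ω t => X t ω) (fun ω t => Y t ω) P) (D D' : Dissection T) :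
    eLpNorm (fun ω => D.trapezoid (X · ω) (Y · ω) - D'.trapezoid (X · ω) (Y · ω)) 2 P ≤
      ENNReal.ofReal (Real.sqrt ((32 + 8 * K) * C ^ 2 * D.gapSqSum φ)) +
      ENNReal.ofReal (Real.sqrt ((32 + 8 * K) * C ^ 2 * D'.gapSqSum φ)) := by
  obtain ⟨s, κ, κ', hs, hsT, hκ, hκ', first_eq, last_eq, hsκ, hsκ'⟩ :=
    Dissection.exists_refinement D D'
  have left_le := hX.eLpNorm_trapezoid_sub_grid_le hY hC hφ hind hs hsT D hκ hsκ
  have right_le := hX.eLpNorm_trapezoid_sub_grid_le hY hC hφ hind hs hsT D' hκ' hsκ'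
  rw [← first_eq, ← last_eq] at right_le
  set refined : Ω → ℝ := fun ω => ∑ p ∈ Finset.Ico (κ 0) (κ D.n),
    (X (s (p + 1)) ω - X (s p) ω) * (Y T ω - (Y (s p) ω + Y (s (p + 1)) ω) / 2)
  have refined_sub (D : Dissection T) :
      AEStronglyMeasurable (fun ω => refined ω - D.trapezoid (X · ω) (Y · ω)) P :=
    (hX.aestronglyMeasurable_sum_trapezoid hY _ s).sub
      (hX.aestronglyMeasurable_sum_trapezoid hY _ D.node)
  have split : (fun ω => D.trapezoid (X · ω) (Y · ω) - D'.trapezoid (X · ω) (Y · ω)) =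
      (fun ω => refined ω - D'.trapezoid (X · ω) (Y · ω)) -
        fun ω => refined ω - D.trapezoid (X · ω) (Y · ω) := by
    funext ω
    exact (sub_sub_sub_cancel_left ..).symm
  rw [split, add_comm]
  exact (eLpNorm_sub_le (refined_sub D') (refined_sub D) one_le_two).trans
    (add_le_add right_le left_le)

lemma exists_tendsto_eLpNorm_trapezoid_sub_le {α : ℝ} (h0 : 1 / 2 < α) (h1 : α ≤ 1)
    (hX : HasRoughIncrements P X (· ^ α) T C) (hY : HasRoughIncrements P Y (· ^ α) T C')
    (hC : 0 ≤ C) (hind : IndepFun (fun ω t => X t ω) (fun ω t => Y t ω) P) :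
    ∃ g : ℝ → ℝ≥0∞, Tendsto g (𝓝 0) (𝓝 0) ∧ ∀ D D' : Dissection T,
      eLpNorm (fun ω => D.trapezoid (X · ω) (Y · ω) - D'.trapezoid (X · ω) (Y · ω)) 2 P ≤
        g D.mesh + g D'.mesh := by
  have hφ := isRoughModulus_rpow h0 h1
  set c := (32 + 8 * ((1 - α) / (2 * (2 * α - 1)))) * max C C' ^ 2
  have hc : 0 ≤ c :=
    mul_nonneg (add_nonneg (by norm_num) (mul_nonneg (by norm_num) hφ.const_nonneg)) (sq_nonneg _)
  have gap_le (D : Dissection T) : ENNReal.ofReal √(c * D.gapSqSum (· ^ α)) ≤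
      ENNReal.ofReal √(c * (D.mesh ^ (2 * α - 1) * T)) :=
    ENNReal.ofReal_le_ofReal (Real.sqrt_le_sqrt
      (mul_le_mul_of_nonneg_left (D.gapSqSum_rpow_le h0.le) hc))
  refine ⟨fun m => ENNReal.ofReal √(c * (m ^ (2 * α - 1) * T)), ?_, fun D D' =>
    ((hX.mono hφ (le_max_left _ _)).eLpNorm_trapezoid_sub_le (hY.mono hφ (le_max_right _ _))
      (hC.trans (le_max_left _ _)) hφ hind D D').trans (add_le_add (gap_le D) (gap_le D'))⟩
  have continuous_modulus : Continuous fun m : ℝ => √(c * (m ^ (2 * α - 1) * T)) :=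
    Real.continuous_sqrt.comp (continuous_const.mul
      ((Real.continuous_rpow_const (by linarith)).mul continuous_const))
  have at_zero : √(c * ((0 : ℝ) ^ (2 * α - 1) * T)) = 0 := by
    rw [Real.zero_rpow (by linarith), zero_mul, mul_zero, Real.sqrt_zero]
  simpa only [at_zero, ENNReal.ofReal_zero] using
    ENNReal.tendsto_ofReal (continuous_modulus.tendsto 0)

end HasRoughIncrements

section Trapezoid
variable {X Y : ℝ → Ω → ℝ} {T : ℝ}

lemma memLp_sub_midpoint (hY : ∀ t, MemLp (Y t) 2 P) (s t u : ℝ) :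
    MemLp (fun ω => Y s ω - (Y t ω + Y u ω) / 2) 2 P := by
  simp only [div_eq_mul_inv]
  exact (hY s).sub (((hY t).add (hY u)).mul_const 2⁻¹)

lemma indepFun_increment_sub_midpoint
    (hind : IndepFun (fun ω t => X t ω) (fun ω t => Y t ω) P) (r s t : ℝ) :
    IndepFun (fun ω => X t ω - X s ω) (fun ω => Y r ω - (Y s ω + Y t ω) / 2) P :=
  hind.comp (φ := fun x : ℝ → ℝ => x t - x s) (ψ := fun y : ℝ → ℝ => y r - (y s + y t) / 2)
    (by fun_prop) (by fun_prop)

lemma Dissection.memLp_trapezoid_of_indep (hX : ∀ t, MemLp (X t) 2 P) (hY : ∀ t, MemLp (Y t) 2 P)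
    (hind : IndepFun (fun ω t => X t ω) (fun ω t => Y t ω) P) (D : Dissection T) :
    MemLp (fun ω => D.trapezoid (X · ω) (Y · ω)) 2 P :=
  memLp_finsetSum _ fun _ _ => memLp_two_mul_of_indep ((hX _).sub (hX _))
    (memLp_sub_midpoint hY _ _ _) ((indepFun_increment_sub_midpoint hind _ _ _).comp
      (φ := fun a => a * a) (ψ := fun a => a * a) (by fun_prop) (by fun_prop))

lemma Dissection.integral_trapezoid_of_indep [IsFiniteMeasure P] (hX : ∀ t, MemLp (X t) 2 P)
    (hY : ∀ t, MemLp (Y t) 2 P) (hind : IndepFun (fun ω t => X t ω) (fun ω t => Y t ω) P)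
    (h_mean : ∀ s t, ∫ ω, X s ω ∂P = ∫ ω, X t ω ∂P) (D : Dissection T) :
    ∫ ω, D.trapezoid (X · ω) (Y · ω) ∂P = 0 := by
  have integrable_X t := (hX t).integrable one_le_two
  have integrable_Y r s t := (memLp_sub_midpoint hY r s t).integrable one_le_two
  have mean_increment s t : ∫ ω, X t ω - X s ω ∂P = 0 := by
    rw [integral_sub (integrable_X t) (integrable_X s), h_mean t s, sub_self]
  have integrable_cell r s t :
      Integrable (fun ω => (X t ω - X s ω) * (Y r ω - (Y s ω + Y t ω) / 2)) P :=
    (indepFun_increment_sub_midpoint hind r s t).integrable_mul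
      ((integrable_X t).sub (integrable_X s)) (integrable_Y r s t)
  simp only [trapezoid]
  rw [integral_finsetSum _ fun _ _ => integrable_cell _ _ _]
  refine Finset.sum_eq_zero fun k _ => ?_
  rw [(indepFun_increment_sub_midpoint hind _ _ _).integral_fun_mul_eq_mul_integral
    ((hX _).sub (hX _)).aestronglyMeasurable (memLp_sub_midpoint hY _ _ _).aestronglyMeasurable,
    mean_increment, zero_mul]

end Trapezoid

end IndependentProcesses

/-! ### Spectral representation of the autocovariance -/

lemma integrableOn_Ioi_of_rpow_bounds {g : ℝ → ℝ} (hg : Measurable g) {A B a b : ℝ} (ha : -1 < a)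
    (hb : b < -1) (h_zero : ∀ l, 0 < l → |g l| ≤ A * l ^ a)
    (h_top : ∀ l, 0 < l → |g l| ≤ B * l ^ b) :
    IntegrableOn g (Set.Ioi 0) := by
  rw [← Set.Ioc_union_Ioi_eq_Ioi zero_le_one]
  refine IntegrableOn.union ?_ ?_
  · have hi : IntegrableOn (fun l : ℝ => A * l ^ a) (Set.Ioc 0 1) :=
      ((intervalIntegrable_iff_integrableOn_Ioc_of_le zero_le_one).1
        (intervalIntegral.intervalIntegrable_rpow' ha)).const_mul A
    refine Integrable.mono' hi hg.aestronglyMeasurable ?_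
    filter_upwards [ae_restrict_mem measurableSet_Ioc] with l hl using h_zero l hl.1
  · have hi : IntegrableOn (fun l : ℝ => B * l ^ b) (Set.Ioi 1) :=
      (integrableOn_Ioi_rpow_of_lt hb one_pos).const_mul B
    refine Integrable.mono' hi hg.aestronglyMeasurable ?_
    filter_upwards [ae_restrict_mem measurableSet_Ioi] with l hl
      using h_top l (one_pos.trans hl)

lemma rpow_one_sub_two_mul_eq {l : ℝ} (hl : 0 < l) (H : ℝ) :
    l ^ (1 - 2 * H) = l ^ (-1 - 2 * H) * l ^ 2 := by
  rw [← Real.rpow_natCast l 2, ← Real.rpow_add hl]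
  congr 1
  push_cast
  ring

lemma one_sub_cos_mem_Icc (x : ℝ) : 1 - Real.cos x ∈ Set.Icc 0 (x ^ 2 / 2) :=
  ⟨by linarith [Real.cos_le_one x], by linarith [Real.one_sub_sq_div_two_le_cos (x := x)]⟩

lemma integral_cos_mul_zero_left (l s : ℝ) (hl : l ≠ 0) :
    ∫ u in (0 : ℝ)..s, Real.cos (l * u) = Real.sin (l * s) / l := by
  rw [intervalIntegral.integral_comp_mul_left (fun u => Real.cos u) hl]
  simp [div_eq_inv_mul]

lemma integral_sin_mul_div_zero_left (l t : ℝ) (hl : l ≠ 0) :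
    ∫ s in (0 : ℝ)..t, Real.sin (l * s) / l = (1 - Real.cos (l * t)) / l ^ 2 := by
  rw [intervalIntegral.integral_div,
    intervalIntegral.integral_comp_mul_left (fun u => Real.sin u) hl]
  simp only [mul_zero, integral_sin, Real.cos_zero, smul_eq_mul]
  field_simp

section SpectralDensity

variable {H θ : ℝ}

lemma measurable_fouSpectral (H θ : ℝ) : Measurable (fouSpectral H θ) := by
  unfold fouSpectral
  fun_prop

lemma fouSpectral_pos {l : ℝ} (hl : 0 < l) : 0 < fouSpectral H θ l := by
  unfold fouSpectral
  positivity

lemma integrableOn_fouSpectral (h0 : 0 < H) (h1 : H < 1) (hθ : 0 < θ) :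
    IntegrableOn (fouSpectral H θ) (Set.Ioi 0) := by
  refine integrableOn_Ioi_of_rpow_bounds (measurable_fouSpectral H θ) (A := 1 / θ ^ 2) (B := 1)
    (a := 1 - 2 * H) (b := -1 - 2 * H) (by linarith) (by linarith) ?_ ?_
  · intro l hl
    rw [abs_of_pos (fouSpectral_pos hl), fouSpectral, one_div_mul_eq_div]
    gcongr
    exact le_add_of_nonneg_right (sq_nonneg l)
  · intro l hl
    rw [abs_of_pos (fouSpectral_pos hl), fouSpectral, one_mul, div_le_iff₀ (by positivity),
      rpow_one_sub_two_mul_eq hl]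
    gcongr
    exact le_add_of_nonneg_left (sq_nonneg θ)

lemma integrableOn_mul_fouSpectral (h0 : 0 < H) (h1 : H < 1) (hθ : 0 < θ) {g : ℝ → ℝ}
    (hg : Measurable g) {c : ℝ} (hc : ∀ l, 0 < l → |g l| ≤ c) :
    IntegrableOn (fun l => g l * fouSpectral H θ l) (Set.Ioi 0) := by
  refine Integrable.bdd_mul (integrableOn_fouSpectral h0 h1 hθ) hg.aestronglyMeasurable (c := c) ?_
  filter_upwards [ae_restrict_mem measurableSet_Ioi] with l hl using hc l hl

lemma integrableOn_cos_mul_fouSpectral (h0 : 0 < H) (h1 : H < 1) (hθ : 0 < θ) (t : ℝ) :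
    IntegrableOn (fun l => Real.cos (l * t) * fouSpectral H θ l) (Set.Ioi 0) :=
  integrableOn_mul_fouSpectral h0 h1 hθ (by fun_prop) fun _ _ => Real.abs_cos_le_one _

lemma integral_fouSpectral_pos (h0 : 0 < H) (h1 : H < 1) (hθ : 0 < θ) :
    0 < ∫ l in Set.Ioi (0 : ℝ), fouSpectral H θ l := by
  rw [setIntegral_pos_iff_support_of_nonneg_ae _ (integrableOn_fouSpectral h0 h1 hθ)]
  · have h_support : Set.Ioi (0 : ℝ) ⊆ Function.support (fouSpectral H θ) ∩ Set.Ioi 0 :=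
      fun l hl => ⟨(fouSpectral_pos hl).ne', hl⟩
    exact lt_of_lt_of_le (by simp) (measure_mono h_support)
  · filter_upwards [ae_restrict_mem measurableSet_Ioi] with l hl using (fouSpectral_pos hl).le

lemma integral_fouSpectral_eq_scale (hθ : 0 < θ) :
    ∫ u in Set.Ioi (0 : ℝ), fouSpectral H 1 u =
      θ ^ (2 * H) * ∫ l in Set.Ioi (0 : ℝ), fouSpectral H θ l := by
  have h_subst := integral_comp_mul_left_Ioi' (fouSpectral H θ) 0 hθ
  rw [mul_zero] at h_subst
  rw [← h_subst, smul_eq_mul, ← integral_const_mul, ← integral_const_mul]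
  refine setIntegral_congr_fun measurableSet_Ioi fun x (hx : 0 < x) => ?_
  simp only [fouSpectral]
  rw [Real.mul_rpow hθ.le hx.le, Real.rpow_sub hθ, Real.rpow_one, mul_pow, one_pow]
  have : θ ^ (2 * H) ≠ 0 := by positivity
  have : θ ^ 2 + θ ^ 2 * x ^ 2 ≠ 0 := by positivity
  field_simp

lemma integral_integral_mul_fouSpectral_comm (h0 : 0 < H) (h1 : H < 1) (hθ : 0 < θ)
    {k : ℝ → ℝ → ℝ} (hk : Measurable (Function.uncurry k)) {c t : ℝ} (ht : 0 ≤ t)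
    (hc : ∀ s ∈ Set.Ioc 0 t, ∀ l, 0 < l → |k s l| ≤ c) :
    ∫ s in (0 : ℝ)..t, ∫ l in Set.Ioi (0 : ℝ), k s l * fouSpectral H θ l =
      ∫ l in Set.Ioi (0 : ℝ), (∫ s in (0 : ℝ)..t, k s l) * fouSpectral H θ l := by
  rw [intervalIntegral_integral_swap]
  · simp only [intervalIntegral.integral_mul_const]
  · rw [Set.uIoc_of_le ht]
    refine ((integrableOn_fouSpectral h0 h1 hθ).comp_snd (volume.restrict (Set.Ioc 0 t))).bdd_mul
      hk.aestronglyMeasurable (c := c) ?_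
    rw [Measure.prod_restrict]
    filter_upwards [ae_restrict_mem (measurableSet_Ioc.prod measurableSet_Ioi)] with z hz
    exact hc z.1 hz.1 z.2 hz.2

end SpectralDensity

section OneSubCos

variable {H : ℝ}

lemma integrableOn_one_sub_cos_mul_rpow (h0 : 0 < H) (h1 : H < 1) (t : ℝ) :
    IntegrableOn (fun l : ℝ => (1 - Real.cos (l * t)) * l ^ (-1 - 2 * H)) (Set.Ioi 0) := by
  refine integrableOn_Ioi_of_rpow_bounds (by fun_prop) (A := t ^ 2 / 2) (B := 2)
    (a := 1 - 2 * H) (b := -1 - 2 * H) (by linarith) (by linarith) ?_ ?_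
  · intro l hl
    have h_cos := one_sub_cos_mem_Icc (l * t)
    rw [abs_of_nonneg (mul_nonneg h_cos.1 (by positivity)), rpow_one_sub_two_mul_eq hl]
    calc (1 - Real.cos (l * t)) * l ^ (-1 - 2 * H)
        ≤ (l * t) ^ 2 / 2 * l ^ (-1 - 2 * H) := by gcongr; exact h_cos.2
      _ = t ^ 2 / 2 * (l ^ (-1 - 2 * H) * l ^ 2) := by ring
  · intro l hl
    rw [abs_of_nonneg (mul_nonneg (one_sub_cos_mem_Icc _).1 (by positivity))]
    gcongr
    linarith [Real.neg_one_le_cos (l * t)]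

lemma integral_one_sub_cos_mul_rpow_eq_scale (h0 : 0 < H) {t : ℝ} (ht : 0 ≤ t) :
    ∫ l in Set.Ioi (0 : ℝ), (1 - Real.cos (l * t)) * l ^ (-1 - 2 * H) =
      t ^ (2 * H) * ∫ u in Set.Ioi (0 : ℝ), (1 - Real.cos u) * u ^ (-1 - 2 * H) := by
  rcases ht.eq_or_lt with rfl | ht
  · simp [Real.zero_rpow (by linarith : 2 * H ≠ 0)]
  · have h_subst := integral_comp_mul_left_Ioi' (fun u => (1 - Real.cos u) * u ^ (-1 - 2 * H)) 0 ht
    rw [mul_zero] at h_subst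
    rw [← h_subst, smul_eq_mul, ← integral_const_mul, ← integral_const_mul]
    refine setIntegral_congr_fun measurableSet_Ioi fun x (hx : 0 < x) => ?_
    have h_cancel : t ^ (2 * H) * (t * (t ^ (-1 - 2 * H))) = 1 := by
      rw [← Real.rpow_one_add' ht.le (by linarith), ← Real.rpow_add ht]
      ring_nf
      exact Real.rpow_zero t
    rw [Real.mul_rpow ht.le hx.le, mul_comm x t]
    linear_combination (1 - Real.cos (t * x)) * x ^ (-1 - 2 * H) * (-h_cancel)

lemma hasDerivAt_exp_neg_mul (c x : ℝ) :
    HasDerivAt (fun u => Real.exp (-(c * u))) (Real.exp (-(c * x)) * (-c)) x := by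
  simpa using ((hasDerivAt_id x).const_mul c).neg.exp

lemma tendsto_exp_neg_mul_mul_trig {x : ℝ} (hx : 0 < x) (a b c : ℝ) :
    Tendsto (fun u => Real.exp (-(x * u)) * (a + b * Real.sin u + c * Real.cos u)) atTop
      (𝓝 0) := by
  have h_exp : Tendsto (fun u : ℝ => Real.exp (-(x * u))) atTop (𝓝 0) :=
    Real.tendsto_exp_neg_atTop_nhds_zero.comp (tendsto_id.const_mul_atTop hx)
  refine h_exp.zero_mul_isBoundedUnder_le (isBoundedUnder_of ⟨|a| + |b| + |c|, fun u => ?_⟩)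
  calc |a + b * Real.sin u + c * Real.cos u|
      ≤ |a| + |b * Real.sin u| + |c * Real.cos u| := abs_add_three _ _ _
    _ ≤ |a| + |b| + |c| := by
        rw [abs_mul, abs_mul]
        gcongr
        · exact mul_le_of_le_one_right (abs_nonneg b) (Real.abs_sin_le_one u)
        · exact mul_le_of_le_one_right (abs_nonneg c) (Real.abs_cos_le_one u)

lemma integral_exp_neg_mul_mul_one_sub_cos {x : ℝ} (hx : 0 < x) :
    ∫ u in Set.Ioi (0 : ℝ), Real.exp (-(x * u)) * (1 - Real.cos u) = 1 / (x * (1 + x ^ 2)) := by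
  have hx2 : 1 + x ^ 2 ≠ 0 := by positivity
  have h_deriv (u : ℝ) : HasDerivAt (fun u => Real.exp (-(x * u)) *
      (-(1 / x) + -(1 / (1 + x ^ 2)) * Real.sin u + x / (1 + x ^ 2) * Real.cos u))
      (Real.exp (-(x * u)) * (1 - Real.cos u)) u := by
    refine ((hasDerivAt_exp_neg_mul x u).mul ((((Real.hasDerivAt_sin u).const_mul _).const_add
      _).add ((Real.hasDerivAt_cos u).const_mul _))).congr_deriv ?_
    simp only [Pi.add_apply]
    field_simp
    ring
  rw [integral_Ioi_of_hasDerivAt_of_nonneg' (fun u _ => h_deriv u)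
    (fun u _ => mul_nonneg (Real.exp_pos _).le (one_sub_cos_mem_Icc u).1)
    (tendsto_exp_neg_mul_mul_trig hx _ _ _)]
  simp only [mul_zero, neg_zero, Real.exp_zero, Real.sin_zero, Real.cos_zero, mul_one, add_zero,
    one_mul, zero_sub]
  field_simp
  ring

lemma integral_rpow_mul_exp_neg_mul (h0 : 0 < H) {u : ℝ} (hu : 0 < u) :
    ∫ x in Set.Ioi (0 : ℝ), x ^ (2 * H) * Real.exp (-(u * x)) =
      u ^ (-1 - 2 * H) * Real.Gamma (2 * H + 1) := by
  have h_gamma := Real.integral_rpow_mul_exp_neg_mul_Ioi (a := 2 * H + 1) (by linarith) hu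
  rw [add_sub_cancel_right] at h_gamma
  rw [h_gamma, one_div, Real.inv_rpow hu.le, ← Real.rpow_neg hu.le]
  congr 2
  ring

lemma integrable_one_sub_cos_mul_rpow_mul_exp (h0 : 0 < H) (h1 : H < 1) :
    Integrable (fun z : ℝ × ℝ => (1 - Real.cos z.1) * (z.2 ^ (2 * H) * Real.exp (-(z.1 * z.2))))
      ((volume.restrict (Set.Ioi 0)).prod (volume.restrict (Set.Ioi 0))) := by
  rw [integrable_prod_iff (by fun_prop)]
  constructor
  · filter_upwards [ae_restrict_mem measurableSet_Ioi] with u (hu : 0 < u)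
    refine Integrable.const_mul (.of_integral_ne_zero ?_) _
    rw [integral_rpow_mul_exp_neg_mul h0 hu]
    have : 0 < Real.Gamma (2 * H + 1) := Real.Gamma_pos_of_pos (by linarith)
    positivity
  · refine ((integrableOn_one_sub_cos_mul_rpow h0 h1 1).mul_const (Real.Gamma (2 * H + 1))).congr ?_
    filter_upwards [ae_restrict_mem measurableSet_Ioi] with u hu
    rw [mul_one, mul_assoc, ← integral_rpow_mul_exp_neg_mul h0 hu, ← integral_const_mul]
    refine setIntegral_congr_fun measurableSet_Ioi fun x (hx : 0 < x) => ?_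
    exact (abs_of_nonneg (mul_nonneg (one_sub_cos_mem_Icc u).1 (by positivity))).symm

lemma integral_rpow_div_mul_one_add_sq :
    ∫ x in Set.Ioi (0 : ℝ), x ^ (2 * H) * (1 / (x * (1 + x ^ 2))) =
      ∫ u in Set.Ioi (0 : ℝ), fouSpectral H 1 u := by
  rw [← integral_comp_rpow_Ioi _ (show (-1 : ℝ) ≠ 0 by norm_num)]
  refine setIntegral_congr_fun measurableSet_Ioi fun x (hx : 0 < x) => ?_
  simp only [smul_eq_mul, fouSpectral, abs_neg, abs_one, one_mul, Real.rpow_neg_one, one_pow]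
  have h_rpow : x ^ (1 - 2 * H) = x * x ^ (-(2 * H)) := by
    rw [sub_eq_add_neg, Real.rpow_add hx, Real.rpow_one]
  have h_jac : x ^ (-1 - 1 : ℝ) = (x ^ 2)⁻¹ := by
    rw [show (-1 - 1 : ℝ) = -(2 : ℕ) by norm_num, Real.rpow_neg hx.le, Real.rpow_natCast]
  rw [Real.inv_rpow hx.le, ← Real.rpow_neg hx.le, h_rpow, h_jac]
  field_simp
  ring

lemma gamma_mul_integral_one_sub_cos_mul_rpow (h0 : 0 < H) (h1 : H < 1) :
    Real.Gamma (2 * H + 1) * ∫ u in Set.Ioi (0 : ℝ), (1 - Real.cos u) * u ^ (-1 - 2 * H) =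
      ∫ u in Set.Ioi (0 : ℝ), fouSpectral H 1 u := by
  calc Real.Gamma (2 * H + 1) * ∫ u in Set.Ioi (0 : ℝ), (1 - Real.cos u) * u ^ (-1 - 2 * H)
      = ∫ u in Set.Ioi (0 : ℝ), ∫ x in Set.Ioi (0 : ℝ),
          (1 - Real.cos u) * (x ^ (2 * H) * Real.exp (-(u * x))) := by
        rw [← integral_const_mul]
        refine setIntegral_congr_fun measurableSet_Ioi fun u hu => ?_
        rw [integral_const_mul, integral_rpow_mul_exp_neg_mul h0 hu]
        ring
    _ = ∫ x in Set.Ioi (0 : ℝ), ∫ u in Set.Ioi (0 : ℝ),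
          (1 - Real.cos u) * (x ^ (2 * H) * Real.exp (-(u * x))) :=
        integral_integral_swap (integrable_one_sub_cos_mul_rpow_mul_exp h0 h1)
    _ = ∫ x in Set.Ioi (0 : ℝ), x ^ (2 * H) * (1 / (x * (1 + x ^ 2))) := by
        refine setIntegral_congr_fun measurableSet_Ioi fun x hx => ?_
        rw [← integral_exp_neg_mul_mul_one_sub_cos hx, ← integral_const_mul]
        refine setIntegral_congr_fun measurableSet_Ioi fun u _ => ?_
        rw [mul_comm u x]
        ring
    _ = ∫ u in Set.Ioi (0 : ℝ), fouSpectral H 1 u := integral_rpow_div_mul_one_add_sq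

end OneSubCos

section SpectralCov

variable {H θ : ℝ}

/-- The covariance function with spectral density proportional to `fouSpectral H θ`, normalized by
`fouZeta H θ σ`; it is the autocovariance of the stationary fractional Ornstein-Uhlenbeck
process. -/
noncomputable def spectralCov (H θ σ t : ℝ) : ℝ :=
  2 * fouZeta H θ σ * ∫ l in Set.Ioi (0 : ℝ), Real.cos (l * t) * fouSpectral H θ l

lemma spectralCov_zero_sub (h0 : 0 < H) (h1 : H < 1) (hθ : 0 < θ) (σ t : ℝ) :
    spectralCov H θ σ 0 - spectralCov H θ σ t = 2 * fouZeta H θ σ *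
      ∫ l in Set.Ioi (0 : ℝ), (1 - Real.cos (l * t)) * fouSpectral H θ l := by
  rw [spectralCov, spectralCov, ← mul_sub,
    ← integral_sub (integrableOn_cos_mul_fouSpectral h0 h1 hθ 0)
      (integrableOn_cos_mul_fouSpectral h0 h1 hθ t)]
  simp only [mul_zero, Real.cos_zero, sub_mul]

lemma norm_cos_mul_fouSpectral_le (t : ℝ) {l : ℝ} (hl : 0 < l) :
    ‖Real.cos (l * t) * fouSpectral H θ l‖ ≤ fouSpectral H θ l := by
  rw [norm_mul, Real.norm_eq_abs, Real.norm_eq_abs, abs_of_pos (fouSpectral_pos hl)]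
  exact mul_le_of_le_one_left (fouSpectral_pos hl).le (Real.abs_cos_le_one _)

lemma abs_spectralCov_le (h0 : 0 < H) (h1 : H < 1) (hθ : 0 < θ) (σ t : ℝ) :
    |spectralCov H θ σ t| ≤ |2 * fouZeta H θ σ| * ∫ l in Set.Ioi (0 : ℝ), fouSpectral H θ l := by
  rw [spectralCov, abs_mul]
  gcongr
  refine norm_integral_le_of_norm_le (f := fun l => Real.cos (l * t) * fouSpectral H θ l)
    (integrableOn_fouSpectral h0 h1 hθ) ?_
  filter_upwards [ae_restrict_mem measurableSet_Ioi] with l hl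
    using norm_cos_mul_fouSpectral_le t hl

lemma continuous_spectralCov (h0 : 0 < H) (h1 : H < 1) (hθ : 0 < θ) (σ : ℝ) :
    Continuous (spectralCov H θ σ) := by
  refine continuous_const.mul (continuous_of_dominated (bound := fouSpectral H θ) (fun t => ?_)
    (fun t => ?_) (integrableOn_fouSpectral h0 h1 hθ) ?_)
  · exact ((by fun_prop : Measurable fun l => Real.cos (l * t)).mul
      (measurable_fouSpectral H θ)).aestronglyMeasurable
  · filter_upwards [ae_restrict_mem measurableSet_Ioi] with l hl
      using norm_cos_mul_fouSpectral_le t hl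
  · exact Eventually.of_forall fun l => by fun_prop

lemma integral_spectralCov (h0 : 0 < H) (h1 : H < 1) (hθ : 0 < θ) (σ : ℝ) {s : ℝ} (hs : 0 ≤ s) :
    ∫ u in (0 : ℝ)..s, spectralCov H θ σ u = 2 * fouZeta H θ σ *
      ∫ l in Set.Ioi (0 : ℝ), Real.sin (l * s) / l * fouSpectral H θ l := by
  simp only [spectralCov]
  rw [intervalIntegral.integral_const_mul,
    integral_integral_mul_fouSpectral_comm h0 h1 hθ (k := fun u l => Real.cos (l * u)) (c := 1)
      (by simp only [Function.uncurry_def]; fun_prop) hs fun u _ l _ => Real.abs_cos_le_one _]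
  congr 1
  refine setIntegral_congr_fun measurableSet_Ioi fun l hl => ?_
  rw [integral_cos_mul_zero_left l s (ne_of_gt hl)]

lemma abs_sin_mul_div_le {s l : ℝ} (hs : 0 ≤ s) (hl : 0 < l) : |Real.sin (l * s) / l| ≤ s := by
  rw [abs_div, abs_of_pos hl, div_le_iff₀ hl, mul_comm s l]
  exact Real.abs_sin_le_abs.trans_eq (abs_of_nonneg (by positivity))

lemma integral_integral_spectralCov (h0 : 0 < H) (h1 : H < 1) (hθ : 0 < θ) (σ : ℝ) {t : ℝ}
    (ht : 0 ≤ t) :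
    ∫ s in (0 : ℝ)..t, ∫ u in (0 : ℝ)..s, spectralCov H θ σ u = 2 * fouZeta H θ σ *
      ∫ l in Set.Ioi (0 : ℝ), (1 - Real.cos (l * t)) / l ^ 2 * fouSpectral H θ l := by
  have h_inner : Set.EqOn (fun s => ∫ u in (0 : ℝ)..s, spectralCov H θ σ u)
      (fun s => 2 * fouZeta H θ σ *
        ∫ l in Set.Ioi (0 : ℝ), Real.sin (l * s) / l * fouSpectral H θ l) (Set.uIcc 0 t) := by
    intro s hs
    rw [Set.uIcc_of_le ht] at hs
    exact integral_spectralCov h0 h1 hθ σ hs.1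
  rw [intervalIntegral.integral_congr h_inner, intervalIntegral.integral_const_mul,
    integral_integral_mul_fouSpectral_comm h0 h1 hθ (k := fun s l => Real.sin (l * s) / l)
      (by simp only [Function.uncurry_def]; fun_prop) ht
      fun s hs l hl => (abs_sin_mul_div_le hs.1.le hl).trans hs.2]
  congr 1
  refine setIntegral_congr_fun measurableSet_Ioi fun l hl => ?_
  rw [integral_sin_mul_div_zero_left l t (ne_of_gt hl)]

lemma integral_one_sub_cos_mul_fouSpectral_add (h0 : 0 < H) (h1 : H < 1) (hθ : 0 < θ) (t : ℝ) :
    (∫ l in Set.Ioi (0 : ℝ), (1 - Real.cos (l * t)) * fouSpectral H θ l) +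
        θ ^ 2 * ∫ l in Set.Ioi (0 : ℝ), (1 - Real.cos (l * t)) / l ^ 2 * fouSpectral H θ l =
      ∫ l in Set.Ioi (0 : ℝ), (1 - Real.cos (l * t)) * l ^ (-1 - 2 * H) := by
  have h_int : IntegrableOn (fun l => (1 - Real.cos (l * t)) * fouSpectral H θ l) (Set.Ioi 0) := by
    refine integrableOn_mul_fouSpectral h0 h1 hθ (by fun_prop) (c := 2) fun l _ => ?_
    rw [abs_of_nonneg (one_sub_cos_mem_Icc _).1]
    linarith [Real.neg_one_le_cos (l * t)]
  have h_int_div : IntegrableOn (fun l => (1 - Real.cos (l * t)) / l ^ 2 * fouSpectral H θ l)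
      (Set.Ioi 0) := by
    refine integrableOn_mul_fouSpectral h0 h1 hθ (by fun_prop) (c := t ^ 2 / 2) fun l hl => ?_
    have h_cos := one_sub_cos_mem_Icc (l * t)
    rw [abs_of_nonneg (div_nonneg h_cos.1 (by positivity)), div_le_iff₀ (by positivity)]
    exact h_cos.2.trans_eq (by ring)
  rw [← integral_const_mul, ← integral_add h_int (h_int_div.const_mul _)]
  refine setIntegral_congr_fun measurableSet_Ioi fun l (hl : 0 < l) => ?_
  have : θ ^ 2 + l ^ 2 ≠ 0 := by positivity
  simp only [fouSpectral]
  rw [rpow_one_sub_two_mul_eq hl]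
  field_simp
  ring

lemma four_mul_fouZeta_mul_integral_one_sub_cos_mul_rpow (h0 : 0 < H) (h1 : H < 1) (hθ : 0 < θ)
    (σ : ℝ) :
    4 * fouZeta H θ σ * ∫ u in Set.Ioi (0 : ℝ), (1 - Real.cos u) * u ^ (-1 - 2 * H) = σ ^ 2 := by
  have h_gamma := gamma_mul_integral_one_sub_cos_mul_rpow h0 h1
  rw [integral_fouSpectral_eq_scale hθ] at h_gamma
  have h_pos := integral_fouSpectral_pos h0 h1 hθ
  have : θ ^ (2 * H) ≠ 0 := by positivity
  rw [fouZeta]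
  field_simp
  linear_combination 4 * σ ^ 2 * h_gamma

lemma spectralCov_equation (h0 : 0 < H) (h1 : H < 1) (hθ : 0 < θ) (σ : ℝ) {t : ℝ} (ht : 0 ≤ t) :
    σ ^ 2 * t ^ (2 * H) = 2 * (spectralCov H θ σ 0 - spectralCov H θ σ t) +
      2 * θ ^ 2 * ∫ s in (0 : ℝ)..t, ∫ u in (0 : ℝ)..s, spectralCov H θ σ u := by
  have h_sum := integral_one_sub_cos_mul_fouSpectral_add h0 h1 hθ t
  rw [integral_one_sub_cos_mul_rpow_eq_scale h0 ht] at h_sum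
  rw [spectralCov_zero_sub h0 h1 hθ, integral_integral_spectralCov h0 h1 hθ σ ht]
  linear_combination (-t ^ (2 * H)) * four_mul_fouZeta_mul_integral_one_sub_cos_mul_rpow h0 h1 hθ σ
    - 4 * fouZeta H θ σ * h_sum

end SpectralCov

section Uniqueness

variable {D : ℝ → ℝ} {θ : ℝ}

lemma exp_mul_conserved_of_integral_eq (hD : Continuous D)
    (h_eq : ∀ t, 0 ≤ t → D t = D 0 + θ ^ 2 * ∫ s in (0 : ℝ)..t, ∫ u in (0 : ℝ)..s, D u) {c : ℝ}
    (hc : c ^ 2 = θ ^ 2) {t : ℝ} (ht : 0 ≤ t) :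
    Real.exp (-(c * t)) * (θ ^ 2 * (∫ u in (0 : ℝ)..t, D u) + c * D t) = c * D 0 := by
  set J : ℝ → ℝ := fun s => ∫ u in (0 : ℝ)..s, D u with hJ
  set E : ℝ → ℝ := fun t => D 0 + θ ^ 2 * ∫ s in (0 : ℝ)..t, J s with hE
  have h_deriv_J (s : ℝ) : HasDerivAt J (D s) s := (hD.integral_hasStrictDerivAt 0 s).hasDerivAt
  have hJ_cont : Continuous J := continuous_iff_continuousAt.2 fun s => (h_deriv_J s).continuousAt
  have h_deriv_E (s : ℝ) : HasDerivAt E (θ ^ 2 * J s) s :=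
    ((hJ_cont.integral_hasStrictDerivAt 0 s).hasDerivAt.const_mul _).const_add _
  have h_deriv (x : ℝ) := (hasDerivAt_exp_neg_mul c x).mul
    (((h_deriv_J x).const_mul (θ ^ 2)).add ((h_deriv_E x).const_mul c))
  have h_const := constant_of_has_deriv_right_zero (a := 0) (b := t)
    (continuous_iff_continuousAt.2 fun x => (h_deriv x).continuousAt).continuousOn
    (fun x hx => ((h_deriv x).congr_deriv ?_).hasDerivWithinAt) t ⟨ht, le_rfl⟩
  · simpa only [Pi.mul_apply, Pi.add_apply, show D t = E t from h_eq t ht, hJ, hE,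
      intervalIntegral.integral_same, mul_zero, neg_zero, Real.exp_zero, one_mul, zero_add,
      add_zero] using h_const
  · simp only [Pi.add_apply]
    rw [show D x = E x from h_eq x hx.1]
    linear_combination (-Real.exp (-(c * x)) * E x) * hc

lemma eq_mul_cosh_of_integral_eq (hD : Continuous D) (hθ : 0 < θ)
    (h_eq : ∀ t, 0 ≤ t → D t = D 0 + θ ^ 2 * ∫ s in (0 : ℝ)..t, ∫ u in (0 : ℝ)..s, D u) {t : ℝ}
    (ht : 0 ≤ t) : D t = D 0 * Real.cosh (θ * t) := by
  have h_plus := exp_mul_conserved_of_integral_eq hD h_eq rfl ht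
  have h_minus := exp_mul_conserved_of_integral_eq hD h_eq (c := -θ) (by ring) ht
  rw [neg_mul, neg_neg] at h_minus
  have h_exp : Real.exp (θ * t) * Real.exp (-(θ * t)) = 1 := by rw [← Real.exp_add]; simp
  refine mul_left_cancel₀ hθ.ne' ?_
  rw [Real.cosh_eq]
  linear_combination (Real.exp (θ * t) * h_plus - Real.exp (-(θ * t)) * h_minus) / 2
    - θ * D t * h_exp

lemma eq_zero_of_bounded_of_integral_eq (hD : Continuous D) (hθ : 0 < θ) {M : ℝ}
    (hM : ∀ t, 0 ≤ t → |D t| ≤ M)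
    (h_eq : ∀ t, 0 ≤ t → D t = D 0 + θ ^ 2 * ∫ s in (0 : ℝ)..t, ∫ u in (0 : ℝ)..s, D u) {t : ℝ}
    (ht : 0 ≤ t) : D t = 0 := by
  suffices h_zero : D 0 = 0 by
    rw [eq_mul_cosh_of_integral_eq hD hθ h_eq ht, h_zero, zero_mul]
  by_contra h_ne
  have h_lim : Tendsto (fun t => |D 0| * (Real.exp (θ * t) / 2)) atTop atTop :=
    ((Real.tendsto_exp_atTop.comp (tendsto_id.const_mul_atTop hθ)).atTop_div_const
      two_pos).const_mul_atTop (abs_pos.2 h_ne)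
  obtain ⟨s, hMs, hs⟩ := ((h_lim.eventually_gt_atTop M).and (eventually_ge_atTop 0)).exists
  refine hMs.not_ge (le_trans ?_ (hM s hs))
  rw [eq_mul_cosh_of_integral_eq hD hθ h_eq hs, abs_mul, abs_of_pos (Real.cosh_pos _), Real.cosh_eq]
  gcongr
  exact le_add_of_nonneg_right (Real.exp_pos _).le

lemma integral_integral_sub {f g : ℝ → ℝ} (hf : Continuous f) (hg : Continuous g) (t : ℝ) :
    ∫ s in (0 : ℝ)..t, ∫ u in (0 : ℝ)..s, (f u - g u) =
      (∫ s in (0 : ℝ)..t, ∫ u in (0 : ℝ)..s, f u) - ∫ s in (0 : ℝ)..t, ∫ u in (0 : ℝ)..s, g u := by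
  have h_prim {h : ℝ → ℝ} (hh : Continuous h) :
      IntervalIntegrable (fun s => ∫ u in (0 : ℝ)..s, h u) volume 0 t :=
    (intervalIntegral.continuous_primitive (fun a b => hh.intervalIntegrable a b)
      0).intervalIntegrable 0 t
  rw [← intervalIntegral.integral_sub (h_prim hf) (h_prim hg)]
  exact intervalIntegral.integral_congr fun s _ =>
    intervalIntegral.integral_sub (hf.intervalIntegrable _ _) (hg.intervalIntegrable _ _)

lemma eq_spectralCov_of_autocovariance_equation {H : ℝ} (h0 : 0 < H) (h1 : H < 1) (hθ : 0 < θ)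
    {σ : ℝ} {R : ℝ → ℝ} (hR : Continuous R) {M : ℝ} (hM : ∀ t, 0 ≤ t → |R t| ≤ M)
    (h_eq : ∀ t, 0 ≤ t → σ ^ 2 * t ^ (2 * H) = 2 * (R 0 - R t) +
      2 * θ ^ 2 * ∫ s in (0 : ℝ)..t, ∫ u in (0 : ℝ)..s, R u) {t : ℝ} (ht : 0 ≤ t) :
    R t = spectralCov H θ σ t := by
  have h_cont := continuous_spectralCov h0 h1 hθ σ
  refine sub_eq_zero.1 (eq_zero_of_bounded_of_integral_eq (D := fun t => R t - spectralCov H θ σ t)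
    (hR.sub h_cont) hθ (fun s hs => (abs_sub _ _).trans
      (add_le_add (hM s hs) (abs_spectralCov_le h0 h1 hθ σ s))) (fun s hs => ?_) ht)
  rw [integral_integral_sub hR h_cont]
  linear_combination (h_eq s hs - spectralCov_equation h0 h1 hθ σ hs) / 2

end Uniqueness

section PowerVariance

lemma isRoughVariance_of_concaveOn {v φ : ℝ → ℝ} {T C : ℝ}
    (hmono : ∀ ε : ℝ, |ε| = 1 → MonotoneOn (fun t => C * φ t + ε * v t) (Set.Icc 0 T))
    (hconc : ∀ ε : ℝ, |ε| = 1 → ConcaveOn ℝ (Set.Icc 0 T) (fun t => C * φ t + ε * v t)) :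
    IsRoughVariance v φ T C where
  abs_sub_le a b ha hab hb := by
    have bound (ε : ℝ) (hε : |ε| = 1) :=
      hmono ε hε ⟨ha, hab.trans hb⟩ ⟨ha.trans hab, hb⟩ hab
    have upper := bound (-1) (by simp)
    have lower := bound 1 (by simp)
    rw [abs_le]
    constructor <;> linarith
  abs_rectIncr_le a b c d hab hbc hcd hT := by
    have bound (ε : ℝ) (hε : |ε| = 1) :=
      concaveOn_add_le_add (hconc ε hε) (x := c - b) (sub_nonneg.2 hab) (sub_nonneg.2 hcd)
        ⟨by linarith, by linarith⟩ ⟨by linarith, by linarith⟩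
    simp only [show c - b + (b - a) = c - a by ring, show c - b + (d - c) = d - b by ring,
      show c - a + (d - c) = d - a by ring] at bound
    have upper := bound (-1) (by simp)
    have lower := bound 1 (by simp)
    rw [rectIncr, rectIncr, abs_le]
    constructor <;> linarith

namespace IsRoughVariance
variable {v w φ : ℝ → ℝ} {T C C' : ℝ}

lemma add (hv : IsRoughVariance v φ T C) (hw : IsRoughVariance w φ T C') :
    IsRoughVariance (fun t => v t + w t) φ T (C + C') where
  abs_sub_le a b ha hab hb := by
    rw [add_sub_add_comm, add_mul]
    exact (abs_add_le _ _).trans (add_le_add (hv.abs_sub_le ha hab hb) (hw.abs_sub_le ha hab hb))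
  abs_rectIncr_le a b c d hab hbc hcd hT := by
    have split :
        rectIncr (fun t => v t + w t) a b c d = rectIncr v a b c d + rectIncr w a b c d := by
      simp only [rectIncr]
      ring
    rw [split, add_mul]
    exact (abs_add_le _ _).trans
      (add_le_add (hv.abs_rectIncr_le hab hbc hcd hT) (hw.abs_rectIncr_le hab hbc hcd hT))

lemma const_mul (hv : IsRoughVariance v φ T C) (r : ℝ) :
    IsRoughVariance (fun t => r * v t) φ T (|r| * C) where
  abs_sub_le a b ha hab hb := by
    rw [← mul_sub, abs_mul, mul_assoc]
    exact mul_le_mul_of_nonneg_left (hv.abs_sub_le ha hab hb) (abs_nonneg r)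
  abs_rectIncr_le a b c d hab hbc hcd hT := by
    have factor : rectIncr (fun t => r * v t) a b c d = r * rectIncr v a b c d := by
      simp only [rectIncr]
      ring
    rw [factor, abs_mul, mul_assoc]
    exact mul_le_mul_of_nonneg_left (hv.abs_rectIncr_le hab hbc hcd hT) (abs_nonneg r)

lemma congr (hv : IsRoughVariance v φ T C) (h : ∀ t, 0 ≤ t → w t = v t) :
    IsRoughVariance w φ T C where
  abs_sub_le a b ha hab hb := by
    rw [h a ha, h b (ha.trans hab)]
    exact hv.abs_sub_le ha hab hb
  abs_rectIncr_le a b c d hab hbc hcd hT := by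
    have eq : rectIncr w a b c d = rectIncr v a b c d := by
      simp only [rectIncr]
      iterate 4 rw [h _ (by linarith)]
    exact eq ▸ hv.abs_rectIncr_le hab hbc hcd hT

end IsRoughVariance

variable {α β T : ℝ}

lemma hasDerivAt_mul_rpow_sub_one (α : ℝ) {t : ℝ} (ht : 0 < t) :
    HasDerivAt (fun t : ℝ => α * t ^ (α - 1)) (-(α * (1 - α)) * t ^ (α - 2)) t := by
  refine ((Real.hasDerivAt_rpow_const (p := α - 1) (Or.inl ht.ne')).const_mul α).congr_deriv ?_
  rw [sub_sub, one_add_one_eq_two]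
  ring

lemma exists_isRoughVariance_of_deriv_bounds {V V' V'' : ℝ → ℝ} {C₁ C₂ : ℝ} (h0 : 0 < α)
    (h1 : α < 1) (hV : Continuous V) (hd : ∀ t ∈ Set.Ioo 0 T, HasDerivAt V (V' t) t)
    (hd' : ∀ t ∈ Set.Ioo 0 T, HasDerivAt V' (V'' t) t) (hC₁ : 0 ≤ C₁) (hC₂ : 0 ≤ C₂)
    (hb : ∀ t ∈ Set.Ioo 0 T, |V' t| ≤ C₁ * t ^ (α - 1))
    (hb' : ∀ t ∈ Set.Ioo 0 T, |V'' t| ≤ C₂ * t ^ (α - 2)) :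
    ∃ C, 0 ≤ C ∧ IsRoughVariance V (· ^ α) T C := by
  have hα : 0 < α * (1 - α) := mul_pos h0 (sub_pos.2 h1)
  set C := C₁ / α + C₂ / (α * (1 - α))
  have hCα : C₁ ≤ C * α := by
    rw [add_mul, div_mul_cancel₀ _ h0.ne']
    exact le_add_of_nonneg_right (by positivity)
  have hCα' : C₂ ≤ C * (α * (1 - α)) := by
    rw [add_mul, div_mul_cancel₀ _ hα.ne']
    exact le_add_of_nonneg_left (by positivity)
  have continuous_pow : Continuous fun t : ℝ => t ^ α := Real.continuous_rpow_const h0.le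
  have deriv_pow (t) (ht : t ∈ Set.Ioo 0 T) :
      HasDerivAt (fun t : ℝ => t ^ α) (α * t ^ (α - 1)) t :=
    Real.hasDerivAt_rpow_const (Or.inl ht.1.ne')
  refine ⟨C, by positivity, isRoughVariance_of_concaveOn (fun ε hε => ?_) fun ε hε => ?_⟩
  · refine monotoneOn_of_hasDerivWithinAt_nonneg (convex_Icc 0 T) (by fun_prop)
      (f' := fun t => C * (α * t ^ (α - 1)) + ε * V' t) ?_ ?_ <;>
        simp only [interior_Icc] <;> intro t ht
    · exact (((deriv_pow t ht).const_mul C).add ((hd t ht).const_mul ε)).hasDerivWithinAt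
    · have bound : |ε * V' t| ≤ C * α * t ^ (α - 1) := by
        rw [abs_mul, hε, one_mul]
        exact (hb t ht).trans (mul_le_mul_of_nonneg_right hCα (Real.rpow_nonneg ht.1.le _))
      linarith [(abs_le.1 bound).1]
  · refine concaveOn_of_hasDerivWithinAt2_nonpos (convex_Icc 0 T) (by fun_prop)
      (f' := fun t => C * (α * t ^ (α - 1)) + ε * V' t)
      (f'' := fun t => C * (-(α * (1 - α)) * t ^ (α - 2)) + ε * V'' t) ?_ ?_ ?_ <;>
        simp only [interior_Icc] <;> intro t ht
    · exact (((deriv_pow t ht).const_mul C).add ((hd t ht).const_mul ε)).hasDerivWithinAt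
    · exact (((hasDerivAt_mul_rpow_sub_one α ht.1).const_mul C).add
        ((hd' t ht).const_mul ε)).hasDerivWithinAt
    · have bound : |ε * V'' t| ≤ C * (α * (1 - α)) * t ^ (α - 2) := by
        rw [abs_mul, hε, one_mul]
        exact (hb' t ht).trans (mul_le_mul_of_nonneg_right hCα' (Real.rpow_nonneg ht.1.le _))
      linarith [(abs_le.1 bound).2]

lemma rpow_le_rpow_sub_mul_rpow {t : ℝ} (ht : 0 < t) (htT : t ≤ T) (hαβ : α ≤ β) :
    t ^ β ≤ T ^ (β - α) * t ^ α := by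
  rw [← sub_add_cancel β α, Real.rpow_add ht, add_sub_cancel_right]
  exact mul_le_mul_of_nonneg_right (Real.rpow_le_rpow ht.le htT (sub_nonneg.2 hαβ))
    (Real.rpow_nonneg ht.le _)

lemma exists_isRoughVariance_rpow (h0 : 0 < α) (h1 : α < 1) (hαβ : α ≤ β) (hT : 0 ≤ T) :
    ∃ C, 0 ≤ C ∧ IsRoughVariance (· ^ β) (· ^ α) T C := by
  have hβ := h0.trans_le hαβ
  refine exists_isRoughVariance_of_deriv_bounds (V' := fun t => β * t ^ (β - 1))
    (V'' := fun t => β * ((β - 1) * t ^ (β - 1 - 1))) (C₁ := |β| * T ^ (β - α))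
    (C₂ := |β * (β - 1)| * T ^ (β - α)) h0 h1 (Real.continuous_rpow_const hβ.le)
    (fun t ht => Real.hasDerivAt_rpow_const (Or.inl ht.1.ne'))
    (fun t ht => (Real.hasDerivAt_rpow_const (Or.inl ht.1.ne')).const_mul β)
    (by positivity) (by positivity) (fun t ht => ?_) fun t ht => ?_
  · have pow_le := rpow_le_rpow_sub_mul_rpow ht.1 ht.2.le (sub_le_sub_right hαβ 1)
    rw [sub_sub_sub_cancel_right] at pow_le
    rw [abs_mul, abs_of_nonneg (Real.rpow_nonneg ht.1.le _), mul_assoc]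
    exact mul_le_mul_of_nonneg_left pow_le (abs_nonneg _)
  · have pow_le := rpow_le_rpow_sub_mul_rpow ht.1 ht.2.le (sub_le_sub_right hαβ 2)
    rw [sub_sub_sub_cancel_right] at pow_le
    rw [← mul_assoc, abs_mul, sub_sub, one_add_one_eq_two,
      abs_of_nonneg (Real.rpow_nonneg ht.1.le _), mul_assoc]
    exact mul_le_mul_of_nonneg_left pow_le (abs_nonneg _)

lemma exists_isRoughVariance_integral_integral {R : ℝ → ℝ} {M : ℝ} (h0 : 0 < α) (h1 : α < 1)
    (hT : 0 ≤ T) (hR : Continuous R) (hM : ∀ t, 0 ≤ t → |R t| ≤ M) :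
    ∃ C, 0 ≤ C ∧
      IsRoughVariance (fun t => ∫ s in (0 : ℝ)..t, ∫ u in (0 : ℝ)..s, R u) (· ^ α) T C := by
  have hM0 : 0 ≤ M := (abs_nonneg _).trans (hM 0 le_rfl)
  have hJ : Continuous fun s => ∫ u in (0 : ℝ)..s, R u :=
    intervalIntegral.continuous_primitive (fun _ _ => hR.intervalIntegrable _ _) 0
  refine exists_isRoughVariance_of_deriv_bounds (V' := fun t => ∫ u in (0 : ℝ)..t, R u) (V'' := R)
    (C₁ := M * T * T ^ (1 - α)) (C₂ := M * T ^ (2 - α)) h0 h1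
    (intervalIntegral.continuous_primitive (fun _ _ => hJ.intervalIntegrable _ _) 0)
    (fun t _ => hJ.integral_hasStrictDerivAt 0 t |>.hasDerivAt)
    (fun t _ => hR.integral_hasStrictDerivAt 0 t |>.hasDerivAt)
    (by positivity) (by positivity) (fun t ht => ?_) fun t ht => ?_
  · have integral_le : |∫ u in (0 : ℝ)..t, R u| ≤ M * |t - 0| :=
      intervalIntegral.norm_integral_le_of_norm_le_const (f := R) fun u hu =>
        hM u (Set.uIoc_of_le ht.1.le ▸ hu : u ∈ Set.Ioc 0 t).1.le
    have one_le := rpow_le_rpow_sub_mul_rpow ht.1 ht.2.le (sub_nonpos.2 h1.le)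
    rw [zero_sub, neg_sub, Real.rpow_zero] at one_le
    rw [sub_zero, abs_of_pos ht.1] at integral_le
    rw [mul_assoc]
    exact integral_le.trans ((mul_le_mul_of_nonneg_left ht.2.le hM0).trans
      (le_mul_of_one_le_right (mul_nonneg hM0 hT) one_le))
  · have one_le := rpow_le_rpow_sub_mul_rpow ht.1 ht.2.le (show α - 2 ≤ 0 by linarith)
    rw [zero_sub, neg_sub, Real.rpow_zero] at one_le
    rw [mul_assoc]
    exact (hM t ht.1.le).trans (le_mul_of_one_le_right hM0 one_le)

lemma exists_isRoughVariance_of_autocovariance_equation {H θ σ M : ℝ} {R : ℝ → ℝ} (h0 : 0 < α)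
    (h1 : α < 1) (hα : α ≤ 2 * H) (hT : 0 ≤ T) (hR : Continuous R)
    (hM : ∀ t, 0 ≤ t → |R t| ≤ M)
    (heq : ∀ t, 0 ≤ t → σ ^ 2 * t ^ (2 * H) = 2 * (R 0 - R t) +
      2 * θ ^ 2 * ∫ s in (0 : ℝ)..t, ∫ u in (0 : ℝ)..s, R u) :
    ∃ C, 0 ≤ C ∧ IsRoughVariance (fun t => R 0 - R t) (· ^ α) T C := by
  obtain ⟨C, hC, noise⟩ := exists_isRoughVariance_rpow h0 h1 hα hT
  obtain ⟨C', hC', drift⟩ := exists_isRoughVariance_integral_integral h0 h1 hT hR hM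
  refine ⟨_, by positivity, ((noise.const_mul (σ ^ 2 / 2)).add
    (drift.const_mul (-θ ^ 2))).congr fun t ht => ?_⟩
  linarith [heq t ht]

end PowerVariance

/-! ### Moments of stationary solutions -/

section Moments
variable {Ω : Type*} [MeasurableSpace Ω] {P : Measure Ω} {p : ℝ≥0∞}

lemma enorm_integral_rpow_le {S E : Type*} [MeasurableSpace S] [NormedAddCommGroup E]
    [NormedSpace ℝ E] {ν : Measure S} {g : S → E} (hg : AEStronglyMeasurable g ν) {q : ℝ}
    (hq : 1 ≤ q) :
    ‖∫ s, g s ∂ν‖ₑ ^ q ≤ (∫⁻ s, ‖g s‖ₑ ^ q ∂ν) * ν Set.univ ^ (q - 1) := by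
  have hq0 : 0 < q := one_pos.trans_le hq
  have h_le := eLpNorm'_le_eLpNorm'_mul_rpow_measure_univ one_pos hq hg
  rw [eLpNorm'_eq_lintegral_enorm, eLpNorm'_eq_lintegral_enorm] at h_le
  simp only [ENNReal.rpow_one, div_one] at h_le
  calc ‖∫ s, g s ∂ν‖ₑ ^ q
      ≤ ((∫⁻ s, ‖g s‖ₑ ^ q ∂ν) ^ (1 / q) * ν Set.univ ^ (1 - 1 / q)) ^ q := by
        gcongr
        exact (enorm_integral_le_lintegral_enorm _).trans h_le
    _ = (∫⁻ s, ‖g s‖ₑ ^ q ∂ν) * ν Set.univ ^ (q - 1) := by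
        rw [ENNReal.mul_rpow_of_nonneg _ _ hq0.le, ← ENNReal.rpow_mul, ← ENNReal.rpow_mul,
          one_div_mul_cancel hq0.ne', ENNReal.rpow_one, sub_mul, one_div_mul_cancel hq0.ne',
          one_mul]

lemma memLp_uncurry_of_eLpNorm_le [SFinite P] {S E : Type*} [MeasurableSpace S]
    [NormedAddCommGroup E] {ν : Measure S} [IsFiniteMeasure ν] {f : S → Ω → E}
    (hf : AEStronglyMeasurable (Function.uncurry f) (ν.prod P)) (h0 : p ≠ 0) (hp : p ≠ ∞)
    {C : ℝ≥0∞} (hC : C ≠ ∞) (hfC : ∀ᵐ s ∂ν, eLpNorm (f s) p P ≤ C) :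
    MemLp (Function.uncurry f) p (ν.prod P) := by
  have hp_pos : 0 < p.toReal := ENNReal.toReal_pos h0 hp
  refine ⟨hf, (eLpNorm_lt_top_iff_lintegral_rpow_enorm_lt_top h0 hp).2 ?_⟩
  calc ∫⁻ z, ‖Function.uncurry f z‖ₑ ^ p.toReal ∂ν.prod P
      = ∫⁻ s, ∫⁻ ω, ‖f s ω‖ₑ ^ p.toReal ∂P ∂ν := lintegral_prod _ (hf.enorm.pow_const _)
    _ ≤ ∫⁻ _, C ^ p.toReal ∂ν := by
        refine lintegral_mono_ae ?_
        filter_upwards [hfC] with s hs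
        rw [eLpNorm_eq_lintegral_rpow_enorm_toReal h0 hp, one_div] at hs
        exact (ENNReal.rpow_inv_le_iff hp_pos).1 hs
    _ < ∞ := by
        rw [lintegral_const]
        exact ENNReal.mul_lt_top (ENNReal.rpow_lt_top_of_nonneg hp_pos.le hC) (measure_lt_top ν _)

lemma memLp_integral_of_memLp_uncurry [SFinite P] {S E : Type*} [MeasurableSpace S]
    [NormedAddCommGroup E] [NormedSpace ℝ E] {ν : Measure S} [IsFiniteMeasure ν] {f : S → Ω → E}
    (h1 : 1 ≤ p) (hp : p ≠ ∞) (hf : MemLp (Function.uncurry f) p (ν.prod P)) :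
    MemLp (fun ω => ∫ s, f s ω ∂ν) p P := by
  have hp0 : p ≠ 0 := (one_pos.trans_le h1).ne'
  have hq : 1 ≤ p.toReal := by simpa using (ENNReal.toReal_le_toReal ENNReal.one_ne_top hp).2 h1
  have h_univ : ν Set.univ ^ (p.toReal - 1) ≠ ∞ :=
    ENNReal.rpow_ne_top_of_nonneg (sub_nonneg.2 hq) (measure_ne_top ν _)
  have hf_swap : AEStronglyMeasurable (fun z : Ω × S => f z.2 z.1) (P.prod ν) :=
    hf.aestronglyMeasurable.prod_swap
  refine ⟨hf_swap.integral_prod_right',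
    (eLpNorm_lt_top_iff_lintegral_rpow_enorm_lt_top hp0 hp).2 ?_⟩
  calc ∫⁻ ω, ‖∫ s, f s ω ∂ν‖ₑ ^ p.toReal ∂P
      ≤ ∫⁻ ω, (∫⁻ s, ‖f s ω‖ₑ ^ p.toReal ∂ν) * ν Set.univ ^ (p.toReal - 1) ∂P := by
        refine lintegral_mono_ae ?_
        filter_upwards [hf_swap.prodMk_left] with ω hω
        exact enorm_integral_rpow_le hω hq
    _ = (∫⁻ z, ‖Function.uncurry f z‖ₑ ^ p.toReal ∂ν.prod P) * ν Set.univ ^ (p.toReal - 1) := by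
        rw [lintegral_mul_const' _ _ h_univ,
          lintegral_prod_symm _ (hf.aestronglyMeasurable.enorm.pow_const _)]
        rfl
    _ < ∞ := ENNReal.mul_lt_top
        ((eLpNorm_lt_top_iff_lintegral_rpow_enorm_lt_top hp0 hp).1 hf.2) h_univ.lt_top

lemma eLpNorm_eq_of_hasGaussianLaw {Z : Ω → ℝ} (hZ : HasGaussianLaw Z P)
    (h0 : ∫ ω, Z ω ∂P = 0) :
    eLpNorm Z p P = ENNReal.ofReal √Var[Z; P] * eLpNorm id p (gaussianReal 0 1) := by
  have h_law : P.map Z = (gaussianReal 0 1).map (√Var[Z; P] * ·) := by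
    rw [hZ.map_eq_gaussianReal, h0, gaussianReal_map_const_mul, mul_zero, mul_one]
    congr 1
    ext
    simp [variance_nonneg]
  calc eLpNorm Z p P = eLpNorm id p (P.map Z) :=
        (eLpNorm_map_measure aestronglyMeasurable_id hZ.aemeasurable).symm
    _ = eLpNorm (√Var[Z; P] • id) p (gaussianReal 0 1) := by
        rw [h_law, eLpNorm_map_measure aestronglyMeasurable_id (by fun_prop)]
        rfl
    _ = _ := by
        rw [eLpNorm_const_smul, Real.enorm_eq_ofReal (Real.sqrt_nonneg _)]

section Contraction
variable {Y N : Ω → ℝ} {c : ℝ}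

lemma min_const_mul_abs_add_le {a K : ℝ} (ha : 0 ≤ a) (hc : 0 ≤ c) (y n : ℝ) :
    min (a * |c * y + n|) K ≤ min (a * c * |y|) K + a * |n| := by
  have h_add : a * |c * y + n| ≤ a * c * |y| + a * |n| := by
    rw [mul_assoc, ← abs_of_nonneg hc, ← abs_mul, ← mul_add, abs_of_nonneg hc]
    exact mul_le_mul_of_nonneg_left (abs_add_le _ _) ha
  have h_nonneg : 0 ≤ a * |n| := by positivity
  rw [← min_add_add_right]
  exact min_le_min h_add (le_add_of_nonneg_right h_nonneg)

lemma eLpNorm_min_pow_mul_abs_le (hc : 0 ≤ c) (h1 : 1 ≤ p)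
    (hY : IdentDistrib (fun ω => c * Y ω + N ω) Y P P) (hN : AEStronglyMeasurable N P) {K : ℝ}
    (hK : 0 ≤ K) (m : ℕ) :
    eLpNorm (fun ω => min (c ^ m * |Y ω|) K) p P ≤
      eLpNorm (fun ω => min (c ^ (m + 1) * |Y ω|) K) p P +
        ENNReal.ofReal (c ^ m) * eLpNorm N p P := by
  have hY_meas : AEMeasurable Y P := hY.aemeasurable_snd
  have h_comp := hY.comp (u := fun y => min (c ^ m * |y|) K) (by fun_prop)
  rw [← show eLpNorm (fun ω => c ^ m * |N ω|) p P = ENNReal.ofReal (c ^ m) * eLpNorm N p P from ?_]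
  · calc eLpNorm (fun ω => min (c ^ m * |Y ω|) K) p P
        = eLpNorm (fun ω => min (c ^ m * |c * Y ω + N ω|) K) p P := (h_comp.eLpNorm_eq p).symm
      _ ≤ eLpNorm (fun ω => min (c ^ (m + 1) * |Y ω|) K + c ^ m * |N ω|) p P := by
          refine eLpNorm_mono_real fun ω => ?_
          rw [Real.norm_of_nonneg (le_min (by positivity) hK), pow_succ]
          exact min_const_mul_abs_add_le (by positivity) hc _ _
      _ ≤ _ := eLpNorm_add_le
          (by fun_prop : AEMeasurable _ P).aestronglyMeasurable
          (hN.norm.const_mul _) h1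
  · rw [← eLpNorm_norm N]
    exact (eLpNorm_const_smul (c ^ m) (fun ω => ‖N ω‖) p P).trans
      (by rw [Real.enorm_eq_ofReal (by positivity)])

lemma tendsto_eLpNorm_min_pow_mul_abs [IsFiniteMeasure P] (hc : 0 ≤ c) (hc1 : c < 1) (h1 : 1 ≤ p)
    (hp : p ≠ ∞) (hY : AEMeasurable Y P) {K : ℝ} (hK : 0 ≤ K) :
    Tendsto (fun m : ℕ => eLpNorm (fun ω => min (c ^ m * |Y ω|) K) p P) atTop (𝓝 0) := by
  have h_meas (m : ℕ) : AEStronglyMeasurable (fun ω => min (c ^ m * |Y ω|) K) P :=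
    (by fun_prop : AEMeasurable _ P).aestronglyMeasurable
  have h_unif : UnifIntegrable (fun (m : ℕ) ω => min (c ^ m * |Y ω|) K) p P := by
    intro ε hε
    obtain ⟨δ, hδ, h_const⟩ := (memLp_const K).eLpNorm_indicator_le (μ := P) h1 hp hε
    refine ⟨δ, hδ, fun m s hs hsδ => (eLpNorm_mono fun ω => ?_).trans (h_const s hs hsδ)⟩
    by_cases hω : ω ∈ s
    · simp only [Set.indicator_of_mem hω]
      rw [Real.norm_of_nonneg (le_min (by positivity) hK), Real.norm_of_nonneg hK]
      exact min_le_right _ _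
    · simp only [Set.indicator_of_notMem hω, le_refl]
  have h_lim (ω : Ω) : Tendsto (fun m : ℕ => min (c ^ m * |Y ω|) K) atTop (𝓝 0) := by
    have := ((tendsto_pow_atTop_nhds_zero_of_lt_one hc hc1).mul_const |Y ω|).min
      (tendsto_const_nhds (x := K))
    rwa [zero_mul, min_eq_left hK] at this
  simpa only [sub_zero, Pi.sub_def] using tendsto_Lp_finite_of_tendsto_ae (g := fun _ => (0 : ℝ))
    h1 hp h_meas (memLp_const 0) h_unif (ae_of_all P h_lim)

lemma eLpNorm_min_abs_le_of_identDistrib [IsFiniteMeasure P] (hc : 0 ≤ c) (hc1 : c < 1)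
    (h1 : 1 ≤ p) (hp : p ≠ ∞) (hY : IdentDistrib (fun ω => c * Y ω + N ω) Y P P)
    (hN : AEStronglyMeasurable N P) {K : ℝ} (hK : 0 ≤ K) :
    eLpNorm (fun ω => min |Y ω| K) p P ≤ ENNReal.ofReal (1 - c)⁻¹ * eLpNorm N p P := by
  have h_iterate (m : ℕ) : eLpNorm (fun ω => min |Y ω| K) p P ≤
      eLpNorm (fun ω => min (c ^ m * |Y ω|) K) p P +
        ENNReal.ofReal (∑ k ∈ Finset.range m, c ^ k) * eLpNorm N p P := by
    induction m with
    | zero => simp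
    | succ m ih =>
      refine ih.trans ((add_le_add_left (eLpNorm_min_pow_mul_abs_le hc h1 hY hN hK m) _).trans ?_)
      rw [Finset.sum_range_succ, add_comm (∑ k ∈ Finset.range m, c ^ k),
        ENNReal.ofReal_add (by positivity) (by positivity), add_mul, add_assoc]
  have h_geom (m : ℕ) : ∑ k ∈ Finset.range m, c ^ k ≤ (1 - c)⁻¹ :=
    (summable_geometric_of_lt_one hc hc1).sum_le_tsum _ (fun k _ => pow_nonneg hc k) |>.trans_eq
      (tsum_geometric_of_lt_one hc hc1)
  have h_lim := (tendsto_eLpNorm_min_pow_mul_abs hc hc1 h1 hp hY.aemeasurable_snd hK).add_const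
    (ENNReal.ofReal (1 - c)⁻¹ * eLpNorm N p P)
  rw [zero_add] at h_lim
  refine ge_of_tendsto' h_lim fun m => (h_iterate m).trans ?_
  gcongr
  exact h_geom m

theorem memLp_of_identDistrib_const_mul_add [IsFiniteMeasure P] (hc : 0 ≤ c) (hc1 : c < 1)
    (h1 : 1 ≤ p) (hp : p ≠ ∞) (hY : IdentDistrib (fun ω => c * Y ω + N ω) Y P P)
    (hN : MemLp N p P) : MemLp Y p P := by
  have hY_meas : AEMeasurable Y P := hY.aemeasurable_snd
  have h_lim (ω : Ω) : Tendsto (fun K : ℕ => min |Y ω| (K : ℝ)) atTop (𝓝 |Y ω|) := by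
    refine tendsto_const_nhds.congr' ?_
    filter_upwards [eventually_ge_atTop ⌈|Y ω|⌉₊] with K hK
    exact (min_eq_left (Nat.ceil_le.1 hK)).symm
  have h_fatou := Lp.eLpNorm_lim_le_liminf_eLpNorm (p := p)
    (fun K : ℕ => (by fun_prop : AEMeasurable (fun ω => min |Y ω| (K : ℝ)) P).aestronglyMeasurable)
    (fun ω => |Y ω|) (ae_of_all P h_lim)
  have h_bound : atTop.liminf (fun K : ℕ => eLpNorm (fun ω => min |Y ω| (K : ℝ)) p P) ≤
      ENNReal.ofReal (1 - c)⁻¹ * eLpNorm N p P :=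
    liminf_le_of_frequently_le' (Frequently.of_forall fun K =>
      eLpNorm_min_abs_le_of_identDistrib hc hc1 h1 hp hY hN.1 K.cast_nonneg)
  refine ⟨hY_meas.aestronglyMeasurable, ?_⟩
  rw [← eLpNorm_norm]
  exact (h_fatou.trans h_bound).trans_lt (ENNReal.mul_lt_top ENNReal.ofReal_lt_top hN.2)

end Contraction

end Moments

section VariationOfConstants
variable {θ t : ℝ}

lemma hasDerivAt_exp_neg_mul_sub (θ t s : ℝ) :
    HasDerivAt (fun s => Real.exp (-(θ * (t - s)))) (θ * Real.exp (-(θ * (t - s)))) s :=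
  ((hasDerivAt_exp_neg_mul θ (t - s)).comp_const_sub t s).congr_deriv (by ring)

/-- Variation of constants for `dy = -θ y dt + σ db`, integrated by parts so that only values of `b`
occur. -/
lemma eq_of_linear_equation {σ : ℝ} {y b : ℝ → ℝ} (hy : Continuous y) (hb : Continuous b)
    (h_eq : ∀ s, 0 ≤ s → y s = y 0 - θ * (∫ u in (0 : ℝ)..s, y u) + σ * b s) (ht : 0 ≤ t) :
    y t = Real.exp (-(θ * t)) * y 0 +
      σ * (b t - ∫ s in (0 : ℝ)..t, θ * Real.exp (-(θ * (t - s))) * b s) := by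
  set Y : ℝ → ℝ := fun t => ∫ s in (0 : ℝ)..t, y s with hY
  have h_deriv_Y (s : ℝ) : HasDerivAt Y (y s) s :=
    intervalIntegral.integral_hasDerivAt_right (hy.intervalIntegrable _ _)
      (hy.stronglyMeasurableAtFilter _ _) hy.continuousAt
  have h_kernel : ∫ s in (0 : ℝ)..t, θ * Real.exp (-(θ * (t - s))) = 1 - Real.exp (-(θ * t)) := by
    rw [intervalIntegral.integral_eq_sub_of_hasDerivAt
      (fun s _ => hasDerivAt_exp_neg_mul_sub θ t s)
      (Continuous.intervalIntegrable (by fun_prop) _ _)]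
    simp only [sub_self, mul_zero, neg_zero, Real.exp_zero, sub_zero]
  have h_parts : ∫ s in (0 : ℝ)..t, (y 0 * (θ * Real.exp (-(θ * (t - s)))) +
      σ * (θ * Real.exp (-(θ * (t - s))) * b s)) = θ * Y t := by
    rw [intervalIntegral.integral_eq_sub_of_hasDerivAt
      (f := fun s => θ * (Real.exp (-(θ * (t - s))) * Y s))]
    · simp [hY]
    · intro s hs
      rw [Set.uIcc_of_le ht] at hs
      refine (((hasDerivAt_exp_neg_mul_sub θ t s).mul (h_deriv_Y s)).const_mul θ).congr_deriv ?_
      linear_combination θ * Real.exp (-(θ * (t - s))) * h_eq s hs.1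
    · exact Continuous.intervalIntegrable (by fun_prop) _ _
  rw [intervalIntegral.integral_add (Continuous.intervalIntegrable (by fun_prop) _ _)
    (Continuous.intervalIntegrable (by fun_prop) _ _), intervalIntegral.integral_const_mul (y 0),
    intervalIntegral.integral_const_mul σ, h_kernel] at h_parts
  linear_combination h_eq t ht + h_parts

end VariationOfConstants

section ContinuousFOU
variable {Ω : Type*} [MeasurableSpace Ω] {P : Measure Ω}

lemma exists_continuous_modification {T E : Type*} [TopologicalSpace T] [TopologicalSpace E]
    [MeasurableSpace E] [Zero E] {X : T → Ω → E} (h_meas : ∀ t, Measurable (X t))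
    (h_cont : ∀ᵐ ω ∂P, Continuous fun t => X t ω) :
    ∃ X' : T → Ω → E, (∀ t, Measurable (X' t)) ∧ (∀ ω, Continuous fun t => X' t ω) ∧
      ∀ᵐ ω ∂P, ∀ t, X' t ω = X t ω := by
  set N := toMeasurable P {ω | ¬ Continuous fun t => X t ω} with hN
  have hN0 : P N = 0 := by rw [hN, measure_toMeasurable]; exact ae_iff.1 h_cont
  refine ⟨fun t => Nᶜ.indicator (X t), fun t =>
    (h_meas t).indicator (measurableSet_toMeasurable _ _).compl, fun ω => ?_, ?_⟩
  · by_cases hω : ω ∈ N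
    · simpa only [Set.indicator_of_notMem (Set.notMem_compl_iff.2 hω)] using continuous_const
    · simp only [Set.indicator_of_mem (Set.mem_compl hω)]
      by_contra h_not
      exact hω (subset_toMeasurable _ _ h_not)
  · filter_upwards [measure_eq_zero_iff_ae_notMem.1 hN0] with ω hω t
    exact Set.indicator_of_mem (Set.mem_compl hω) _

/-- A one-dimensional stationary fractional Ornstein-Uhlenbeck process, indexed by `ℝ` and with all
paths continuous, of which only the one-dimensional laws of the noise and the two-dimensional laws
of the process are prescribed. Times `t < 0` carry no information. -/
structure IsContinuousFOU (P : Measure Ω) (H θ μ σ : ℝ) (b x : ℝ → Ω → ℝ) : Prop where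
  continuous_noise : ∀ ω, Continuous fun t => b t ω
  continuous : ∀ ω, Continuous fun t => x t ω
  measurable_noise : ∀ t, Measurable (b t)
  measurable : ∀ t, Measurable (x t)
  equation : ∀ᵐ ω ∂P, ∀ t, 0 ≤ t →
    x t ω = x 0 ω - θ * (∫ s in (0 : ℝ)..t, (x s ω - μ)) + σ * b t ω
  stationary : ∀ τ s t, 0 ≤ τ → 0 ≤ s → 0 ≤ t →
    IdentDistrib (fun ω => (x (τ + s) ω, x (τ + t) ω)) (fun ω => (x s ω, x t ω)) P P
  hasGaussianLaw_noise : ∀ t, HasGaussianLaw (b t) P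
  integral_noise : ∀ t, ∫ ω, b t ω ∂P = 0
  variance_noise : ∀ t, 0 ≤ t → Var[b t; P] = t ^ (2 * H)

namespace IsContinuousFOU
variable {H θ μ σ t : ℝ} {b x : ℝ → Ω → ℝ} {p : ℝ≥0∞}

lemma identDistrib (h : IsContinuousFOU P H θ μ σ b x) (ht : 0 ≤ t) :
    IdentDistrib (x t) (x 0) P P := by
  simpa only [Function.comp_def, add_zero] using
    (h.stationary t 0 0 ht le_rfl le_rfl).comp measurable_fst

lemma measurable_uncurry_noise (h : IsContinuousFOU P H θ μ σ b x) :
    Measurable (Function.uncurry b) :=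
  measurable_uncurry_of_continuous_of_measurable h.continuous_noise h.measurable_noise

lemma measurable_uncurry (h : IsContinuousFOU P H θ μ σ b x) : Measurable (Function.uncurry x) :=
  measurable_uncurry_of_continuous_of_measurable h.continuous h.measurable

lemma sub_eq (h : IsContinuousFOU P H θ μ σ b x) (ht : 0 ≤ t) :
    ∀ᵐ ω ∂P, x t ω - μ = Real.exp (-(θ * t)) * (x 0 ω - μ) +
      σ * (b t ω - ∫ s in (0 : ℝ)..t, θ * Real.exp (-(θ * (t - s))) * b s ω) := by
  filter_upwards [h.equation] with ω hω
  refine eq_of_linear_equation (y := fun s => x s ω - μ) ((h.continuous ω).sub continuous_const)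
    (h.continuous_noise ω) (fun s hs => ?_) ht
  rw [hω s hs]
  ring

lemma eLpNorm_noise_le (h : IsContinuousFOU P H θ μ σ b x) (hH : 0 ≤ H) {s : ℝ} (hs : 0 ≤ s)
    (hst : s ≤ t) :
    eLpNorm (b s) p P ≤ ENNReal.ofReal √(t ^ (2 * H)) * eLpNorm id p (gaussianReal 0 1) := by
  rw [eLpNorm_eq_of_hasGaussianLaw (h.hasGaussianLaw_noise s) (h.integral_noise s),
    h.variance_noise s hs]
  gcongr

variable [IsProbabilityMeasure P]

lemma memLp_integral_noise (h : IsContinuousFOU P H θ μ σ b x) (hH : 0 ≤ H) (hθ : 0 ≤ θ)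
    (h1 : 1 ≤ p) (hp : p ≠ ∞) (ht : 0 ≤ t) :
    MemLp (fun ω => ∫ s in (0 : ℝ)..t, θ * Real.exp (-(θ * (t - s))) * b s ω) p P := by
  simp only [intervalIntegral.integral_of_le ht]
  refine memLp_integral_of_memLp_uncurry h1 hp (memLp_uncurry_of_eLpNorm_le
    (f := fun s ω => θ * Real.exp (-(θ * (t - s))) * b s ω) ?_ (one_pos.trans_le h1).ne' hp
    (C := ENNReal.ofReal θ * (ENNReal.ofReal √(t ^ (2 * H)) * eLpNorm id p (gaussianReal 0 1)))
    ?_ ?_)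
  · exact ((by fun_prop : Measurable fun z : ℝ × Ω => θ * Real.exp (-(θ * (t - z.1)))).mul
      h.measurable_uncurry_noise).aestronglyMeasurable
  · exact ENNReal.mul_ne_top ENNReal.ofReal_ne_top
      (ENNReal.mul_ne_top ENNReal.ofReal_ne_top (memLp_id_gaussianReal' p hp).eLpNorm_ne_top)
  · filter_upwards [ae_restrict_mem measurableSet_Ioc] with s hs
    have h_kernel : θ * Real.exp (-(θ * (t - s))) ≤ θ :=
      mul_le_of_le_one_right hθ (Real.exp_le_one_iff.2
        (neg_nonpos.2 (mul_nonneg hθ (sub_nonneg.2 hs.2))))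
    refine (eLpNorm_const_smul (θ * Real.exp (-(θ * (t - s)))) (b s) p P).trans_le ?_
    rw [Real.enorm_eq_ofReal (by positivity)]
    exact mul_le_mul' (ENNReal.ofReal_le_ofReal h_kernel) (h.eLpNorm_noise_le hH hs.1.le hs.2)

/-- Over a unit of time the process is contracted by `exp (-θ)` and perturbed by a functional of the
noise, while its law does not change. -/
lemma memLp (h : IsContinuousFOU P H θ μ σ b x) (hH : 0 ≤ H) (hθ : 0 < θ) (h1 : 1 ≤ p)
    (hp : p ≠ ∞) (ht : 0 ≤ t) : MemLp (x t) p P := by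
  refine ((h.identDistrib ht).memLp_iff).2 ?_
  have h_law : IdentDistrib (fun ω => x 1 ω - μ) (fun ω => x 0 ω - μ) P P :=
    (h.identDistrib zero_le_one).comp (measurable_id.sub_const μ)
  have h_sub : MemLp (fun ω => x 0 ω - μ) p P :=
    memLp_of_identDistrib_const_mul_add (Real.exp_nonneg (-(θ * 1)))
      (by simpa using hθ) h1 hp
      ((IdentDistrib.of_ae_eq (h_law.aemeasurable_fst) (h.sub_eq zero_le_one)).symm.trans h_law)
      ((((h.hasGaussianLaw_noise 1).memLp hp).sub
        (h.memLp_integral_noise hH hθ.le h1 hp zero_le_one)).const_mul σ)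
  simpa only [Pi.add_def, sub_add_cancel] using h_sub.add (memLp_const μ)

end IsContinuousFOU

end ContinuousFOU

/-! ### The autocovariance equation -/

section WeakStationarity
variable {Ω : Type*} [MeasurableSpace Ω] {P : Measure Ω}

lemma covariance_integral_right [IsProbabilityMeasure P] {S : Type*} [MeasurableSpace S]
    {ν : Measure S} [IsFiniteMeasure ν] {f : S → Ω → ℝ} {Z : Ω → ℝ} (hZ : MemLp Z 2 P)
    (hf : MemLp (Function.uncurry f) 2 (ν.prod P)) :
    cov[Z, fun ω => ∫ s, f s ω ∂ν; P] = ∫ s, cov[Z, f s; P] ∂ν := by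
  have h_int : Integrable (Function.uncurry f) (ν.prod P) := hf.integrable one_le_two
  have h_mul : Integrable (Function.uncurry fun s ω => Z ω * f s ω) (ν.prod P) :=
    (hZ.comp_snd ν).integrable_mul hf
  have h_slice : ∀ᵐ s ∂ν, MemLp (f s) 2 P := by
    filter_upwards [hf.integrable_sq.prod_right_ae, hf.aestronglyMeasurable.prodMk_left]
      with s hs hs_meas
    exact (memLp_two_iff_integrable_sq hs_meas).2 hs
  calc cov[Z, fun ω => ∫ s, f s ω ∂ν; P]
      = (∫ ω, ∫ s, Z ω * f s ω ∂ν ∂P) - (∫ ω, Z ω ∂P) * ∫ ω, ∫ s, f s ω ∂ν ∂P := by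
        rw [covariance_eq_sub hZ (memLp_integral_of_memLp_uncurry one_le_two (by simp) hf)]
        simp only [Pi.mul_apply, integral_const_mul]
    _ = ∫ s, ((∫ ω, Z ω * f s ω ∂P) - (∫ ω, Z ω ∂P) * ∫ ω, f s ω ∂P) ∂ν := by
        rw [← integral_integral_swap h_mul, ← integral_integral_swap h_int, ← integral_const_mul]
        exact (integral_sub h_mul.integral_prod_left (h_int.integral_prod_left.const_mul _)).symm
    _ = ∫ s, cov[Z, f s; P] ∂ν := by
        refine integral_congr_ae ?_
        filter_upwards [h_slice] with s hs
        rw [covariance_eq_sub hZ hs]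
        rfl

/-- Second-order stationarity on `[0, ∞)`: the mean is constant and the autocovariance at lag `t` is
`R t`, where `R` is taken to be even so that the order of the two times does not matter. Nothing is
said about times `t < 0`. -/
structure IsWeaklyStationary (P : Measure Ω) (x : ℝ → Ω → ℝ) (R : ℝ → ℝ) : Prop where
  measurable_uncurry : Measurable (Function.uncurry x)
  memLp : ∀ t, 0 ≤ t → MemLp (x t) 2 P
  integral_eq : ∀ t, 0 ≤ t → ∫ ω, x t ω ∂P = ∫ ω, x 0 ω ∂P
  covariance_eq : ∀ s t, 0 ≤ s → 0 ≤ t → cov[x s, x t; P] = R (s - t)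

namespace IsWeaklyStationary
variable {x : ℝ → Ω → ℝ} {R : ℝ → ℝ} {s t : ℝ}

lemma autocov_neg (h : IsWeaklyStationary P x R) (t : ℝ) : R (-t) = R t := by
  wlog ht : 0 ≤ t generalizing t
  · simpa using (this (-t) (by linarith)).symm
  have h_comm := covariance_comm (x 0) (x t) (μ := P)
  rwa [h.covariance_eq 0 t le_rfl ht, h.covariance_eq t 0 ht le_rfl, zero_sub, sub_zero] at h_comm

lemma variance_eq (h : IsWeaklyStationary P x R) (ht : 0 ≤ t) : Var[x t; P] = R 0 := by
  rw [← covariance_self (h.memLp t ht).aemeasurable, h.covariance_eq t t ht ht, sub_self]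

lemma autocov_eq_integral (h : IsWeaklyStationary P x R) (t : ℝ) :
    R t = ∫ ω, (x 0 ω - ∫ ω, x 0 ω ∂P) * (x |t| ω - ∫ ω, x 0 ω ∂P) ∂P := by
  have h_abs : R t = R (0 - |t|) := by
    rw [zero_sub, h.autocov_neg]
    rcases abs_choice t with ht | ht
    · rw [ht]
    · rw [ht, h.autocov_neg]
  rw [h_abs, ← h.covariance_eq 0 |t| le_rfl (abs_nonneg t), covariance,
    h.integral_eq _ (abs_nonneg t)]

section FiniteMeasure
variable [IsFiniteMeasure P]

lemma variance_sub (h : IsWeaklyStationary P x R) (hs : 0 ≤ s) (ht : 0 ≤ t) :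
    Var[fun ω => x t ω - x s ω; P] = 2 * (R 0 - R (t - s)) := by
  rw [variance_fun_sub (h.memLp t ht) (h.memLp s hs), h.variance_eq ht, h.variance_eq hs,
    h.covariance_eq t s ht hs]
  ring

lemma integral_sub_sq (h : IsWeaklyStationary P x R) (hs : 0 ≤ s) (ht : 0 ≤ t) :
    ∫ ω, (x t ω - x s ω) ^ 2 ∂P = 2 * (R 0 - R (t - s)) := by
  have h_mean : ∫ ω, (x t ω - x s ω) ∂P = 0 := by
    rw [integral_sub ((h.memLp t ht).integrable one_le_two) ((h.memLp s hs).integrable one_le_two),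
      h.integral_eq t ht, h.integral_eq s hs, sub_self]
  rw [← h.variance_sub hs ht]
  exact (variance_of_integral_eq_zero ((h.memLp t ht).sub (h.memLp s hs)).aemeasurable h_mean).symm

lemma abs_autocov_le (h : IsWeaklyStationary P x R) (t : ℝ) : |R t| ≤ R 0 := by
  wlog ht : 0 ≤ t generalizing t
  · rw [← h.autocov_neg]
    exact this (-t) (by linarith)
  have h_sub := variance_nonneg (fun ω => x t ω - x 0 ω) P
  have h_add := variance_nonneg (fun ω => x t ω + x 0 ω) P
  rw [h.variance_sub le_rfl ht, sub_zero] at h_sub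
  rw [variance_fun_add (h.memLp t ht) (h.memLp 0 le_rfl), h.variance_eq ht, h.variance_eq le_rfl,
    h.covariance_eq t 0 ht le_rfl, sub_zero] at h_add
  exact abs_le.2 ⟨by linarith, by linarith⟩

lemma measurable_autocov (h : IsWeaklyStationary P x R) : Measurable R := by
  rw [funext h.autocov_eq_integral]
  have h_meas : Measurable fun z : ℝ × Ω =>
      (x 0 z.2 - ∫ ω, x 0 ω ∂P) * (x |z.1| z.2 - ∫ ω, x 0 ω ∂P) :=
    ((h.measurable_uncurry.comp (measurable_const.prodMk measurable_snd)).sub_const _).mul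
      ((h.measurable_uncurry.comp (measurable_fst.abs.prodMk measurable_snd)).sub_const _)
  exact h_meas.stronglyMeasurable.integral_prod_right'.measurable

lemma intervalIntegrable_autocov (h : IsWeaklyStationary P x R) (a c : ℝ) :
    IntervalIntegrable R volume a c :=
  (intervalIntegrable_const (c := R 0)).mono_fun' h.measurable_autocov.aestronglyMeasurable
    (Eventually.of_forall h.abs_autocov_le)

lemma continuous_integral_autocov (h : IsWeaklyStationary P x R) :
    Continuous fun s => ∫ u in (0 : ℝ)..s, R u :=
  intervalIntegral.continuous_primitive h.intervalIntegrable_autocov 0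

end FiniteMeasure

variable [IsProbabilityMeasure P]

lemma integral_sq (h : IsWeaklyStationary P x R) (ht : 0 ≤ t) :
    ∫ ω, x t ω ^ 2 ∂P = R 0 + (∫ ω, x 0 ω ∂P) ^ 2 := by
  rw [← h.variance_eq ht, variance_eq_sub (h.memLp t ht), h.integral_eq t ht]
  simp

lemma memLp_uncurry (h : IsWeaklyStationary P x R) (t : ℝ) :
    MemLp (Function.uncurry x) 2 ((volume.restrict (Set.Ioc 0 t)).prod P) := by
  refine memLp_uncurry_of_eLpNorm_le h.measurable_uncurry.aestronglyMeasurable two_ne_zero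
    (by simp) (C := ENNReal.ofReal √(R 0 + (∫ ω, x 0 ω ∂P) ^ 2)) ENNReal.ofReal_ne_top ?_
  filter_upwards [ae_restrict_mem measurableSet_Ioc] with s hs
  exact eLpNorm_two_le_of_integral_sq_le (h.memLp s hs.1.le) (h.integral_sq hs.1.le).le

lemma memLp_integral (h : IsWeaklyStationary P x R) (ht : 0 ≤ t) :
    MemLp (fun ω => ∫ s in (0 : ℝ)..t, x s ω) 2 P := by
  simp only [intervalIntegral.integral_of_le ht]
  exact memLp_integral_of_memLp_uncurry one_le_two (by simp) (h.memLp_uncurry t)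

lemma covariance_integral (h : IsWeaklyStationary P x R) {Z : Ω → ℝ} (hZ : MemLp Z 2 P)
    (ht : 0 ≤ t) :
    cov[Z, fun ω => ∫ s in (0 : ℝ)..t, x s ω; P] = ∫ s in (0 : ℝ)..t, cov[Z, x s; P] := by
  simp only [intervalIntegral.integral_of_le ht]
  exact covariance_integral_right hZ (h.memLp_uncurry t)

lemma covariance_integral_eq (h : IsWeaklyStationary P x R) (hs : 0 ≤ s) (ht : 0 ≤ t) :
    cov[x s, fun ω => ∫ u in (0 : ℝ)..t, x u ω; P] =
      (∫ u in (0 : ℝ)..s, R u) + ∫ u in (0 : ℝ)..t - s, R u := by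
  have h_even : ∫ u in (0 : ℝ)..t - s, R u = ∫ u in (s - t)..0, R u := by
    rw [← neg_sub t s, ← neg_zero, ← intervalIntegral.integral_comp_neg R, neg_zero]
    simp only [h.autocov_neg]
  calc cov[x s, fun ω => ∫ u in (0 : ℝ)..t, x u ω; P]
      = ∫ u in (0 : ℝ)..t, cov[x s, x u; P] := h.covariance_integral (h.memLp s hs) ht
    _ = ∫ u in (0 : ℝ)..t, R (s - u) := by
        refine intervalIntegral.integral_congr fun u hu => ?_
        rw [Set.uIcc_of_le ht] at hu
        exact h.covariance_eq s u hs hu.1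
    _ = ∫ u in (s - t)..s, R u := by rw [intervalIntegral.integral_comp_sub_left, sub_zero]
    _ = _ := by
        rw [h_even, add_comm, intervalIntegral.integral_add_adjacent_intervals
          (h.intervalIntegrable_autocov _ _) (h.intervalIntegrable_autocov _ _)]

lemma variance_integral (h : IsWeaklyStationary P x R) (ht : 0 ≤ t) :
    Var[fun ω => ∫ s in (0 : ℝ)..t, x s ω; P] =
      2 * ∫ s in (0 : ℝ)..t, ∫ u in (0 : ℝ)..s, R u := by
  have hG := h.continuous_integral_autocov
  have hG_sub : Continuous fun s => ∫ u in (0 : ℝ)..t - s, R u :=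
    hG.comp (continuous_const.sub continuous_id)
  rw [← covariance_self (h.memLp_integral ht).aemeasurable, h.covariance_integral
    (h.memLp_integral ht) ht]
  calc ∫ s in (0 : ℝ)..t, cov[fun ω => ∫ s in (0 : ℝ)..t, x s ω, x s; P]
      = ∫ s in (0 : ℝ)..t, ((∫ u in (0 : ℝ)..s, R u) + ∫ u in (0 : ℝ)..t - s, R u) := by
        refine intervalIntegral.integral_congr fun s hs => ?_
        rw [Set.uIcc_of_le ht] at hs
        exact (covariance_comm _ _).trans (h.covariance_integral_eq hs.1 ht)
    _ = _ := by
        rw [intervalIntegral.integral_add (hG.intervalIntegrable _ _)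
          (hG_sub.intervalIntegrable _ _),
          intervalIntegral.integral_comp_sub_left fun s => ∫ u in (0 : ℝ)..s, R u, sub_self,
          sub_zero, two_mul]

lemma variance_sub_add_integral (h : IsWeaklyStationary P x R) (θ : ℝ) (ht : 0 ≤ t) :
    Var[fun ω => x t ω - x 0 ω + θ * ∫ s in (0 : ℝ)..t, x s ω; P] = 2 * (R 0 - R t) +
      2 * θ ^ 2 * ∫ s in (0 : ℝ)..t, ∫ u in (0 : ℝ)..s, R u := by
  have h_sub : MemLp (fun ω => x t ω - x 0 ω) 2 P := (h.memLp t ht).sub (h.memLp 0 le_rfl)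
  have h_cov : cov[fun ω => x t ω - x 0 ω, fun ω => ∫ s in (0 : ℝ)..t, x s ω; P] = 0 := by
    rw [covariance_fun_sub_left (h.memLp t ht) (h.memLp 0 le_rfl) (h.memLp_integral ht),
      h.covariance_integral_eq ht ht, h.covariance_integral_eq le_rfl ht]
    simp
  rw [variance_fun_add h_sub ((h.memLp_integral ht).const_mul θ),
    covariance_const_mul_right, h_cov, variance_const_mul, h.variance_integral ht,
    h.variance_sub le_rfl ht, sub_zero]
  ring

end IsWeaklyStationary

end WeakStationarity

namespace IsContinuousFOU
variable {Ω : Type*} [MeasurableSpace Ω] {P : Measure Ω}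
  {H θ μ σ : ℝ} {b x : ℝ → Ω → ℝ} {R : ℝ → ℝ}

lemma covariance_eq_of_le (h : IsContinuousFOU P H θ μ σ b x) {s t : ℝ} (hs : 0 ≤ s)
    (hst : s ≤ t) : cov[x s, x t; P] = cov[x 0, x (t - s); P] := by
  have h_mean {u : ℝ} (hu : 0 ≤ u) : ∫ ω, x u ω ∂P = ∫ ω, x 0 ω ∂P :=
    (h.identDistrib hu).integral_eq
  have h_law := ((h.stationary s 0 (t - s) hs le_rfl (sub_nonneg.2 hst)).comp
    (u := fun p : ℝ × ℝ => (p.1 - ∫ ω, x 0 ω ∂P) * (p.2 - ∫ ω, x 0 ω ∂P)) (by fun_prop)).integral_eq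
  simp only [Function.comp_def, add_zero, add_sub_cancel] at h_law
  rw [covariance, covariance, h_mean hs, h_mean (hs.trans hst), h_mean (sub_nonneg.2 hst), h_law]

lemma noise_eq (h : IsContinuousFOU P H θ μ σ b x) {t : ℝ} (ht : 0 ≤ t) :
    ∀ᵐ ω ∂P, σ * b t ω = x t ω - x 0 ω + θ * (∫ s in (0 : ℝ)..t, x s ω) - θ * μ * t := by
  filter_upwards [h.equation] with ω hω
  have h_eq := hω t ht
  rw [intervalIntegral.integral_sub ((h.continuous ω).intervalIntegrable _ _) (by simp),
    intervalIntegral.integral_const, smul_eq_mul, sub_zero] at h_eq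
  linear_combination -h_eq

variable [IsProbabilityMeasure P]

lemma isWeaklyStationary (h : IsContinuousFOU P H θ μ σ b x) (hH : 0 ≤ H) (hθ : 0 < θ) :
    IsWeaklyStationary P x fun t => cov[x 0, x |t|; P] where
  measurable_uncurry := h.measurable_uncurry
  memLp _ ht := h.memLp hH hθ one_le_two (by simp) ht
  integral_eq _ ht := (h.identDistrib ht).integral_eq
  covariance_eq s t hs ht := by
    rcases le_total s t with hst | hst
    · rw [h.covariance_eq_of_le hs hst, abs_sub_comm, abs_of_nonneg (sub_nonneg.2 hst)]
    · rw [covariance_comm, h.covariance_eq_of_le ht hst, abs_of_nonneg (sub_nonneg.2 hst)]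

lemma autocovariance_equation (h : IsContinuousFOU P H θ μ σ b x) (hx : IsWeaklyStationary P x R)
    {t : ℝ} (ht : 0 ≤ t) : σ ^ 2 * t ^ (2 * H) = 2 * (R 0 - R t) +
      2 * θ ^ 2 * ∫ s in (0 : ℝ)..t, ∫ u in (0 : ℝ)..s, R u := by
  rw [← hx.variance_sub_add_integral θ ht, ← h.variance_noise t ht, ← variance_const_mul,
    variance_congr (h.noise_eq ht), variance_sub_const]
  exact (((hx.memLp t ht).sub (hx.memLp 0 le_rfl)).add
    ((hx.memLp_integral ht).const_mul θ)).aestronglyMeasurable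

lemma continuous_autocov (h : IsContinuousFOU P H θ μ σ b x) (hx : IsWeaklyStationary P x R)
    (hH : 0 ≤ H) : Continuous R := by
  have h_eq : R = fun t => R 0 - σ ^ 2 / 2 * |t| ^ (2 * H) +
      θ ^ 2 * ∫ s in (0 : ℝ)..|t|, ∫ u in (0 : ℝ)..s, R u := by
    funext t
    have h_abs : R |t| = R t := by rw [hx.autocov_eq_integral, abs_abs, ← hx.autocov_eq_integral]
    linarith [h.autocovariance_equation hx (abs_nonneg t)]
  have h_pow : Continuous fun t : ℝ => t ^ (2 * H) := Real.continuous_rpow_const (by linarith)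
  have h_prim : Continuous fun t => ∫ s in (0 : ℝ)..t, ∫ u in (0 : ℝ)..s, R u :=
    intervalIntegral.continuous_primitive
      (fun a c => hx.continuous_integral_autocov.intervalIntegrable a c) 0
  rw [h_eq]
  exact (continuous_const.sub (continuous_const.mul (h_pow.comp continuous_abs))).add
    (continuous_const.mul (h_prim.comp continuous_abs))

lemma autocov_eq_spectralCov (h : IsContinuousFOU P H θ μ σ b x) (hx : IsWeaklyStationary P x R)
    (h0 : 0 < H) (h1 : H < 1) (hθ : 0 < θ) {t : ℝ} (ht : 0 ≤ t) : R t = spectralCov H θ σ t :=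
  eq_spectralCov_of_autocovariance_equation h0 h1 hθ (h.continuous_autocov hx h0.le)
    (fun t _ => hx.abs_autocov_le t) (fun _ ht => h.autocovariance_equation hx ht) ht

lemma exists_hasRoughIncrements (h : IsContinuousFOU P H θ μ σ b x) (hH : 0 ≤ H) (hθ : 0 < θ)
    {T α : ℝ} (hT : 0 ≤ T) (h0 : 0 < α) (h1 : α < 1) (hα : α ≤ 2 * H) :
    ∃ C, 0 ≤ C ∧ HasRoughIncrements P (fun t => x (max t 0)) (· ^ α) T C := by
  have hx := h.isWeaklyStationary hH hθ
  obtain ⟨C, hC, hv⟩ := exists_isRoughVariance_of_autocovariance_equation h0 h1 hα hT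
    (h.continuous_autocov hx hH) (fun t _ => hx.abs_autocov_le t)
    (fun _ ht => h.autocovariance_equation hx ht)
  refine ⟨C, hC, fun t => hx.memLp _ (le_max_right t 0), _, hv, fun s t hs hst _ => ?_⟩
  rw [max_eq_left hs, max_eq_left (hs.trans hst)]
  exact hx.integral_sub_sq hs (hs.trans hst)

end IsContinuousFOU

/-! ### Limits along dissections -/

namespace Dissection
variable {T : ℝ}

lemma trapezoid_self (D : Dissection T) (x : ℝ → ℝ) :
    D.trapezoid x x = (x T - x 0) ^ 2 / 2 := by
  set primitive : ℕ → ℝ := fun k => x T * x (D.node k) - x (D.node k) ^ 2 / 2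
  calc D.trapezoid x x = ∑ k ∈ Finset.range D.n, (primitive (k + 1) - primitive k) :=
        Finset.sum_congr rfl fun k _ => by ring
    _ = (x T - x 0) ^ 2 / 2 := by
        rw [Finset.sum_range_sub]
        simp only [primitive, D.node_n, D.node_zero]
        ring

/-- The dissection of `[0, T]` into `n + 1` cells of equal length. -/
noncomputable def uniform (hT : 0 < T) (n : ℕ) : Dissection T where
  n := n + 1
  pt k := T * k / (n + 1)
  strictMono a b hab := by
    have h_lt : ((a : ℕ) : ℝ) < (b : ℕ) := by exact_mod_cast hab
    simp only
    gcongr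
  first := by simp
  last := by
    simp only [Fin.val_last, Nat.cast_add, Nat.cast_one]
    field_simp

lemma mesh_uniform_le (hT : 0 < T) (n : ℕ) : (uniform hT n).mesh ≤ T / (n + 1) := by
  have h_nonempty : Nonempty (Fin (uniform hT n).n) := ⟨⟨0, Nat.succ_pos n⟩⟩
  refine ciSup_le fun k => le_of_eq ?_
  change T * ((k.succ : ℕ) : ℝ) / (n + 1) - T * ((k.castSucc : ℕ) : ℝ) / (n + 1) = _
  rw [Fin.val_succ, Fin.val_castSucc, Nat.cast_add, Nat.cast_one]
  ring

lemma tendsto_mesh_uniform (hT : 0 < T) :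
    Tendsto (fun n => (uniform hT n).mesh) atTop (𝓝 0) :=
  squeeze_zero (fun n => mesh_nonneg _) (mesh_uniform_le hT)
    (by simpa [div_eq_mul_one_div T] using
      (tendsto_one_div_add_atTop_nhds_zero_nat (𝕜 := ℝ)).const_mul T)

/-- The dissection of `[0, T]` into a single cell. -/
def single (hT : 0 < T) : Dissection T where
  n := 1
  pt := ![0, T]
  strictMono := by
    rw [Fin.strictMono_iff_lt_succ]
    intro i
    fin_cases i
    simpa using hT
  first := rfl
  last := rfl

end Dissection

lemma ofReal_abs_sub_le_pVarDist {d : ℕ} {p T : ℝ} (hT : 0 < T) (hp : 2 ≤ p)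
    (A B : ℝ → ℝ → List (Fin d) → ℝ) (i j : Fin d) :
    ENNReal.ofReal |A 0 T [i, j] - B 0 T [i, j]| ≤ pVarDist p T A B := by
  have h_length : 1 ≤ [i, j].length ∧ [i, j].length ≤ ⌊p⌋₊ :=
    ⟨by simp, by simpa using Nat.le_floor (by exact_mod_cast hp)⟩
  have h_sum (f : Fin (Dissection.single hT).n → ℝ≥0∞) : ∑ k, f k = f ⟨0, Nat.one_pos⟩ :=
    Fin.sum_univ_one f
  have h_exponent : p / ([i, j].length : ℝ) * (([i, j].length : ℝ) / p) = 1 := by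
    have hp0 : p ≠ 0 := by linarith
    simp only [List.length_cons, List.length_nil]
    field_simp
  refine le_trans (le_of_eq ?_) (le_iSup₂_of_le [i, j] h_length
    (le_iSup_of_le (Dissection.single hT) le_rfl))
  rw [h_sum, ← ENNReal.rpow_mul, h_exponent, ENNReal.rpow_one]
  rfl

section Limits
variable {Ω : Type*} [MeasurableSpace Ω] {P : Measure Ω}

lemma exists_tendsto_eLpNorm_sub {E : Type*} [NormedAddCommGroup E] [CompleteSpace E] {p : ℝ≥0∞}
    [Fact (1 ≤ p)] {F : ℕ → Ω → E} (hF : ∀ n, MemLp (F n) p P) {ε : ℕ → ℝ≥0∞}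
    (hε : Tendsto ε atTop (𝓝 0)) (h : ∀ m n, eLpNorm (F m - F n) p P ≤ ε m + ε n) :
    ∃ S, MemLp S p P ∧ Tendsto (fun n => eLpNorm (F n - S) p P) atTop (𝓝 0) := by
  have h_cauchy : CauchySeq fun n => (hF n).toLp := by
    rw [EMetric.cauchySeq_iff]
    intro δ hδ
    obtain ⟨N, hN⟩ := eventually_atTop.1 (hε.eventually_lt_const (ENNReal.half_pos hδ.ne'))
    refine ⟨N, fun m hm n hn => ?_⟩
    rw [Lp.edist_toLp_toLp, ← ENNReal.add_halves δ]
    exact (h m n).trans_lt (ENNReal.add_lt_add (hN m hm) (hN n hn))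
  obtain ⟨S, hS⟩ := cauchySeq_tendsto_of_complete h_cauchy
  rw [Lp.tendsto_Lp_iff_tendsto_eLpNorm'] at hS
  exact ⟨S, Lp.memLp S, hS.congr fun n => eLpNorm_congr_ae ((hF n).coeFn_toLp.sub .rfl)⟩

lemma exists_memLp_limit_of_mesh {T : ℝ} (hT : 0 < T) {F : Dissection T → Ω → ℝ}
    (hF : ∀ D, MemLp (F D) 2 P) {g : ℝ → ℝ≥0∞} (hg : Tendsto g (𝓝 0) (𝓝 0))
    (h : ∀ D D', eLpNorm (F D - F D') 2 P ≤ g D.mesh + g D'.mesh) :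
    ∃ S : Ω → ℝ, MemLp S 2 P ∧ ∀ D : ℕ → Dissection T,
      Tendsto (fun n => (D n).mesh) atTop (𝓝 0) →
        Tendsto (fun n => eLpNorm (F (D n) - S) 2 P) atTop (𝓝 0) := by
  set U : ℕ → Dissection T := Dissection.uniform hT
  have hgU : Tendsto (fun n => g (U n).mesh) atTop (𝓝 0) :=
    hg.comp (Dissection.tendsto_mesh_uniform hT)
  obtain ⟨S, hS, hSU⟩ := exists_tendsto_eLpNorm_sub (fun n => hF (U n)) hgU fun m n => h _ _
  have h_bound (D : ℕ → Dissection T) (hD : Tendsto (fun n => (D n).mesh) atTop (𝓝 0)) :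
      Tendsto (fun n => g (D n).mesh + g (U n).mesh + eLpNorm (F (U n) - S) 2 P) atTop (𝓝 0) := by
    simpa only [add_zero, Function.comp_def] using ((hg.comp hD).add hgU).add hSU
  refine ⟨S, hS, fun D hD => tendsto_of_tendsto_of_tendsto_of_le_of_le tendsto_const_nhds
    (h_bound D hD) (fun _ => zero_le) fun n => ?_⟩
  calc eLpNorm (F (D n) - S) 2 P
      = eLpNorm ((F (D n) - F (U n)) + (F (U n) - S)) 2 P := by rw [sub_add_sub_cancel]
    _ ≤ eLpNorm (F (D n) - F (U n)) 2 P + eLpNorm (F (U n) - S) 2 P :=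
        eLpNorm_add_le ((hF _).sub (hF _)).aestronglyMeasurable
          ((hF _).sub hS).aestronglyMeasurable one_le_two
    _ ≤ _ := add_le_add (h _ _) le_rfl

lemma tendsto_integral_of_tendsto_eLpNorm {E : Type*} [NormedAddCommGroup E] [NormedSpace ℝ E]
    [IsProbabilityMeasure P] {p : ℝ≥0∞} (hp : 1 ≤ p) {F : ℕ → Ω → E} {S : Ω → E}
    (hF : ∀ n, MemLp (F n) p P) (hS : MemLp S p P)
    (h : Tendsto (fun n => eLpNorm (F n - S) p P) atTop (𝓝 0)) :
    Tendsto (fun n => ∫ ω, F n ω ∂P) atTop (𝓝 (∫ ω, S ω ∂P)) :=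
  tendsto_integral_of_L1' S hS.aestronglyMeasurable
    (Eventually.of_forall fun n => (hF n).integrable hp)
    (tendsto_of_tendsto_of_tendsto_of_le_of_le tendsto_const_nhds h (fun _ => zero_le) fun n =>
      eLpNorm_le_eLpNorm_of_exponent_le hp ((hF n).sub hS).aestronglyMeasurable)

lemma memLp_two_sq {f : Ω → ℝ} (hf : MemLp f 4 P) : MemLp (fun ω => f ω ^ 2) 2 P := by
  have h_inv : (4 : ℝ≥0∞)⁻¹ = 2⁻¹ / 2 := by
    rw [div_eq_mul_inv, ← ENNReal.mul_inv (by simp) (by simp)]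
    norm_num
  have h_holder : ENNReal.HolderTriple 4 4 2 := ⟨by rw [h_inv, ENNReal.add_halves]⟩
  simpa only [sq] using hf.mul' (r := 2) hf

lemma covariance_congr {X X' Y Y' : Ω → ℝ} (hX : X =ᵐ[P] X') (hY : Y =ᵐ[P] Y') :
    cov[X, Y; P] = cov[X', Y'; P] := by
  rw [covariance, covariance, integral_congr_ae hX, integral_congr_ae hY]
  refine integral_congr_ae ?_
  filter_upwards [hX, hY] with ω hXω hYω
  rw [hXω, hYω]

end Limits

section LevelTwoSignature
variable {Ω : Type*} {d : ℕ} {X : Fin d → ℝ≥0 → Ω → ℝ} {T : ℝ}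

lemma plSig_incrPath (X : Fin d → ℝ≥0 → Ω → ℝ) (hT : 0 < T) (D : Dissection T) (ω : Ω)
    (i j : Fin d) : plSig D (incrPath X ω) 0 T [i, j] =
      D.trapezoid (fun t => X i t.toNNReal ω) (fun t => X j t.toNNReal ω) := by
  rw [plSig_two hT]
  exact Finset.sum_congr rfl fun k _ => by simp only [incrPath]; ring

variable [MeasurableSpace Ω] {P : Measure Ω}

lemma measurable_plSig_incrPath (hX : ∀ i t, Measurable (X i t)) (hT : 0 < T) (D : Dissection T)
    (i j : Fin d) : Measurable fun ω => plSig D (incrPath X ω) 0 T [i, j] := by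
  simp only [plSig_incrPath X hT, Dissection.trapezoid]
  fun_prop

namespace IsLevelTwoSignature
variable {S S' : Fin d → Fin d → Ω → ℝ}

lemma tendstoInMeasure (hS : IsLevelTwoSignature P X T S) (hX : ∀ i t, Measurable (X i t))
    (hT : 0 < T) (i j : Fin d) :
    TendstoInMeasure P (fun n ω => plSig (Dissection.uniform hT n) (incrPath X ω) 0 T [i, j]) atTop
      (S i j) :=
  tendstoInMeasure_of_tendsto_eLpNorm two_ne_zero
    (fun _ => (measurable_plSig_incrPath hX hT _ i j).aestronglyMeasurable)
    (hS i j).1.aestronglyMeasurable ((hS i j).2 _ (Dissection.tendsto_mesh_uniform hT))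

lemma ae_eq (hS : IsLevelTwoSignature P X T S) (hS' : IsLevelTwoSignature P X T S')
    (hX : ∀ i t, Measurable (X i t)) (hT : 0 < T) (i j : Fin d) : S i j =ᵐ[P] S' i j :=
  tendstoInMeasure_ae_unique (hS.tendstoInMeasure hX hT i j) (hS'.tendstoInMeasure hX hT i j)

lemma congr (hS : IsLevelTwoSignature P X T S) (h : ∀ i j, S i j =ᵐ[P] S' i j) :
    IsLevelTwoSignature P X T S' := fun i j =>
  ⟨(hS i j).1.ae_eq (h i j), fun D hD => ((hS i j).2 D hD).congr fun _ =>
    eLpNorm_congr_ae (EventuallyEq.rfl.sub (h i j))⟩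

lemma ae_eq_of_isCanonicalLift (hS : IsLevelTwoSignature P X T S)
    (hX : ∀ i t, Measurable (X i t)) (hT : 0 < T) {p : ℝ} (hp : 2 ≤ p)
    {L : Ω → ℝ → ℝ → List (Fin d) → ℝ} (hL : IsCanonicalLift P X p T L) (i j : Fin d) :
    S i j =ᵐ[P] fun ω => L ω 0 T [i, j] := by
  refine tendstoInMeasure_ae_unique (hS.tendstoInMeasure hX hT i j) fun ε hε =>
    tendsto_of_tendsto_of_tendsto_of_le_of_le tendsto_const_nhds
      (hL.2 _ (Dissection.tendsto_mesh_uniform hT) ε hε) (fun _ => zero_le) fun n =>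
        measure_mono fun ω hω => ?_
  refine le_trans ?_ (ofReal_abs_sub_le_pVarDist hT hp _ _ i j)
  rwa [← Real.dist_eq, ← edist_dist]

end IsLevelTwoSignature

end LevelTwoSignature

/-! ### The stationary fractional Ornstein-Uhlenbeck process -/

lemma IsFBM.variance_eq {Ω : Type*} [MeasurableSpace Ω] {P : Measure Ω} {H : ℝ} (hH : 0 < H)
    {B : ℝ≥0 → Ω → ℝ} (hB : IsFBM P H B) (t : ℝ≥0) : Var[B t; P] = (t : ℝ) ^ (2 * H) := by
  rw [← covariance_self (hB.measurable t).aemeasurable, hB.covariance, sub_self, abs_zero,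
    Real.zero_rpow (by positivity)]
  ring

namespace IsStationaryFOU

variable {Ω : Type*} [MeasurableSpace Ω] {P : Measure Ω} {H : ℝ} {d : ℕ}
  {θ μ σ : Fin d → ℝ} {B X : Fin d → ℝ≥0 → Ω → ℝ} {i j : Fin d}

lemma identDistrib_prodMk (hX : IsStationaryFOU P H θ μ σ B X) (i : Fin d) (τ s t : ℝ≥0) :
    IdentDistrib (fun ω => (X i (τ + s) ω, X i (τ + t) ω)) (fun ω => (X i s ω, X i t ω)) P P := by
  have h_law := (hX.stationary τ 2 ![s, t]).comp
    (u := fun f : Fin 2 → Fin d → ℝ => (f 0 i, f 1 i)) (by fun_prop)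
  simpa only [Function.comp_def, Matrix.cons_val_zero, Matrix.cons_val_one] using h_law

lemma exists_isContinuousFOU (hX : IsStationaryFOU P H θ μ σ B X) (hH : 0 < H) (i : Fin d) :
    ∃ b x, IsContinuousFOU P H (θ i) (μ i) (σ i) b x ∧ ∀ t : ℝ≥0, x t =ᵐ[P] X i t := by
  obtain ⟨X', hX'_meas, hX'_cont, hX'_eq⟩ :=
    exists_continuous_modification (hX.measurable i) (hX.continuous i)
  obtain ⟨B', hB'_meas, hB'_cont, hB'_eq⟩ :=
    exists_continuous_modification (hX.fbm i).measurable (hX.fbm i).continuous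
  have hX'_ae t : X' t =ᵐ[P] X i t := hX'_eq.mono fun _ h => h t
  have hB'_ae t : B' t =ᵐ[P] B i t := hB'_eq.mono fun _ h => h t
  have h_pair s t : IdentDistrib (fun ω => (X' s ω, X' t ω)) (fun ω => (X i s ω, X i t ω)) P P :=
    .of_ae_eq (by fun_prop) ((hX'_ae s).prodMk (hX'_ae t))
  refine ⟨fun t => B' t.toNNReal, fun t => X' t.toNNReal, ?_, fun t => ?_⟩
  · exact {
      continuous_noise ω := (hB'_cont ω).comp continuous_real_toNNReal
      continuous ω := (hX'_cont ω).comp continuous_real_toNNReal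
      measurable_noise t := hB'_meas _
      measurable t := hX'_meas _
      equation := by
        filter_upwards [hX.equation i, hX'_eq, hB'_eq] with ω h_eq hXω hBω t ht
        simpa only [hXω, hBω, Real.toNNReal_zero, Real.coe_toNNReal t ht] using h_eq t.toNNReal
      stationary τ s t hτ hs ht := by
        simp only [Real.toNNReal_add hτ hs, Real.toNNReal_add hτ ht]
        exact (h_pair _ _).trans ((hX.identDistrib_prodMk i _ _ _).trans (h_pair _ _).symm)
      hasGaussianLaw_noise t :=
        ((hX.fbm i).gaussian.hasGaussianLaw_eval _).congr (hB'_ae _).symm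
      integral_noise t := (integral_congr_ae (hB'_ae _)).trans ((hX.fbm i).mean_zero _)
      variance_noise t ht := by
        rw [variance_congr (hB'_ae _), (hX.fbm i).variance_eq hH, Real.coe_toNNReal t ht] }
  · simpa only [Real.toNNReal_coe] using hX'_ae t

lemma autocov_eq_covariance {x : ℝ → Ω → ℝ} (hx : ∀ t : ℝ≥0, x t =ᵐ[P] X i t) (t : ℝ≥0) :
    autocov P X i t = cov[x 0, x |(t : ℝ)|; P] := by
  rw [NNReal.abs_eq]
  exact (covariance_congr (hx 0) (hx t)).symm

lemma indepFun (hX : IsStationaryFOU P H θ μ σ B X) (hij : i ≠ j) :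
    IndepFun (fun ω (t : ℝ) => X i t.toNNReal ω) (fun ω (t : ℝ) => X j t.toNNReal ω) P :=
  (hX.indep_coord.indepFun hij).comp (φ := fun (f : ℝ≥0 → ℝ) (t : ℝ) => f t.toNNReal)
    (ψ := fun (f : ℝ≥0 → ℝ) (t : ℝ) => f t.toNNReal) (by fun_prop) (by fun_prop)

lemma integral_eq (hX : IsStationaryFOU P H θ μ σ B X) (i : Fin d) (t : ℝ≥0) :
    ∫ ω, X i t ω ∂P = ∫ ω, X i 0 ω ∂P := by
  simpa using ((hX.identDistrib_prodMk i t 0 0).comp measurable_fst).integral_eq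

variable [IsProbabilityMeasure P]

lemma memLp (hX : IsStationaryFOU P H θ μ σ B X) (hH : 0 < H) (hθ : 0 < θ i) {p : ℝ≥0∞}
    (h1 : 1 ≤ p) (hp : p ≠ ∞) (t : ℝ≥0) : MemLp (X i t) p P := by
  obtain ⟨b, x, h, hx⟩ := hX.exists_isContinuousFOU hH i
  exact (h.memLp hH.le hθ h1 hp t.2).ae_eq (hx t)

lemma memLp_two (hX : IsStationaryFOU P H θ μ σ B X) (hH : 0 < H) (hθ : 0 < θ i) (t : ℝ≥0) :
    MemLp (X i t) 2 P :=
  hX.memLp hH hθ one_le_two (by simp) t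

lemma integral_sub_sq (hX : IsStationaryFOU P H θ μ σ B X) (hH : 0 < H) (hθ : 0 < θ i) (t : ℝ≥0) :
    ∫ ω, (X i t ω - X i 0 ω) ^ 2 ∂P = 2 * (autocov P X i 0 - autocov P X i t) := by
  obtain ⟨b, x, h, hx⟩ := hX.exists_isContinuousFOU hH i
  have h_sq := (h.isWeaklyStationary hH.le hθ).integral_sub_sq le_rfl t.2
  rw [autocov_eq_covariance hx, autocov_eq_covariance hx, NNReal.coe_zero]
  rw [sub_zero] at h_sq
  refine Eq.trans (integral_congr_ae ?_) h_sq
  filter_upwards [hx t, hx 0] with ω h_t h_zero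
  rw [← h_t, ← h_zero, NNReal.coe_zero]
  rfl

lemma exists_hasRoughIncrements (hX : IsStationaryFOU P H θ μ σ B X) (hH : 0 < H) (hθ : 0 < θ i)
    {T α : ℝ} (hT : 0 ≤ T) (h0 : 0 < α) (h1 : α < 1) (hα : α ≤ 2 * H) :
    ∃ C, 0 ≤ C ∧ HasRoughIncrements P (fun t => X i t.toNNReal) (· ^ α) T C := by
  obtain ⟨b, x, h, hx⟩ := hX.exists_isContinuousFOU hH i
  obtain ⟨C, hC, hx_rough⟩ := h.exists_hasRoughIncrements hH.le hθ hT h0 h1 hα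
  exact ⟨C, hC, hx_rough.congr fun t => hx t.toNNReal⟩

lemma autocov_sub_eq (hX : IsStationaryFOU P H θ μ σ B X) (h0 : 0 < H) (h1 : H < 1)
    (hθ : 0 < θ i) (t : ℝ≥0) :
    autocov P X i 0 - autocov P X i t = 2 * fouZeta H (θ i) (σ i) *
      ∫ l in Set.Ioi (0 : ℝ), (1 - Real.cos (l * t)) * fouSpectral H (θ i) l := by
  obtain ⟨b, x, h, hx⟩ := hX.exists_isContinuousFOU h0 i
  have h_stat := h.isWeaklyStationary h0.le hθ
  have h_cov (s : ℝ≥0) : autocov P X i s = spectralCov H (θ i) (σ i) s :=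
    (autocov_eq_covariance hx s).trans (h.autocov_eq_spectralCov h_stat h0 h1 hθ s.2)
  rw [h_cov, h_cov, NNReal.coe_zero]
  exact spectralCov_zero_sub h0 h1 hθ (σ i) t

section LevelTwo
variable {T : ℝ}

lemma memLp_plSig (hX : IsStationaryFOU P H θ μ σ B X) (hH : 0 < H) (hθ : ∀ i, 0 < θ i)
    (hT : 0 < T) (D : Dissection T) (i j : Fin d) :
    MemLp (fun ω => plSig D (incrPath X ω) 0 T [i, j]) 2 P := by
  simp only [plSig_incrPath X hT]
  rcases eq_or_ne i j with rfl | hij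
  · have h_four t : MemLp (X i t) 4 P := hX.memLp hH (hθ i) (by norm_num) (by simp) t
    simp only [Dissection.trapezoid_self, div_eq_mul_inv]
    exact (memLp_two_sq ((h_four _).sub (h_four _))).mul_const _
  · exact D.memLp_trapezoid_of_indep (fun _ => hX.memLp_two hH (hθ i) _)
      (fun _ => hX.memLp_two hH (hθ j) _) (hX.indepFun hij)

lemma integral_plSig (hX : IsStationaryFOU P H θ μ σ B X) (hH : 0 < H) (hθ : ∀ i, 0 < θ i)
    {T : ℝ≥0} (hT : 0 < T) (D : Dissection T) (i j : Fin d) :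
    ∫ ω, plSig D (incrPath X ω) 0 T [i, j] ∂P =
      if i = j then autocov P X i 0 - autocov P X i T else 0 := by
  simp only [plSig_incrPath X (NNReal.coe_pos.2 hT)]
  rcases eq_or_ne i j with rfl | hij
  · simp only [Dissection.trapezoid_self, Real.toNNReal_coe, Real.toNNReal_zero, if_true]
    rw [integral_div, hX.integral_sub_sq hH (hθ i), mul_div_cancel_left₀ _ two_ne_zero]
  · rw [if_neg hij]
    exact D.integral_trapezoid_of_indep (fun _ => hX.memLp_two hH (hθ i) _)
      (fun _ => hX.memLp_two hH (hθ j) _) (hX.indepFun hij)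
      fun _ _ => (hX.integral_eq i _).trans (hX.integral_eq i _).symm

lemma exists_tendsto_eLpNorm_plSig_sub_le (hX : IsStationaryFOU P H θ μ σ B X) (hH : 1 / 4 < H)
    (hθ : ∀ i, 0 < θ i) (hT : 0 < T) (i j : Fin d) :
    ∃ g : ℝ → ℝ≥0∞, Tendsto g (𝓝 0) (𝓝 0) ∧ ∀ D D' : Dissection T,
      eLpNorm (fun ω => plSig D (incrPath X ω) 0 T [i, j] - plSig D' (incrPath X ω) 0 T [i, j]) 2 P
        ≤ g D.mesh + g D'.mesh := by
  have hH0 : 0 < H := by linarith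
  simp only [plSig_incrPath X hT]
  rcases eq_or_ne i j with rfl | hij
  · refine ⟨fun _ => 0, tendsto_const_nhds, fun D D' => ?_⟩
    simp only [Dissection.trapezoid_self, sub_self, eLpNorm_zero', zero_le]
  · have h_half : 1 / 2 < min (2 * H) (3 / 4) := lt_min (by linarith) (by norm_num)
    have h_one : min (2 * H) (3 / 4) < 1 := (min_le_right _ _).trans_lt (by norm_num)
    have h_rough k := hX.exists_hasRoughIncrements hH0 (hθ k) hT.le (by linarith) h_one
      (min_le_left _ _)
    obtain ⟨C, hC, hXi⟩ := h_rough i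
    obtain ⟨C', -, hXj⟩ := h_rough j
    exact hXi.exists_tendsto_eLpNorm_trapezoid_sub_le h_half h_one.le hXj hC (hX.indepFun hij)

theorem exists_isLevelTwoSignature (hX : IsStationaryFOU P H θ μ σ B X) (hH : 1 / 4 < H)
    (hθ : ∀ i, 0 < θ i) (hT : 0 < T) : ∃ S, IsLevelTwoSignature P X T S := by
  have h_limit (i j : Fin d) : ∃ S : Ω → ℝ, MemLp S 2 P ∧ ∀ D : ℕ → Dissection T,
      Tendsto (fun n => (D n).mesh) atTop (𝓝 0) → Tendsto (fun n => eLpNorm (fun ω =>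
        plSig (D n) (incrPath X ω) 0 T [i, j] - S ω) 2 P) atTop (𝓝 0) := by
    obtain ⟨g, hg, hgD⟩ := hX.exists_tendsto_eLpNorm_plSig_sub_le hH hθ hT i j
    exact exists_memLp_limit_of_mesh (F := fun D ω => plSig D (incrPath X ω) 0 T [i, j]) hT
      (fun D => hX.memLp_plSig (by linarith) hθ hT D i j) hg hgD
  choose S hS using h_limit
  exact ⟨S, hS⟩

theorem isLevelTwoSignature_of_isCanonicalLift (hX : IsStationaryFOU P H θ μ σ B X)
    (hH : 1 / 4 < H) (hθ : ∀ i, 0 < θ i) (hT : 0 < T) {p : ℝ} (hp : 2 ≤ p)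
    {L : Ω → ℝ → ℝ → List (Fin d) → ℝ} (hL : IsCanonicalLift P X p T L) :
    IsLevelTwoSignature P X T fun i j ω => L ω 0 T [i, j] := by
  obtain ⟨S, hS⟩ := hX.exists_isLevelTwoSignature hH hθ hT
  exact hS.congr (hS.ae_eq_of_isCanonicalLift hX.measurable hT hp hL)

theorem integral_levelTwoSignature (hX : IsStationaryFOU P H θ μ σ B X) (hH : 0 < H)
    (hθ : ∀ i, 0 < θ i) {T : ℝ≥0} (hT : 0 < T) {S : Fin d → Fin d → Ω → ℝ}
    (hS : IsLevelTwoSignature P X T S) (i j : Fin d) :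
    ∫ ω, S i j ω ∂P = if i = j then autocov P X i 0 - autocov P X i T else 0 := by
  have hT' : (0 : ℝ) < T := NNReal.coe_pos.2 hT
  have h_lim := tendsto_integral_of_tendsto_eLpNorm one_le_two
    (fun n => hX.memLp_plSig hH hθ hT' (Dissection.uniform hT' n) i j) (hS i j).1
    ((hS i j).2 _ (Dissection.tendsto_mesh_uniform hT'))
  simp only [hX.integral_plSig hH hθ hT] at h_lim
  exact tendsto_nhds_unique h_lim tendsto_const_nhds

end LevelTwo

end IsStationaryFOU

theorem mainTheorem9 {Ω : Type*} [MeasurableSpace Ω] (P : Measure Ω) [IsProbabilityMeasure P]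
    {d : ℕ} (H : ℝ) (hH : 1 / 4 < H) (hH1 : H < 1)
    (θ μ σ : Fin d → ℝ) (hθ : ∀ i, 0 < θ i) (hσ : ∀ i, 0 < σ i)
    (B X : Fin d → ℝ≥0 → Ω → ℝ) (hX : IsStationaryFOU P H θ μ σ B X)
    (Δ : ℝ≥0) (hΔ : 0 < Δ) :
    -- the level-2 signature over `[0, Δ]` exists, it is unique up to null sets, and its
    -- expectation is finite with the stated value
    (∃ S, IsLevelTwoSignature P X Δ S) ∧
    (∀ S S', IsLevelTwoSignature P X Δ S → IsLevelTwoSignature P X Δ S' →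
      ∀ i j, S i j =ᵐ[P] S' i j) ∧
    (∀ S, IsLevelTwoSignature P X Δ S → ∀ i j, Integrable (S i j) P ∧
      ∫ ω, S i j ω ∂P = if i = j then autocov P X i 0 - autocov P X i Δ else 0) ∧
    -- the same for the level-2 component of the canonical geometric rough path lift
    (∀ p : ℝ, max 2 (1 / H) < p → ∀ L, IsCanonicalLift P X p Δ L →
      IsLevelTwoSignature P X Δ (fun i j ω => L ω 0 Δ [i, j]) ∧
      ∀ i j, Integrable (fun ω => L ω 0 Δ [i, j]) P ∧
        ∫ ω, L ω 0 Δ [i, j] ∂P = if i = j then autocov P X i 0 - autocov P X i Δ else 0) ∧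
    -- the diagonal value is a spectral integral
    (∀ i, (∀ t, MemLp (X i t) 2 P) ∧
      IntegrableOn (fouSpectral H (θ i)) (Set.Ioi 0) ∧
      IntegrableOn (fun l => (1 - Real.cos (l * Δ)) * fouSpectral H (θ i) l) (Set.Ioi 0) ∧
      autocov P X i 0 - autocov P X i Δ =
        2 * fouZeta H (θ i) (σ i) *
          ∫ l in Set.Ioi (0 : ℝ), (1 - Real.cos (l * Δ)) * fouSpectral H (θ i) l) := by
  have hH0 : 0 < H := by linarith
  have hΔ' : (0 : ℝ) < Δ := NNReal.coe_pos.2 hΔ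
  have h_expectation (S) (hS : IsLevelTwoSignature P X Δ S) (i j) : Integrable (S i j) P ∧
      ∫ ω, S i j ω ∂P = if i = j then autocov P X i 0 - autocov P X i Δ else 0 :=
    ⟨(hS i j).1.integrable one_le_two, hX.integral_levelTwoSignature hH0 hθ hΔ hS i j⟩
  refine ⟨hX.exists_isLevelTwoSignature hH hθ hΔ',
    fun S S' hS hS' => hS.ae_eq hS' hX.measurable hΔ', h_expectation, fun p hp L hL => ?_,
    fun i => ⟨hX.memLp_two hH0 (hθ i), integrableOn_fouSpectral hH0 hH1 (hθ i), ?_,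
      hX.autocov_sub_eq hH0 hH1 (hθ i) Δ⟩⟩
  · have hL_sig := hX.isLevelTwoSignature_of_isCanonicalLift hH hθ hΔ'
      ((le_max_left _ _).trans hp.le) hL
    exact ⟨hL_sig, h_expectation _ hL_sig⟩
  · refine integrableOn_mul_fouSpectral (c := 2) hH0 hH1 (hθ i) (by fun_prop) fun l _ => ?_
    rw [abs_le]
    constructor <;> linarith [Real.neg_one_le_cos (l * Δ), Real.cos_le_one (l * Δ)]
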